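/- Let $\mathfrak H=\{z=x+iy : y>0\}$, $q=e^{2\pi i z}$ and $\mathbb L=\log|q|=-2\pi y$. For integers $r,s$ let $\mathcal M_{r,s}$ be the complex vector space of real analytic functions $f:\mathfrak H\to\mathbb C$ such that $$f\Big(\frac{az+b}{cz+d}\Big)=(cz+d)^r(c\overline z+d)^s f(z)\qquad\text{for all }\begin{pmatrix}a&b\\c&d\end{pmatrix}\in\mathrm{SL}_2(\mathbb Z),$$ and which admit an expansion in $\mathbb C[[q,\overline q]][\mathbb L^{\pm}]$ at the cusp, i.e. for all $z$ with $\mathrm{Im}(z)$ sufficiently large, $f(z)=\sum_{k=-N}^{N}\sum_{m,n\ge 0}a^{(k)}_{m,n}\mathbb L^kq^m\overline q^n$ for some $N\in\mathbb N$ and $a^{(k)}_{m,n}\in\mathbb C$, with absolutely convergent power series in $q,\overline q$. Let $\mathcal M=\bigoplus_{r,s\in\mathbb Z}\mathcal M_{r,s}$, with the bigraded product given by multiplication of functions; thus $\mathbb L^{k}\in\mathcal M_{-k,-k}$ for all $k\in\mathbb Z$. Let $\Delta$ be the operator on $\mathcal M$ which acts on $\mathcal M_{r,s}$ by $$\Delta_{r,s}=-\overline\partial_{s-1}\partial_r+r(s-1),\qquad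 \partial_r=(z-\overline z)\frac{\partial}{\partial z}+r,\quad \overline\partial_s=(\overline z-z)\frac{\partial}{\partial\overline z}+s .$$ For integers $r,s\ge0$ with $w=r+s>0$ even, let $$\mathcal E_{r,s}(z)=\frac{w!}{(2\pi i)^{w+2}}\,\frac12\sum_{(m,n)\in\mathbb Z^2\setminus\{(0,0)\}}\frac{\mathbb L}{(mz+n)^{r+1}(m\overline z+n)^{s+1}},$$ placed in bidegree $(r,s)$. Let $\widetilde M=M[\mathbb G_2^*]$ be the ring of almost holomorphic modular forms, generated by the ring $M$ of holomorphic modular forms for $\mathrm{SL}_2(\mathbb Z)$ (those of weight $n$ being placed in bidegree $(n,0)$) and by $\mathbb G_2^*=-\frac1{24}+\sum_{n\ge1}\sigma_1(n)q^n-\frac1{4\mathbb L}$ in bidegree $(2,0)$. **Theorem.** Let $F\in\mathcal M$ be a non-zero eigenfunction of $\Delta$, i.e. $\Delta F=\lambda F$ for some $\lambda\in\mathbb C$. Then $\lambda\in\mathbb Z$, and $F$ is a linear combination, with coefficients in $\mathbb C[\mathbb L^{\pm}]$, of the functions $\mathcal E_{r,s}$ ($r,s\ge0$, $r+s>0$ even),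 elements of $\widetilde M$, and complex conjugates of elements of $\widetilde M$ (complex conjugation exchanges the bidegrees $(r,s)$ and $(s,r)$). -/

import Mathlib

noncomputable section

namespace BigradedModular

open Complex
open UpperHalfPlane hiding I
open scoped MatrixGroups ComplexConjugate

/-- The variable `q = exp(2πiz)`. -/
def qVar (z : ℍ) : ℂ := cexp (2 * Real.pi * I * z)

/-- The function `𝕃 = log |q| = iπ(z - z̄) = -2π Im z`. -/
def LL (z : ℍ) : ℂ := -2 * Real.pi * (z.im : ℂ)

/-- `f` is real analytic on the upper half plane (viewed as an open subset of `ℂ = ℝ²`). -/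
def IsRealAnalytic (f : ℍ → ℂ) : Prop :=
  AnalyticOnNhd ℝ (f ∘ ofComplex) {z : ℂ | 0 < z.im}

/-- `f` is modular of weights `(r, s)` for `SL₂(ℤ)`:
`f (γ z) = (cz + d)^r (c z̄ + d)^s f(z)`. -/
def IsBimodular (r s : ℤ) (f : ℍ → ℂ) : Prop :=
  ∀ (γ : SL(2, ℤ)) (z : ℍ),
    f (γ • z) = ((γ 1 0 : ℂ) * z + (γ 1 1 : ℂ)) ^ r *
      ((γ 1 0 : ℂ) * conj (z : ℂ) + (γ 1 1 : ℂ)) ^ s * f z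

/-- The term `a_{m,n} q^m q̄^n` of a power series in `q, q̄` with coefficients `a`. -/
def qTerm (a : ℕ × ℕ → ℂ) (z : ℍ) (p : ℕ × ℕ) : ℂ :=
  a p * qVar z ^ p.1 * conj (qVar z) ^ p.2

/-- `f` admits an expansion in `ℂ[[q, q̄]][𝕃^±]` at the cusp: there are finitely many power series
`a^{(k)}` in `q, q̄` (`k ∈ ℤ`) which converge (absolutely) at all points of sufficiently large
imaginary part, and there `f = ∑_k 𝕃^k ∑_{m,n} a^{(k)}_{m,n} q^m q̄^n`. -/
def HasCuspExpansion (f : ℍ → ℂ) : Prop :=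
  ∃ (a : ℤ →₀ (ℕ × ℕ → ℂ)) (Y : ℝ), ∀ z : ℍ, Y < z.im →
    (∀ k, Summable (qTerm (a k) z)) ∧
      f z = ∑ k ∈ a.support, LL z ^ k * ∑' p, qTerm (a k) z p

lemma qTerm_add (a b : ℕ × ℕ → ℂ) (z : ℍ) : qTerm (a + b) z = qTerm a z + qTerm b z := by
  funext p; simp only [qTerm, Pi.add_apply]; ring

lemma qTerm_smul (c : ℂ) (a : ℕ × ℕ → ℂ) (z : ℍ) : qTerm (c • a) z = c • qTerm a z := by
  funext p; simp only [qTerm, Pi.smul_apply, smul_eq_mul]; ring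

lemma qTerm_zero (z : ℍ) : qTerm 0 z = 0 := by
  funext p; simp [qTerm]

lemma HasCuspExpansion.zero : HasCuspExpansion 0 :=
  ⟨0, 0, fun z _ => ⟨fun k => by rw [Finsupp.zero_apply, qTerm_zero]; exact summable_zero, by simp⟩⟩

lemma sum_support_of_subset (a : ℤ →₀ (ℕ × ℕ → ℂ)) (S : Finset ℤ) (h : a.support ⊆ S) (z : ℍ) :
    ∑ k ∈ a.support, LL z ^ k * ∑' p, qTerm (a k) z p =
      ∑ k ∈ S, LL z ^ k * ∑' p, qTerm (a k) z p := by
  refine Finset.sum_subset h fun k _ hk => ?_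
  rw [Finsupp.notMem_support_iff.mp hk, qTerm_zero]
  simp

lemma HasCuspExpansion.add {f g : ℍ → ℂ} (hf : HasCuspExpansion f) (hg : HasCuspExpansion g) :
    HasCuspExpansion (f + g) := by
  classical
  obtain ⟨a, Y, ha⟩ := hf
  obtain ⟨b, Y', hb⟩ := hg
  refine ⟨a + b, max Y Y', fun z hz => ?_⟩
  obtain ⟨ha1, ha2⟩ := ha z (lt_of_le_of_lt (le_max_left _ _) hz)
  obtain ⟨hb1, hb2⟩ := hb z (lt_of_le_of_lt (le_max_right _ _) hz)
  refine ⟨fun k => ?_, ?_⟩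
  · rw [Finsupp.add_apply, qTerm_add]
    exact (ha1 k).add (hb1 k)
  · rw [Pi.add_apply, ha2, hb2,
      sum_support_of_subset a (a.support ∪ b.support) Finset.subset_union_left,
      sum_support_of_subset b (a.support ∪ b.support) Finset.subset_union_right,
      sum_support_of_subset (a + b) (a.support ∪ b.support) Finsupp.support_add,
      ← Finset.sum_add_distrib]
    refine Finset.sum_congr rfl fun k _ => ?_
    rw [← mul_add, Finsupp.add_apply, qTerm_add, ← (ha1 k).tsum_add (hb1 k)]
    rfl

lemma HasCuspExpansion.smul {f : ℍ → ℂ} (c : ℂ) (hf : HasCuspExpansion f) :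
    HasCuspExpansion (c • f) := by
  obtain ⟨a, Y, ha⟩ := hf
  refine ⟨c • a, Y, fun z hz => ?_⟩
  obtain ⟨ha1, ha2⟩ := ha z hz
  refine ⟨fun k => ?_, ?_⟩
  · rw [Finsupp.smul_apply, qTerm_smul]
    exact (ha1 k).const_smul c
  · rw [Pi.smul_apply, ha2, sum_support_of_subset (c • a) a.support Finsupp.support_smul,
      Finset.smul_sum]
    refine Finset.sum_congr rfl fun k _ => ?_
    rw [Finsupp.smul_apply, qTerm_smul, ← mul_smul_comm, ← tsum_const_smul'']
    rfl

/-- The space `𝓜_{r,s}` of real analytic modular functions of weights `(r, s)` which admit an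
expansion in `ℂ[[q, q̄]][𝕃^±]`. -/
def MSpace (r s : ℤ) : Submodule ℂ (ℍ → ℂ) where
  carrier := {f | IsRealAnalytic f ∧ IsBimodular r s f ∧ HasCuspExpansion f}
  zero_mem' := ⟨fun _ _ => analyticAt_const, fun γ z => by simp, HasCuspExpansion.zero⟩
  add_mem' := fun {f g} hf hg =>
    ⟨fun z hz => (hf.1 z hz).add (hg.1 z hz),
      fun γ z => by
        rw [Pi.add_apply, Pi.add_apply, hf.2.1 γ z, hg.2.1 γ z]; ring,
      hf.2.2.add hg.2.2⟩
  smul_mem' := fun c f hf =>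
    ⟨fun z hz => analyticAt_const.smul (hf.1 z hz),
      fun γ z => by
        rw [Pi.smul_apply, Pi.smul_apply, hf.2.1 γ z]; simp only [smul_eq_mul]; ring,
      hf.2.2.smul c⟩

/-- The bigraded commutative algebra of all finite formal sums `∑ f_{r,s}` of functions
`f_{r,s} : ℍ → ℂ` placed in bidegree `(r, s) ∈ ℤ × ℤ`; the product of `f` in bidegree `(r, s)` and
`g` in bidegree `(k, l)` is the pointwise product `fg` in bidegree `(r + k, s + l)`. -/
abbrev BigradedFun : Type := AddMonoidAlgebra (ℍ → ℂ) (ℤ × ℤ)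

/-- The function `f` placed in bidegree `(r, s)`. -/
def inDeg (r s : ℤ) (f : ℍ → ℂ) : BigradedFun := AddMonoidAlgebra.single (r, s) f

/-- The bigraded space `𝓜 = ⨁_{r,s} 𝓜_{r,s}`. -/
def MTotal : Submodule ℂ BigradedFun where
  carrier := {F | ∀ r s : ℤ, F.coeff (r, s) ∈ MSpace r s}
  zero_mem' := fun r s => (MSpace r s).zero_mem
  add_mem' := fun hF hG r s => (MSpace r s).add_mem (hF r s) (hG r s)
  smul_mem' := fun c _ hF r s => (MSpace r s).smul_mem c (hF r s)

/-- The Wirtinger derivative `∂f/∂z = (∂f/∂x - i ∂f/∂y) / 2`. -/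
def wirtinger (f : ℍ → ℂ) (z : ℍ) : ℂ :=
  (fderiv ℝ (f ∘ ofComplex) (z : ℂ) 1 - I * fderiv ℝ (f ∘ ofComplex) (z : ℂ) I) / 2

/-- The Wirtinger derivative `∂f/∂z̄ = (∂f/∂x + i ∂f/∂y) / 2`. -/
def wirtingerBar (f : ℍ → ℂ) (z : ℍ) : ℂ :=
  (fderiv ℝ (f ∘ ofComplex) (z : ℂ) 1 + I * fderiv ℝ (f ∘ ofComplex) (z : ℂ) I) / 2

/-- The operator `∂_r = (z - z̄) ∂/∂z + r`. -/
def maass (r : ℤ) (f : ℍ → ℂ) (z : ℍ) : ℂ :=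
  ((z : ℂ) - conj (z : ℂ)) * wirtinger f z + r * f z

/-- The operator `∂̄_s = (z̄ - z) ∂/∂z̄ + s`. -/
def maassBar (s : ℤ) (f : ℍ → ℂ) (z : ℍ) : ℂ :=
  (conj (z : ℂ) - (z : ℂ)) * wirtingerBar f z + s * f z

/-- The Laplace operator `Δ_{r,s} = -∂̄_{s-1} ∂_r + r (s - 1)`. -/
def laplace (r s : ℤ) (f : ℍ → ℂ) (z : ℍ) : ℂ :=
  -maassBar (s - 1) (maass r f) z + r * (s - 1) * f z

/-- The bigraded Laplace operator `Δ`, which acts in bidegree `(r, s)` as `Δ_{r,s}`. -/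
def bigradedLaplace (F : BigradedFun) : BigradedFun :=
  ∑ p ∈ F.coeff.support, inDeg p.1 p.2 (laplace p.1 p.2 (F.coeff p))

/-- `F ∈ 𝓜` is an eigenfunction of `Δ` with eigenvalue `lam`. -/
def IsEigenfunction (F : BigradedFun) (lam : ℂ) : Prop :=
  F ∈ MTotal ∧ F ≠ 0 ∧ bigradedLaplace F = lam • F

/-- `𝕃`, an element of bidegree `(-1, -1)`. -/
def LElt : BigradedFun := inDeg (-1) (-1) LL

/-- `𝕃⁻¹`, an element of bidegree `(1, 1)`. -/
def LInvElt : BigradedFun := inDeg 1 1 fun z => (LL z)⁻¹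

/-- The algebra `ℂ[𝕃^±]` of Laurent polynomials in `𝕃`. -/
def LaurentL : Subalgebra ℂ BigradedFun := Algebra.adjoin ℂ {LElt, LInvElt}

/-- The real analytic Eisenstein series
`ℰ_{r,s}(z) = w! / (2πi)^{w+2} · (1/2) ∑_{(m,n) ≠ (0,0)} 𝕃 / ((mz+n)^{r+1} (m z̄+n)^{s+1})`,
where `w = r + s`. -/
def eisenstein (r s : ℕ) (z : ℍ) : ℂ :=
  ((r + s).factorial : ℂ) / (2 * Real.pi * I) ^ (r + s + 2) * (1 / 2) *
    ∑' p : {p : ℤ × ℤ // p ≠ 0},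
      LL z / (((p.1.1 : ℂ) * z + (p.1.2 : ℂ)) ^ (r + 1) *
        ((p.1.1 : ℂ) * conj (z : ℂ) + (p.1.2 : ℂ)) ^ (s + 1))

/-- The set of all `ℰ_{r,s}` (`r, s ≥ 0`, `r + s > 0` even), each in bidegree `(r, s)`. -/
def eisensteinSet : Set BigradedFun :=
  {E | ∃ r s : ℕ, 0 < r + s ∧ Even (r + s) ∧ E = inDeg r s (eisenstein r s)}

/-- The modified weight two Eisenstein series
`𝔾₂^* = -1/24 + ∑_{n ≥ 1} σ₁(n) q^n - 1 / (4𝕃)`. -/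
def G2star (z : ℍ) : ℂ :=
  -1 / 24 + ∑' n : ℕ+, (ArithmeticFunction.sigma 1 n : ℂ) * qVar z ^ (n : ℕ) - 1 / (4 * LL z)

/-- The holomorphic modular forms of level one, those of weight `n` in bidegree `(n, 0)`. -/
def holomorphicSet : Set BigradedFun :=
  {G | ∃ (n : ℤ) (f : ModularForm 𝒮ℒ n), G = inDeg n 0 f}

/-- The ring `M[𝔾₂^*]` of almost holomorphic modular forms. -/
def almostHolomorphic : Subalgebra ℂ BigradedFun :=
  Algebra.adjoin ℂ (holomorphicSet ∪ {inDeg 2 0 G2star})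

/-- Complex conjugation, which sends `f` in bidegree `(r, s)` to `f̄` in bidegree `(s, r)`. -/
def bigradedConj : BigradedFun →+* BigradedFun :=
  (AddMonoidAlgebra.mapRingHom (ℤ × ℤ) (starRingEnd (ℍ → ℂ))).comp
    (AddMonoidAlgebra.mapDomainRingHom (ℍ → ℂ)
      (AddEquiv.prodComm : ℤ × ℤ ≃+ ℤ × ℤ).toAddMonoidHom)

lemma bigradedConj_inDeg (r s : ℤ) (f : ℍ → ℂ) :
    bigradedConj (inDeg r s f) = inDeg s r fun z => conj (f z) := by
  simp only [bigradedConj, inDeg, RingHom.comp_apply, AddMonoidAlgebra.mapDomainRingHom_apply,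
    AddMonoidAlgebra.mapDomain_single, AddMonoidAlgebra.coe_mapRingHom]
  rw [AddMonoidAlgebra.map_single]
  rfl

end BigradedModular

end

noncomputable section

namespace BigradedModular

open Complex Filter Topology
open UpperHalfPlane hiding I
open scoped MatrixGroups ComplexConjugate ContDiff ModularForm

/-! Multiplication by 𝕃^k commutes with ∂ and ∂̄ up to a shift of the weights, so every eigenvalue
problem can be moved to the eigenvalue zero. On expansions at the cusp, Δ_{r,s} sends 𝕃^k q^m q̄^n
to -k(k+r+s-1) times itself plus terms with higher powers of 𝕃 and the same m, n. The least power of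
𝕃 that occurs beside some q^m q̄^n therefore forces λ = -k(k+r+s-1) with k an integer
(`exists_eigenvalue_eq`, which rests on the uniqueness of expansions, `Expands.coeff_eq_zero`). Then
𝕃^{-k} f is harmonic, that is, of eigenvalue zero (`isHarmonic_of_laplace`). Since -1 acts trivially
on ℍ, r+s is even; replacing k by 1-(r+s)-k if necessary, the harmonic function has total weight at
least two.

A harmonic f of weights (r,s) satisfies ∂̄_{s-1}∂_r f = r(s-1) f, and the signs of r and s decide
what it is.

If s ≤ 0, repeated application of ∂̄ raises the second weight to 0. There ∂∂̄_0 f = 0, so the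
conjugate of 𝕃^{r-1} ∂̄_0 f is a holomorphic modular form of weight 2-r ≤ 0, hence constant.
Consequently a power of the lowering operator 𝕃∂̄_0 kills 𝕃^s f
(`lower_iterate_LL_zpow_mul_eq_zero`). Lowering is a derivation which sends 𝔾₂^* to 1/4, so such a
function is a polynomial in 𝔾₂^* over M (`mem_almostHolomorphic_of_lower_iterate`). If r ≤ 0,
complex conjugation reduces to this case.

If r, s ≥ 1 and r+s ≥ 4, the operators ∂ and ∂̄ carry f to the diagonal r = s = p and back. On the
diagonal the part of f without q, q̄ is a + b𝕃^{1-2p}. Subtracting a multiple of the Eisenstein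
series removes a, and then the invariant function u = 𝕃^p f tends to zero at the cusp and satisfies
4y² ∂∂̄u = p(p-1)u with p(p-1) > 0; the maximum principle gives u = 0
(`eq_zero_of_isHarmonic_of_tendsto`). Only the limit of the Eisenstein series at the cusp is needed,
not its Fourier expansion.

In the remaining weights (1,1) the absence of modular forms of weight two leaves only the multiples
of 𝕃^{-1} (`eq_const_of_isHarmonic_one_one`). -/

/-! ### Wirtinger calculus -/

/-- The real linear map `v ↦ a v + b v̄`. -/
def wirtingerCLM (a b : ℂ) : ℂ →L[ℝ] ℂ :=
  a • (ContinuousLinearMap.id ℝ ℂ) + b • (conjCLE : ℂ →L[ℝ] ℂ)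

@[simp] lemma wirtingerCLM_apply (a b v : ℂ) : wirtingerCLM a b v = a * v + b * conj v := by
  simp [wirtingerCLM]

lemma eq_wirtingerCLM (L : ℂ →L[ℝ] ℂ) :
    L = wirtingerCLM ((L 1 - I * L I) / 2) ((L 1 + I * L I) / 2) := by
  ext v
  have h : L v = v.re * L 1 + v.im * L I := by
    conv_lhs => rw [show v = v.re • (1 : ℂ) + v.im • I by
      apply Complex.ext <;> simp]
    rw [map_add, map_smul, map_smul]; simp
  rw [h, wirtingerCLM_apply]
  have h1 : v = v.re + v.im * I := (re_add_im v).symm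
  have h2 : conj v = v.re - v.im * I := by apply Complex.ext <;> simp
  rw [h2]; nth_rw 3 [h1]
  linear_combination ((v.im : ℂ) * L I) * I_sq

/-- `f` is real differentiable at `z` with `∂f/∂z = a` and `∂f/∂z̄ = b`. -/
def HasWirtinger (f : ℍ → ℂ) (a b : ℂ) (z : ℍ) : Prop :=
  HasFDerivAt (f ∘ ofComplex) (wirtingerCLM a b) (z : ℂ)

lemma HasWirtinger.wirtinger {f : ℍ → ℂ} {a b : ℂ} {z : ℍ} (h : HasWirtinger f a b z) :
    wirtinger f z = a := by
  rw [BigradedModular.wirtinger, h.fderiv]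
  simp only [wirtingerCLM_apply, map_one, conj_I]
  linear_combination (-a / 2 + b / 2) * I_sq

lemma HasWirtinger.wirtingerBar {f : ℍ → ℂ} {a b : ℂ} {z : ℍ} (h : HasWirtinger f a b z) :
    wirtingerBar f z = b := by
  rw [BigradedModular.wirtingerBar, h.fderiv]
  simp only [wirtingerCLM_apply, map_one, conj_I]
  linear_combination (a / 2 - b / 2) * I_sq

lemma hasWirtinger_of_differentiableAt {f : ℍ → ℂ} {z : ℍ}
    (h : DifferentiableAt ℝ (f ∘ ofComplex) (z : ℂ)) :
    HasWirtinger f (wirtinger f z) (wirtingerBar f z) z := by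
  have := h.hasFDerivAt
  rw [eq_wirtingerCLM (fderiv ℝ (f ∘ ofComplex) (z : ℂ))] at this
  exact this

lemma eventually_im_pos (z : ℍ) : ∀ᶠ w in 𝓝 (z : ℂ), 0 < w.im :=
  isOpen_upperHalfPlaneSet.mem_nhds z.im_pos

lemma coe_ofComplex_of_im_pos {w : ℂ} (hw : 0 < w.im) : ((ofComplex w : ℍ) : ℂ) = w := by
  rw [ofComplex_apply_of_im_pos hw]

/-- Functions which agree near `z` agree near `z` as functions on `ℂ`. -/
lemma eventuallyEq_comp_ofComplex {f g : ℍ → ℂ} {z : ℍ} (h : f =ᶠ[𝓝 z] g) :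
    f ∘ ofComplex =ᶠ[𝓝 (z : ℂ)] g ∘ ofComplex := by
  rw [← isOpenEmbedding_coe.map_nhds_eq, EventuallyEq, eventually_map]
  filter_upwards [h] with w hw
  simpa using hw

lemma HasWirtinger.congr {f g : ℍ → ℂ} {a b : ℂ} {z : ℍ} (h : HasWirtinger f a b z)
    (hfg : g =ᶠ[𝓝 z] f) : HasWirtinger g a b z :=
  HasFDerivAt.congr_of_eventuallyEq h (eventuallyEq_comp_ofComplex hfg)

lemma HasWirtinger.congr_deriv {f : ℍ → ℂ} {a b a' b' : ℂ} {z : ℍ} (h : HasWirtinger f a b z)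
    (ha : a = a') (hb : b = b') : HasWirtinger f a' b' z := ha ▸ hb ▸ h

lemma HasWirtinger.add {f g : ℍ → ℂ} {a b c d : ℂ} {z : ℍ} (hf : HasWirtinger f a b z)
    (hg : HasWirtinger g c d z) : HasWirtinger (f + g) (a + c) (b + d) z := by
  refine (HasFDerivAt.add hf hg).congr_fderiv ?_
  ext v; simp; ring

lemma HasWirtinger.mul {f g : ℍ → ℂ} {a b c d : ℂ} {z : ℍ} (hf : HasWirtinger f a b z)
    (hg : HasWirtinger g c d z) :
    HasWirtinger (f * g) (f z * c + a * g z) (f z * d + b * g z) z := by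
  refine (HasFDerivAt.mul hf hg).congr_fderiv ?_
  ext v; simp; ring

lemma hasWirtinger_const (c : ℂ) (z : ℍ) : HasWirtinger (fun _ => c) 0 0 z := by
  refine (hasFDerivAt_const c (z : ℂ)).congr_fderiv ?_
  ext v; simp

lemma HasWirtinger.smul {f : ℍ → ℂ} {a b : ℂ} {z : ℍ} (c : ℂ) (hf : HasWirtinger f a b z) :
    HasWirtinger (c • f) (c * a) (c * b) z := by
  refine (HasFDerivAt.const_smul hf c).congr_fderiv ?_
  ext v; simp; ring

lemma HasWirtinger.star {f : ℍ → ℂ} {a b : ℂ} {z : ℍ} (hf : HasWirtinger f a b z) :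
    HasWirtinger (fun z => conj (f z)) (conj b) (conj a) z := by
  refine ((conjCLE : ℂ →L[ℝ] ℂ).hasFDerivAt.comp (z : ℂ) hf).congr_fderiv ?_
  ext v; simp; ring

/-- Composition with a holomorphic function on the left. -/
lemma HasWirtinger.comp_left {f : ℍ → ℂ} {a b c : ℂ} {z : ℍ} (hf : HasWirtinger f a b z)
    {h : ℂ → ℂ} (hh : HasDerivAt h c (f z)) :
    HasWirtinger (fun z => h (f z)) (c * a) (c * b) z := by
  have h1 : HasFDerivAt h (c • (ContinuousLinearMap.id ℝ ℂ)) ((f ∘ ofComplex) (z : ℂ)) := by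
    have := hh.hasFDerivAt.restrictScalars ℝ
    simp only [Function.comp_apply, ofComplex_apply]
    refine this.congr_fderiv ?_
    ext v; simp [mul_comm]
  refine (h1.comp (z : ℂ) hf).congr_fderiv ?_
  ext v; simp; ring

/-- Composition with a holomorphic map of the upper half plane on the right. -/
lemma HasWirtinger.comp_right {f : ℍ → ℂ} {a b c : ℂ} {z : ℍ} {γ : ℍ → ℍ}
    (hf : HasWirtinger f a b (γ z))
    (hγ : HasDerivAt (fun w : ℂ => ((γ (ofComplex w) : ℍ) : ℂ)) c z) :
    HasWirtinger (fun z => f (γ z)) (c * a) (conj c * b) z := by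
  have h1 : HasFDerivAt (fun w : ℂ => ((γ (ofComplex w) : ℍ) : ℂ))
      (c • (ContinuousLinearMap.id ℝ ℂ)) (z : ℂ) := by
    refine (hγ.hasFDerivAt.restrictScalars ℝ).congr_fderiv ?_
    ext v; simp [mul_comm]
  have h2 : HasFDerivAt (f ∘ ofComplex) (wirtingerCLM a b) ((γ (ofComplex (z : ℂ)) : ℍ) : ℂ) := by
    rw [ofComplex_apply]; exact hf
  have h3 := HasFDerivAt.comp (z : ℂ) h2 h1
  have h4 : (f ∘ ofComplex) ∘ (fun w : ℂ => ((γ (ofComplex w) : ℍ) : ℂ)) =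
      (fun z => f (γ z)) ∘ ofComplex := by
    funext w; simp
  rw [h4] at h3
  refine h3.congr_fderiv ?_
  ext v; simp; ring

lemma hasWirtinger_coe (z : ℍ) : HasWirtinger (fun z => (z : ℂ)) 1 0 z := by
  have h : HasFDerivAt (fun w : ℂ => w) (wirtingerCLM 1 0) (z : ℂ) := by
    refine (hasFDerivAt_id (z : ℂ)).congr_fderiv ?_
    ext v; simp
  refine h.congr_of_eventuallyEq ?_
  filter_upwards [eventually_im_pos z] with w hw
  exact coe_ofComplex_of_im_pos hw

lemma hasWirtinger_conj_coe (z : ℍ) : HasWirtinger (fun z => conj (z : ℂ)) 0 1 z := by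
  simpa using (hasWirtinger_coe z).star

lemma sub_conj_eq (z : ℍ) : (z : ℂ) - conj (z : ℂ) = 2 * z.im * I := by
  rw [Complex.sub_conj]; simp [mul_comm]

lemma sub_conj_ne_zero (z : ℍ) : (z : ℂ) - conj (z : ℂ) ≠ 0 := by
  rw [sub_conj_eq]
  simp [z.im_ne_zero]

lemma LL_eq (z : ℍ) : LL z = Real.pi * I * ((z : ℂ) - conj (z : ℂ)) := by
  rw [sub_conj_eq, LL]
  linear_combination (-2 * Real.pi * z.im) * I_sq

lemma LL_ne_zero (z : ℍ) : LL z ≠ 0 := by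
  simp [LL, Real.pi_ne_zero, z.im_ne_zero]

@[simp] lemma conj_LL (z : ℍ) : conj (LL z) = LL z := by
  rw [LL, map_mul, map_mul, map_neg, map_ofNat, conj_ofReal, conj_ofReal]

lemma hasWirtinger_LL (z : ℍ) : HasWirtinger LL (Real.pi * I) (-(Real.pi * I)) z := by
  have h := (((hasWirtinger_coe z).add ((hasWirtinger_conj_coe z).smul (-1))).smul (Real.pi * I))
  refine (h.congr (Eventually.of_forall fun w => ?_)).congr_deriv (by ring) (by ring)
  simp [LL_eq, sub_eq_add_neg]

lemma hasWirtinger_LL_zpow (k : ℤ) (z : ℍ) :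
    HasWirtinger (fun z => LL z ^ k) (k * LL z ^ (k - 1) * (Real.pi * I))
      (-(k * LL z ^ (k - 1) * (Real.pi * I))) z :=
  ((hasWirtinger_LL z).comp_left (hasDerivAt_zpow k (LL z) (Or.inl (LL_ne_zero z)))).congr_deriv
    rfl (by ring)

/-! ### Smoothness on the upper half plane -/

/-- `f` is of class `C^n` on the upper half plane. -/
def IsSmooth (n : WithTop ℕ∞) (f : ℍ → ℂ) : Prop :=
  ∀ z : ℍ, ContDiffAt ℝ n (f ∘ ofComplex) (z : ℂ)

lemma isRealAnalytic_iff {f : ℍ → ℂ} : IsRealAnalytic f ↔ IsSmooth ω f := by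
  refine ⟨fun h z => (h z z.im_pos).contDiffAt, fun h z hz => ?_⟩
  exact (h ⟨z, hz⟩).analyticAt

namespace IsSmooth

variable {n : WithTop ℕ∞} {f g : ℍ → ℂ}

lemma of_le {m : WithTop ℕ∞} (hf : IsSmooth n f) (h : m ≤ n) : IsSmooth m f :=
  fun z => (hf z).of_le h

lemma hasWirtinger (hf : IsSmooth n f) (hn : 1 ≤ n) (z : ℍ) :
    HasWirtinger f (wirtinger f z) (wirtingerBar f z) z :=
  hasWirtinger_of_differentiableAt ((hf z).differentiableAt (by positivity))

lemma const (c : ℂ) : IsSmooth n fun _ => c := fun _ => contDiffAt_const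

lemma add (hf : IsSmooth n f) (hg : IsSmooth n g) : IsSmooth n (f + g) :=
  fun z => (hf z).add (hg z)

lemma mul (hf : IsSmooth n f) (hg : IsSmooth n g) : IsSmooth n (f * g) :=
  fun z => (hf z).mul (hg z)

lemma smul (c : ℂ) (hf : IsSmooth n f) : IsSmooth n (c • f) :=
  fun z => (hf z).const_smul c

lemma star (hf : IsSmooth n f) : IsSmooth n fun z => conj (f z) :=
  fun z => (conjCLE : ℂ →L[ℝ] ℂ).contDiff.contDiffAt.comp (z : ℂ) (hf z)

lemma congr_of_holomorphic {h : ℂ → ℂ} (hh : ∀ z : ℍ, AnalyticAt ℂ h z)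
    (hf : ∀ z : ℍ, f z = h z) : IsSmooth n f := fun z => by
  have h1 : ContDiffAt ℝ n h z := (hh z).contDiffAt.restrict_scalars ℝ
  refine h1.congr_of_eventuallyEq ?_
  filter_upwards [eventually_im_pos z] with w hw
  rw [Function.comp_apply, hf, coe_ofComplex_of_im_pos hw]

lemma coe : IsSmooth n fun z => (z : ℂ) :=
  congr_of_holomorphic (fun _ => analyticAt_id) fun _ => rfl

lemma LL : IsSmooth n LL := by
  have : IsSmooth n ((Real.pi * I) • ((fun z : ℍ => (z : ℂ)) + (-1 : ℂ) • fun z : ℍ => conj (z : ℂ))) :=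
    (coe.add (coe.star.smul _)).smul _
  convert this using 1
  funext z
  simp [LL_eq, sub_eq_add_neg]

lemma comp_left {h : ℂ → ℂ} (hf : IsSmooth n f) (hh : ∀ z, AnalyticAt ℂ h (f z)) :
    IsSmooth n fun z => h (f z) := fun z => by
  have h1 : ContDiffAt ℝ n h ((f ∘ ofComplex) (z : ℂ)) := by
    simpa using! (hh z).contDiffAt.restrict_scalars ℝ
  exact h1.comp (z : ℂ) (hf z)

lemma LL_zpow (k : ℤ) : IsSmooth n fun z => BigradedModular.LL z ^ k :=
  LL.comp_left (h := fun w => w ^ k) fun z => analyticAt_id.zpow (LL_ne_zero z)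

lemma wirtinger (hf : IsSmooth n f) {m : WithTop ℕ∞} (h : m + 1 ≤ n) : IsSmooth m (wirtinger f) := by
  intro z
  have h1 : ContDiffAt ℝ m (fderiv ℝ (f ∘ ofComplex)) (z : ℂ) := (hf z).fderiv_right h
  have h2 : ContDiffAt ℝ m (fun w => (fderiv ℝ (f ∘ ofComplex) w 1 -
      I * fderiv ℝ (f ∘ ofComplex) w I) / 2) (z : ℂ) :=
    ((h1.clm_apply contDiffAt_const).sub (contDiffAt_const.mul
      (h1.clm_apply contDiffAt_const))).div_const _
  refine h2.congr_of_eventuallyEq ?_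
  filter_upwards [eventually_im_pos z] with w hw
  rw [Function.comp_apply, BigradedModular.wirtinger, coe_ofComplex_of_im_pos hw]

lemma wirtingerBar (hf : IsSmooth n f) {m : WithTop ℕ∞} (h : m + 1 ≤ n) :
    IsSmooth m (wirtingerBar f) := by
  intro z
  have h1 : ContDiffAt ℝ m (fderiv ℝ (f ∘ ofComplex)) (z : ℂ) := (hf z).fderiv_right h
  have h2 : ContDiffAt ℝ m (fun w => (fderiv ℝ (f ∘ ofComplex) w 1 +
      I * fderiv ℝ (f ∘ ofComplex) w I) / 2) (z : ℂ) :=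
    ((h1.clm_apply contDiffAt_const).add (contDiffAt_const.mul
      (h1.clm_apply contDiffAt_const))).div_const _
  refine h2.congr_of_eventuallyEq ?_
  filter_upwards [eventually_im_pos z] with w hw
  rw [Function.comp_apply, BigradedModular.wirtingerBar, coe_ofComplex_of_im_pos hw]

end IsSmooth

/-- The second real derivatives of `f` in terms of those of its first Wirtinger derivatives. -/
lemma wirtinger_wirtingerBar_comm {f : ℍ → ℂ} (hf : IsSmooth 2 f) (z : ℍ) :
    wirtinger (wirtingerBar f) z = wirtingerBar (wirtinger f) z := by
  have hsymm : IsSymmSndFDerivAt ℝ (f ∘ ofComplex) (z : ℂ) :=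
    (hf z).isSymmSndFDerivAt (by simp)
  set D := fderiv ℝ (f ∘ ofComplex) with hD
  have hD' : DifferentiableAt ℝ D z :=
    ((hf z).fderiv_right (m := 1) (by norm_num)).differentiableAt (by norm_num)
  have hv (v : ℂ) : HasFDerivAt (fun w => D w v) ((fderiv ℝ D z).flip v) (z : ℂ) := by
    have := hD'.hasFDerivAt.clm_apply (hasFDerivAt_const v (z : ℂ))
    refine this.congr_fderiv ?_
    ext u; simp
  have e1 : HasFDerivAt (wirtingerBar f ∘ ofComplex)
      ((2⁻¹ : ℂ) • ((fderiv ℝ D z).flip 1 + I • (fderiv ℝ D z).flip I)) (z : ℂ) := by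
    refine (((hv 1).add ((hv I).const_smul I)).const_smul (2⁻¹ : ℂ)).congr_of_eventuallyEq ?_
    filter_upwards [eventually_im_pos z] with w hw
    rw [Function.comp_apply, wirtingerBar, coe_ofComplex_of_im_pos hw]
    simp; ring
  have e2 : HasFDerivAt (wirtinger f ∘ ofComplex)
      ((2⁻¹ : ℂ) • ((fderiv ℝ D z).flip 1 - I • (fderiv ℝ D z).flip I)) (z : ℂ) := by
    refine (((hv 1).sub ((hv I).const_smul I)).const_smul (2⁻¹ : ℂ)).congr_of_eventuallyEq ?_
    filter_upwards [eventually_im_pos z] with w hw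
    rw [Function.comp_apply, wirtinger, coe_ofComplex_of_im_pos hw]
    simp; ring
  rw [wirtinger, wirtingerBar, e1.fderiv, e2.fderiv]
  have := hsymm 1 I
  simp only [_root_.smul_apply, _root_.add_apply,
    _root_.sub_apply, ContinuousLinearMap.flip_apply, smul_eq_mul]
  rw [show fderiv ℝ D z 1 I = fderiv ℝ D z I 1 from this]
  ring

/-! ### The operators `∂_r` and `∂̄_s` -/

lemma hasWirtinger_sub_conj (z : ℍ) :
    HasWirtinger (fun z => (z : ℂ) - conj (z : ℂ)) 1 (-1) z := by
  refine (((hasWirtinger_coe z).add ((hasWirtinger_conj_coe z).smul (-1))).congr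
    (Eventually.of_forall fun w => ?_)).congr_deriv (by ring) (by ring)
  simp [sub_eq_add_neg]

lemma HasWirtinger.maass {f : ℍ → ℂ} {a b : ℂ} {z : ℍ} (h : HasWirtinger f a b z) (r : ℤ) :
    maass r f z = ((z : ℂ) - conj (z : ℂ)) * a + r * f z := by
  rw [BigradedModular.maass, h.wirtinger]

lemma HasWirtinger.maassBar {f : ℍ → ℂ} {a b : ℂ} {z : ℍ} (h : HasWirtinger f a b z) (s : ℤ) :
    maassBar s f z = (conj (z : ℂ) - (z : ℂ)) * b + s * f z := by
  rw [BigradedModular.maassBar, h.wirtingerBar]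

section

variable {n m : WithTop ℕ∞} {f g : ℍ → ℂ}

lemma IsSmooth.maass (hf : IsSmooth n f) (h : m + 1 ≤ n) (r : ℤ) : IsSmooth m (maass r f) := by
  have h1 : IsSmooth m (fun z : ℍ => (z : ℂ) - conj (z : ℂ)) := by
    convert! IsSmooth.coe.add (IsSmooth.coe.star.smul (-1)) using 1
    funext z; simp [sub_eq_add_neg]
  have h2 : m ≤ n := le_trans le_self_add h
  exact (h1.mul (hf.wirtinger h)).add ((IsSmooth.const (r : ℂ)).mul (hf.of_le h2))

lemma IsSmooth.maassBar (hf : IsSmooth n f) (h : m + 1 ≤ n) (s : ℤ) :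
    IsSmooth m (maassBar s f) := by
  have h1 : IsSmooth m (fun z : ℍ => conj (z : ℂ) - (z : ℂ)) := by
    convert! IsSmooth.coe.star.add (IsSmooth.coe.smul (-1)) using 1
    funext z; simp [sub_eq_add_neg]
  have h2 : m ≤ n := le_trans le_self_add h
  exact (h1.mul (hf.wirtingerBar h)).add ((IsSmooth.const (s : ℂ)).mul (hf.of_le h2))

lemma maass_add (hf : IsSmooth n f) (hg : IsSmooth n g) (hn : 1 ≤ n) (r : ℤ) :
    maass r (f + g) = maass r f + maass r g := by
  funext z
  rw [((hf.hasWirtinger hn z).add (hg.hasWirtinger hn z)).maass]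
  simp only [Pi.add_apply, maass]; ring

lemma maassBar_add (hf : IsSmooth n f) (hg : IsSmooth n g) (hn : 1 ≤ n) (s : ℤ) :
    maassBar s (f + g) = maassBar s f + maassBar s g := by
  funext z
  rw [((hf.hasWirtinger hn z).add (hg.hasWirtinger hn z)).maassBar]
  simp only [Pi.add_apply, maassBar]; ring

lemma maass_smul (hf : IsSmooth n f) (hn : 1 ≤ n) (c : ℂ) (r : ℤ) :
    maass r (c • f) = c • maass r f := by
  funext z
  rw [((hf.hasWirtinger hn z).smul c).maass]
  simp only [Pi.smul_apply, maass, smul_eq_mul]; ring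

lemma maassBar_smul (hf : IsSmooth n f) (hn : 1 ≤ n) (c : ℂ) (s : ℤ) :
    maassBar s (c • f) = c • maassBar s f := by
  funext z
  rw [((hf.hasWirtinger hn z).smul c).maassBar]
  simp only [Pi.smul_apply, maassBar, smul_eq_mul]; ring

lemma maassBar_mul (hf : IsSmooth n f) (hg : IsSmooth n g) (hn : 1 ≤ n) (s t : ℤ) :
    maassBar (s + t) (f * g) = maassBar s f * g + f * maassBar t g := by
  funext z
  rw [((hf.hasWirtinger hn z).mul (hg.hasWirtinger hn z)).maassBar]
  simp only [Pi.add_apply, Pi.mul_apply, maassBar, Int.cast_add]; ring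

lemma LL_zpow_pred (k : ℤ) (z : ℍ) : LL z ^ k = LL z ^ (k - 1) * LL z := by
  rw [← zpow_add_one₀ (LL_ne_zero z), sub_add_cancel]

/-- Multiplication by `𝕃^k` commutes with the operators `∂`. -/
lemma maass_LL_zpow_mul (hf : IsSmooth n f) (hn : 1 ≤ n) (k r : ℤ) :
    maass (r - k) (fun z => LL z ^ k * f z) = fun z => LL z ^ k * maass r f z := by
  funext z
  have := ((hasWirtinger_LL_zpow k z).mul (hf.hasWirtinger hn z))
  refine (this.maass (r - k)).trans ?_
  simp only [Pi.mul_apply, maass, Int.cast_sub]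
  rw [LL_zpow_pred k z, LL_eq z]
  ring

lemma maassBar_LL_zpow_mul (hf : IsSmooth n f) (hn : 1 ≤ n) (k s : ℤ) :
    maassBar (s - k) (fun z => LL z ^ k * f z) = fun z => LL z ^ k * maassBar s f z := by
  funext z
  have := ((hasWirtinger_LL_zpow k z).mul (hf.hasWirtinger hn z))
  refine (this.maassBar (s - k)).trans ?_
  simp only [Pi.mul_apply, maassBar, Int.cast_sub]
  rw [LL_zpow_pred k z, LL_eq z]
  ring

lemma maass_star (hf : IsSmooth n f) (hn : 1 ≤ n) (r : ℤ) :
    maass r (fun z => conj (f z)) = fun z => conj (maassBar r f z) := by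
  funext z
  rw [(hf.hasWirtinger hn z).star.maass]
  simp [maassBar]

lemma maassBar_star (hf : IsSmooth n f) (hn : 1 ≤ n) (s : ℤ) :
    maassBar s (fun z => conj (f z)) = fun z => conj (maass s f z) := by
  funext z
  rw [(hf.hasWirtinger hn z).star.maassBar]
  simp [maass]

/-- `∂̄∂` in terms of the Wirtinger derivatives. -/
lemma maassBar_maass (hf : IsSmooth n f) (hn : 2 ≤ n) (r s : ℤ) (z : ℍ) :
    maassBar (s - 1) (maass r f) z =
      (conj (z : ℂ) - z) * ((z - conj (z : ℂ)) * wirtingerBar (wirtinger f) z - wirtinger f z +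
        r * wirtingerBar f z) + (s - 1) * ((z - conj (z : ℂ)) * wirtinger f z + r * f z) := by
  have h1 := (hf.hasWirtinger (le_trans (by norm_num) hn) z)
  have h2 := ((hf.wirtinger (m := 1) (by simpa [one_add_one_eq_two] using hn)).hasWirtinger
    le_rfl z)
  have h3 := ((hasWirtinger_sub_conj z).mul h2).add (h1.smul r)
  refine (h3.maassBar (s - 1)).trans ?_
  simp only [Pi.add_apply, Pi.mul_apply, Pi.smul_apply, smul_eq_mul, Int.cast_sub, Int.cast_one]
  ring

lemma maass_maassBar (hf : IsSmooth n f) (hn : 2 ≤ n) (r s : ℤ) (z : ℍ) :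
    maass (r - 1) (maassBar s f) z =
      (z - conj (z : ℂ)) * ((conj (z : ℂ) - z) * wirtinger (wirtingerBar f) z - wirtingerBar f z +
        s * wirtinger f z) + (r - 1) * ((conj (z : ℂ) - z) * wirtingerBar f z + s * f z) := by
  have h1 := (hf.hasWirtinger (le_trans (by norm_num) hn) z)
  have h2 := ((hf.wirtingerBar (m := 1) (by simpa [one_add_one_eq_two] using hn)).hasWirtinger
    le_rfl z)
  have h3 := (((hasWirtinger_sub_conj z).smul (-1)).mul h2).add (h1.smul s)
  have h4 : maassBar s f = (((-1 : ℂ) • fun z : ℍ => (z : ℂ) - conj (z : ℂ)) * wirtingerBar f +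
      (s : ℂ) • f) := by
    funext w; simp [maassBar]; ring
  rw [h4]
  refine (h3.maass (r - 1)).trans ?_
  simp only [Pi.add_apply, Pi.mul_apply, Pi.smul_apply, smul_eq_mul, Int.cast_sub, Int.cast_one]
  ring

/-- The mixed second derivatives agree by symmetry, so only terms of order zero survive in the
commutator. This relation is what transports harmonicity between neighbouring bidegrees. -/
lemma maass_maassBar_comm (hf : IsSmooth n f) (hn : 2 ≤ n) (r s : ℤ) :
    maass (r - 1) (maassBar s f) = maassBar (s - 1) (maass r f) + ((r : ℂ) - s) • f := by
  funext z
  rw [Pi.add_apply, maassBar_maass hf hn, maass_maassBar hf hn,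
    wirtinger_wirtingerBar_comm (hf.of_le hn)]
  simp only [Pi.smul_apply, smul_eq_mul]
  ring

end

/-! ### Modularity -/

/-- The factor of automorphy `cz + d`. -/
def autFactor (γ : SL(2, ℤ)) (z : ℍ) : ℂ := (γ 1 0 : ℂ) * z + (γ 1 1 : ℂ)

lemma autFactor_eq_denom (γ : SL(2, ℤ)) (z : ℍ) :
    autFactor γ z = denom (γ : GL (Fin 2) ℝ) z := by simp [autFactor, denom]

lemma autFactor_ne_zero (γ : SL(2, ℤ)) (z : ℍ) : autFactor γ z ≠ 0 := by
  rw [autFactor_eq_denom]; exact denom_ne_zero _ z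

lemma conj_autFactor (γ : SL(2, ℤ)) (z : ℍ) :
    conj (autFactor γ z) = (γ 1 0 : ℂ) * conj (z : ℂ) + (γ 1 1 : ℂ) := by
  simp [autFactor]

lemma conj_autFactor_ne_zero (γ : SL(2, ℤ)) (z : ℍ) : conj (autFactor γ z) ≠ 0 :=
  (map_ne_zero _).mpr (autFactor_ne_zero γ z)

lemma isBimodular_iff {r s : ℤ} {f : ℍ → ℂ} : IsBimodular r s f ↔
    ∀ (γ : SL(2, ℤ)) (z : ℍ), f (γ • z) = autFactor γ z ^ r * conj (autFactor γ z) ^ s * f z := by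
  simp only [IsBimodular, conj_autFactor]
  rfl

lemma hasDerivAt_sl_smul (γ : SL(2, ℤ)) (z : ℍ) :
    HasDerivAt (fun w : ℂ => ((γ • ofComplex w : ℍ) : ℂ)) (1 / autFactor γ z ^ 2) z := by
  have hdet : (γ : GL (Fin 2) ℝ).val.det = 1 :=
    (Matrix.SpecialLinearGroup.map (Int.castRingHom ℝ) γ).det_coe
  have h := (hasStrictDerivAt_smul (g := (γ : GL (Fin 2) ℝ)) (by rw [hdet]; norm_num) z).hasDerivAt
  rw [hdet, ofReal_one] at h
  rw [autFactor_eq_denom]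
  exact h

lemma hasWirtinger_autFactor (γ : SL(2, ℤ)) (z : ℍ) :
    HasWirtinger (autFactor γ) (γ 1 0) 0 z := by
  refine (((hasWirtinger_coe z).smul (γ 1 0 : ℂ)).add (hasWirtinger_const (γ 1 1 : ℂ) z)).congr_deriv
    (by ring) (by ring)

lemma sub_conj_smul (γ : SL(2, ℤ)) (z : ℍ) :
    ((γ • z : ℍ) : ℂ) - conj ((γ • z : ℍ) : ℂ) =
      ((z : ℂ) - conj (z : ℂ)) / (autFactor γ z * conj (autFactor γ z)) := by
  rw [sub_conj_eq, sub_conj_eq, ModularGroup.im_smul_eq_div_normSq, Complex.mul_conj,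
    autFactor_eq_denom]
  push_cast; ring

namespace IsBimodular

variable {r s t u : ℤ} {f g : ℍ → ℂ}

lemma mul (hf : IsBimodular r s f) (hg : IsBimodular t u g) :
    IsBimodular (r + t) (s + u) (f * g) := by
  rw [isBimodular_iff] at *
  intro γ z
  rw [Pi.mul_apply, Pi.mul_apply, hf, hg, zpow_add₀ (autFactor_ne_zero γ z),
    zpow_add₀ (conj_autFactor_ne_zero γ z)]
  ring

lemma add (hf : IsBimodular r s f) (hg : IsBimodular r s g) : IsBimodular r s (f + g) := by
  intro γ z
  rw [Pi.add_apply, Pi.add_apply, hf, hg]; ring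

lemma smul (hf : IsBimodular r s f) (c : ℂ) : IsBimodular r s (c • f) := by
  intro γ z
  rw [Pi.smul_apply, Pi.smul_apply, hf]; simp only [smul_eq_mul]; ring

lemma star (hf : IsBimodular r s f) : IsBimodular s r fun z => conj (f z) := by
  rw [isBimodular_iff] at *
  intro γ z
  rw [hf, map_mul, map_mul, map_zpow₀, map_zpow₀, conj_conj]
  ring

lemma LL_zpow (k : ℤ) : IsBimodular (-k) (-k) fun z => LL z ^ k := by
  rw [isBimodular_iff]
  intro γ z
  simp only [LL_eq]
  rw [sub_conj_smul, mul_div_assoc', div_zpow, mul_zpow (autFactor γ z), zpow_neg, zpow_neg]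
  have h1 := zpow_ne_zero k (autFactor_ne_zero γ z)
  have h2 := zpow_ne_zero k (conj_autFactor_ne_zero γ z)
  field_simp

/-- Differentiating the transformation law produces an extra term r c f. The identity c(z - z̄) = j
- j̄, with j = cz + d, shows that the summand r f in ∂_r compensates it. -/
lemma maass (hf : IsBimodular r s f) (hs : IsSmooth 1 f) :
    IsBimodular (r + 1) (s - 1) (maass r f) := by
  rw [isBimodular_iff] at *
  intro γ z
  have hj := autFactor_ne_zero γ z
  have hj' := conj_autFactor_ne_zero γ z
  have h1 := (hs.hasWirtinger le_rfl (γ • z)).comp_right (γ := fun z => γ • z)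
    (hasDerivAt_sl_smul γ z)
  have hp (k : ℤ) := (hasWirtinger_autFactor γ z).comp_left (hasDerivAt_zpow k _ (Or.inl hj))
  have hp' (k : ℤ) := ((hasWirtinger_autFactor γ z).star).comp_left
    (hasDerivAt_zpow k _ (Or.inl hj'))
  have h2 := ((hp r).mul (hp' s)).mul (hs.hasWirtinger le_rfl z)
  have h3 := (h1.congr (Eventually.of_forall fun w => ((hf γ w).symm))).wirtinger.symm.trans
    h2.wirtinger
  simp only [Pi.mul_apply, map_zero, mul_zero, zero_add] at h3
  rw [one_div_mul_eq_div, div_eq_iff (pow_ne_zero 2 hj)] at h3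
  have hc : (γ 1 0 : ℂ) * ((z : ℂ) - conj (z : ℂ)) = autFactor γ z - conj (autFactor γ z) := by
    rw [conj_autFactor, autFactor]; ring
  rw [BigradedModular.maass, sub_conj_smul, h3, hf γ z, BigradedModular.maass,
    zpow_add_one₀ hj, zpow_sub_one₀ hj', zpow_sub_one₀ hj]
  field_simp
  linear_combination (r * f z) * hc

lemma maassBar (hf : IsBimodular r s f) (hs : IsSmooth 1 f) :
    IsBimodular (r - 1) (s + 1) (maassBar s f) := by
  have h := (hf.star.maass hs.star).star
  rw [maass_star hs le_rfl] at h
  simpa using h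

/-- A bimodular function of odd weight vanishes. -/
lemma even_of_ne_zero (hf : IsBimodular r s f) (h0 : f ≠ 0) : Even (r + s) := by
  obtain ⟨z, hz⟩ := Function.ne_iff.mp h0
  have h := hf (-1) z
  have e : (-1 : SL(2, ℤ)) • z = z := by
    rw [ModularGroup.SL_neg_smul, one_smul]
  rw [e] at h
  simp only [Matrix.SpecialLinearGroup.coe_neg, Matrix.SpecialLinearGroup.coe_one, Matrix.neg_apply,
    Matrix.one_apply_eq, ne_eq, one_ne_zero, not_false_eq_true, Matrix.one_apply_ne, neg_zero,
    Int.cast_zero, zero_mul, zero_add, Int.cast_neg, Int.cast_one] at h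
  rw [← zpow_add₀ (by norm_num)] at h
  by_contra hodd
  rw [Int.not_even_iff_odd] at hodd
  rw [hodd.neg_one_zpow] at h
  apply hz
  have h2 : (2 : ℂ) * f z = 0 := by linear_combination h
  simpa using h2

end IsBimodular

/-! ### Termwise differentiation -/

lemma norm_wirtingerCLM_le (a b : ℂ) : ‖wirtingerCLM a b‖ ≤ ‖a‖ + ‖b‖ := by
  refine ContinuousLinearMap.opNorm_le_bound _ (by positivity) fun v => ?_
  rw [wirtingerCLM_apply, add_mul]
  refine (norm_add_le _ _).trans (le_of_eq ?_)
  rw [norm_mul, norm_mul, RCLike.norm_conj]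

lemma hasWirtinger_tsum {ι : Type*} {f α β : ι → ℍ → ℂ} {u : ι → ℝ} (hu : Summable u)
    {t : Set ℂ} (ht : IsOpen t) (htc : IsPreconnected t) (hpos : ∀ w ∈ t, 0 < w.im)
    (hf : ∀ i, ∀ z : ℍ, (z : ℂ) ∈ t → HasWirtinger (f i) (α i z) (β i z) z)
    (hα : ∀ i, ∀ z : ℍ, (z : ℂ) ∈ t → ‖α i z‖ ≤ u i)
    (hβ : ∀ i, ∀ z : ℍ, (z : ℂ) ∈ t → ‖β i z‖ ≤ u i)
    {z₀ : ℍ} (hz₀ : (z₀ : ℂ) ∈ t) (hsum : Summable fun i => f i z₀) {z : ℍ} (hz : (z : ℂ) ∈ t) :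
    HasWirtinger (fun z => ∑' i, f i z) (∑' i, α i z) (∑' i, β i z) z := by
  have key := hasFDerivAt_tsum_of_isPreconnected (𝕜 := ℝ) (f := fun i => f i ∘ ofComplex)
    (f' := fun i w => wirtingerCLM (α i (ofComplex w)) (β i (ofComplex w)))
    (u := fun i => u i + u i) (hu.add hu) ht htc ?_ ?_ hz₀ (by simpa using hsum) hz
  · refine HasFDerivAt.congr_fderiv key ?_
    have sα : Summable fun i => α i z := .of_norm_bounded hu fun i => hα i z hz
    have sβ : Summable fun i => β i z := .of_norm_bounded hu fun i => hβ i z hz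
    simp only [ofComplex_apply]
    have s : Summable fun i => wirtingerCLM (α i z) (β i z) :=
      .of_norm_bounded (hu.add hu) fun i => (norm_wirtingerCLM_le _ _).trans
        (add_le_add (hα i z hz) (hβ i z hz))
    ext v
    rw [← ContinuousLinearMap.apply_apply v, ContinuousLinearMap.map_tsum _ s]
    simp only [ContinuousLinearMap.apply_apply, wirtingerCLM_apply]
    rw [(sα.mul_right v).tsum_add (sβ.mul_right _), tsum_mul_right, tsum_mul_right]
  · intro i w hw
    have := hf i ⟨w, hpos w hw⟩ hw
    rw [ofComplex_apply_of_im_pos (hpos w hw)]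
    exact this
  · intro i w hw
    rw [ofComplex_apply_of_im_pos (hpos w hw)]
    exact (norm_wirtingerCLM_le _ _).trans
      (add_le_add (hα i ⟨w, hpos w hw⟩ hw) (hβ i ⟨w, hpos w hw⟩ hw))

/-! ### Power series in `q` and `q̄` -/

lemma norm_qVar (z : ℍ) : ‖qVar z‖ = Real.exp (-2 * Real.pi * z.im) := by
  rw [qVar, Complex.norm_exp]
  congr 1
  simp

lemma qVar_ne_zero (z : ℍ) : qVar z ≠ 0 := exp_ne_zero _

lemma norm_qVar_pos (z : ℍ) : 0 < ‖qVar z‖ := norm_pos_iff.mpr (qVar_ne_zero z)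

lemma norm_qTerm (a : ℕ × ℕ → ℂ) (z : ℍ) (p : ℕ × ℕ) :
    ‖qTerm a z p‖ = ‖a p‖ * ‖qVar z‖ ^ (p.1 + p.2) := by
  rw [qTerm, norm_mul, norm_mul, norm_pow, norm_pow, RCLike.norm_conj, mul_assoc, pow_add]

lemma norm_qVar_lt {z w : ℍ} (h : z.im < w.im) : ‖qVar w‖ < ‖qVar z‖ := by
  rw [norm_qVar, norm_qVar, Real.exp_lt_exp]
  nlinarith [Real.pi_pos]

lemma norm_qVar_le {z w : ℍ} (h : z.im ≤ w.im) : ‖qVar w‖ ≤ ‖qVar z‖ := by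
  rw [norm_qVar, norm_qVar, Real.exp_le_exp]
  nlinarith [Real.pi_pos]

/-- The sum of a power series in `q`, `q̄`. -/
def qSum (a : ℕ × ℕ → ℂ) (z : ℍ) : ℂ := ∑' p, qTerm a z p

lemma hasWirtinger_qVar (z : ℍ) : HasWirtinger qVar (2 * Real.pi * I * qVar z) 0 z := by
  have h := ((hasWirtinger_coe z).smul (2 * Real.pi * I)).comp_left (Complex.hasDerivAt_exp _)
  refine h.congr_deriv ?_ (by simp)
  simp [qVar, mul_comm]

lemma hasWirtinger_qTerm (a : ℕ × ℕ → ℂ) (p : ℕ × ℕ) (z : ℍ) :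
    HasWirtinger (fun z => qTerm a z p) (qTerm (fun p => 2 * Real.pi * I * p.1 * a p) z p)
      (qTerm (fun p => -(2 * Real.pi * I * p.2 * a p)) z p) z := by
  have h1 := (hasWirtinger_qVar z).comp_left (hasDerivAt_pow p.1 (qVar z))
  have h2 := (hasWirtinger_qVar z).star.comp_left (hasDerivAt_pow p.2 (conj (qVar z)))
  have hc : conj (2 * Real.pi * I * qVar z) = -(2 * Real.pi * I * conj (qVar z)) := by
    rw [map_mul, map_mul, map_mul, conj_I, conj_ofReal, map_ofNat]; ring
  have hp (x : ℂ) (k : ℕ) : (k : ℂ) * x ^ (k - 1) * x = k * x ^ k := by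
    cases k <;> simp [pow_succ, mul_assoc]
  refine (((h1.mul h2).smul (a p)).congr (Eventually.of_forall fun w => ?_)).congr_deriv ?_ ?_
  · simp [qTerm, mul_assoc]
  · simp only [qTerm, map_zero, mul_zero, zero_add]
    linear_combination (2 * Real.pi * I * a p * conj (qVar z) ^ p.2) * hp (qVar z) p.1
  · rw [hc]
    simp only [qTerm, mul_zero, zero_mul, add_zero]
    linear_combination (-2 * Real.pi * I * a p * qVar z ^ p.1) * hp (conj (qVar z)) p.2

lemma exists_im_eq {y : ℝ} (hy : 0 < y) : ∃ z : ℍ, z.im = y :=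
  ⟨⟨y * I, by simpa using hy⟩, by simp [UpperHalfPlane.im]⟩

lemma exists_im_between {Y : ℝ} {z : ℍ} (h : Y < z.im) : ∃ w : ℍ, Y < w.im ∧ w.im < z.im := by
  obtain ⟨y, h1, h2⟩ := exists_between (max_lt h z.im_pos)
  obtain ⟨w, rfl⟩ := exists_im_eq (lt_of_le_of_lt (le_max_right _ _) h1)
  exact ⟨w, lt_of_le_of_lt (le_max_left _ _) h1, h2⟩

/-- Multiplication of the coefficients by a linearly bounded function does not change the domain of
convergence. -/
lemma exists_bound_of_linear_growth {a b : ℕ × ℕ → ℂ} {C : ℝ}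
    (hb : ∀ p, ‖b p‖ ≤ C * (p.1 + p.2 : ℕ) * ‖a p‖) {z₁ z₂ : ℍ} (hz : z₁.im < z₂.im)
    (hs : Summable (qTerm a z₁)) :
    ∃ u : ℕ × ℕ → ℝ, Summable u ∧ ∀ z : ℍ, z₂.im ≤ z.im → ∀ p, ‖qTerm b z p‖ ≤ u p := by
  have hr : |‖qVar z₂‖ / ‖qVar z₁‖| < 1 := by
    rw [abs_of_nonneg (by positivity), div_lt_one (norm_qVar_pos z₁)]
    exact norm_qVar_lt hz
  -- With ρ = |q(z₂)|/|q(z₁)| < 1 the sequence N ρ^N is bounded, so a factor linear in the degree N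
  -- is absorbed by convergence at the lower point z₁.
  have ht := tendsto_self_mul_const_pow_of_abs_lt_one hr
  obtain ⟨B, hB⟩ := ht.bddAbove_range
  refine ⟨fun p => |C| * B * ‖qTerm a z₁ p‖, hs.norm.mul_left _, fun z hz2 p => ?_⟩
  have hB' := hB ⟨p.1 + p.2, rfl⟩
  simp only at hB'
  rw [div_pow, mul_div_assoc', div_le_iff₀ (pow_pos (norm_qVar_pos z₁) _)] at hB'
  simp only [norm_qTerm]
  have h1 : ‖qVar z‖ ^ (p.1 + p.2) ≤ ‖qVar z₂‖ ^ (p.1 + p.2) :=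
    pow_le_pow_left₀ (norm_nonneg _) (norm_qVar_le hz2) _
  calc ‖b p‖ * ‖qVar z‖ ^ (p.1 + p.2)
      ≤ (|C| * (p.1 + p.2 : ℕ) * ‖a p‖) * ‖qVar z₂‖ ^ (p.1 + p.2) := by
        gcongr
        refine (hb p).trans ?_
        gcongr
        exact le_abs_self C
    _ = |C| * ‖a p‖ * ((p.1 + p.2 : ℕ) * ‖qVar z₂‖ ^ (p.1 + p.2)) := by ring
    _ ≤ |C| * ‖a p‖ * (B * ‖qVar z₁‖ ^ (p.1 + p.2)) := by gcongr
    _ = _ := by ring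

lemma isPreconnected_im_gt (y : ℝ) : IsPreconnected {w : ℂ | y < w.im} :=
  (convex_halfSpace_im_gt y).isPreconnected

lemma isOpen_im_gt (y : ℝ) : IsOpen {w : ℂ | y < w.im} :=
  isOpen_lt continuous_const Complex.continuous_im

section

variable {a : ℕ × ℕ → ℂ} {Y : ℝ}

lemma norm_wirtinger_coeff_le (p : ℕ × ℕ) :
    ‖2 * Real.pi * I * p.1 * a p‖ ≤ 2 * Real.pi * (p.1 + p.2 : ℕ) * ‖a p‖ := by
  simp only [norm_mul, RCLike.norm_ofNat, norm_I, mul_one, norm_natCast, norm_real]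
  rw [Real.norm_of_nonneg Real.pi_pos.le]
  gcongr
  omega

lemma norm_wirtingerBar_coeff_le (p : ℕ × ℕ) :
    ‖-(2 * Real.pi * I * p.2 * a p)‖ ≤ 2 * Real.pi * (p.1 + p.2 : ℕ) * ‖a p‖ := by
  simp only [norm_neg, norm_mul, RCLike.norm_ofNat, norm_I, mul_one, norm_natCast, norm_real]
  rw [Real.norm_of_nonneg Real.pi_pos.le]
  gcongr
  omega

lemma summable_qTerm_of_linear_growth {b : ℕ × ℕ → ℂ} {C : ℝ}
    (hb : ∀ p, ‖b p‖ ≤ C * (p.1 + p.2 : ℕ) * ‖a p‖)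
    (hs : ∀ z : ℍ, Y < z.im → Summable (qTerm a z)) {z : ℍ} (hz : Y < z.im) :
    Summable (qTerm b z) := by
  obtain ⟨z₁, h1, h2⟩ := exists_im_between hz
  obtain ⟨u, hu, hub⟩ := exists_bound_of_linear_growth hb h2 (hs z₁ h1)
  exact .of_norm_bounded hu (hub z le_rfl)

lemma hasWirtinger_qSum (hs : ∀ z : ℍ, Y < z.im → Summable (qTerm a z)) {z : ℍ} (hz : Y < z.im) :
    HasWirtinger (qSum a) (qSum (fun p => 2 * Real.pi * I * p.1 * a p) z)
      (qSum (fun p => -(2 * Real.pi * I * p.2 * a p)) z) z := by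
  -- Two intermediate heights are needed: the series converges at z₁, and its derivatives are
  -- dominated on the open half plane above z₂, which contains z.
  obtain ⟨z₂, h2, h3⟩ := exists_im_between hz
  obtain ⟨z₁, h1, h2'⟩ := exists_im_between h2
  obtain ⟨u, hu, hub⟩ := exists_bound_of_linear_growth (norm_wirtinger_coeff_le (a := a)) h2' (hs z₁ h1)
  obtain ⟨v, hv, hvb⟩ := exists_bound_of_linear_growth (norm_wirtingerBar_coeff_le (a := a)) h2' (hs z₁ h1)
  have hu0 (p) : 0 ≤ u p := (norm_nonneg _).trans (hub z₂ le_rfl p)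
  have hv0 (p) : 0 ≤ v p := (norm_nonneg _).trans (hvb z₂ le_rfl p)
  refine hasWirtinger_tsum (hu.add hv) (isOpen_im_gt z₂.im) (isPreconnected_im_gt z₂.im)
    (fun w hw => lt_trans z₂.im_pos hw) (fun p w _ => hasWirtinger_qTerm a p w)
    (fun p w hw => ?_) (fun p w hw => ?_) (z₀ := z) h3 (hs z hz) h3
  · exact (hub w (le_of_lt hw) p).trans (le_add_of_nonneg_right (hv0 p))
  · exact (hvb w (le_of_lt hw) p).trans (le_add_of_nonneg_left (hu0 p))

/-- A power series in `q`, `q̄` without terms of total degree less than `N` is asymptotic to its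
homogeneous part of degree `N`. -/
lemma norm_qSum_sub_le (N : ℕ) (ha : ∀ p : ℕ × ℕ, p.1 + p.2 < N → a p = 0) {z₁ : ℍ}
    (hs : Summable (qTerm a z₁)) :
    ∃ C : ℝ, ∀ z : ℍ, z₁.im ≤ z.im →
      ‖qSum a z - ∑ p ∈ Finset.HasAntidiagonal.antidiagonal N, qTerm a z p‖ ≤ C * ‖qVar z‖ ^ (N + 1) := by
  -- Compared with its value at z₁, each term of degree at least N + 1 gains the factor
  -- (|q(z)|/|q(z₁)|)^{N+1}.
  refine ⟨(∑' p, ‖qTerm a z₁ p‖) / ‖qVar z₁‖ ^ (N + 1), fun z hz => ?_⟩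
  have hle := norm_qVar_le hz
  have hpos := norm_qVar_pos z₁
  have hsz : Summable (qTerm a z) := by
    refine .of_norm_bounded hs.norm fun p => ?_
    rw [norm_qTerm, norm_qTerm]
    gcongr
  rw [qSum, ← hsz.sum_add_tsum_compl (s := Finset.HasAntidiagonal.antidiagonal N), add_sub_cancel_left]
  have hb : ∀ p : ↥((Finset.HasAntidiagonal.antidiagonal N : Set (ℕ × ℕ))ᶜ), ‖qTerm a z p‖ ≤
      ‖qTerm a z₁ p‖ * (‖qVar z‖ ^ (N + 1) / ‖qVar z₁‖ ^ (N + 1)) := by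
    rintro ⟨p, hp⟩
    simp only [Set.mem_compl_iff, Finset.mem_coe, Finset.HasAntidiagonal.mem_antidiagonal] at hp
    rcases lt_or_gt_of_ne hp with hp | hp
    · simp [norm_qTerm, ha p hp]
    · rw [norm_qTerm, norm_qTerm, mul_assoc]
      gcongr
      obtain ⟨d, hd⟩ := Nat.exists_eq_add_of_le (Nat.succ_le_of_lt hp)
      rw [hd, Nat.succ_eq_add_one, pow_add, pow_add ‖qVar z₁‖, mul_div_assoc', le_div_iff₀ (by positivity)]
      have : ‖qVar z‖ ^ d ≤ ‖qVar z₁‖ ^ d := pow_le_pow_left₀ (norm_nonneg _) hle d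
      calc ‖qVar z‖ ^ (N + 1) * ‖qVar z‖ ^ d * ‖qVar z₁‖ ^ (N + 1)
          ≤ ‖qVar z‖ ^ (N + 1) * ‖qVar z₁‖ ^ d * ‖qVar z₁‖ ^ (N + 1) := by gcongr
        _ = _ := by ring
  have hs1 : Summable fun p : ↥((Finset.HasAntidiagonal.antidiagonal N : Set (ℕ × ℕ))ᶜ) => ‖qTerm a z₁ p‖ :=
    hs.norm.subtype _
  refine (tsum_of_norm_bounded (hs1.mul_right _).hasSum hb).trans ?_
  rw [tsum_mul_right, div_mul_eq_mul_div, mul_div_assoc]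
  gcongr
  exact Summable.tsum_subtype_le (fun p => ‖qTerm a z₁ p‖) _ (fun p => norm_nonneg _) hs.norm

end

/-! ### Expansions at the cusp -/

/-- `f = ∑_{k ∈ S} 𝕃^k ∑_{m,n} c^{(k)}_{m,n} q^m q̄^n` for `Im z > Y`. -/
structure Expands (f : ℍ → ℂ) (S : Finset ℤ) (c : ℤ → ℕ × ℕ → ℂ) (Y : ℝ) : Prop where
  eq_zero : ∀ k ∉ S, c k = 0
  summable : ∀ k, ∀ z : ℍ, Y < z.im → Summable (qTerm (c k) z)
  eq_sum : ∀ z : ℍ, Y < z.im → f z = ∑ k ∈ S, LL z ^ k * qSum (c k) z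

lemma hasCuspExpansion_iff {f : ℍ → ℂ} : HasCuspExpansion f ↔ ∃ S c Y, Expands f S c Y := by
  constructor
  · rintro ⟨a, Y, h⟩
    exact ⟨a.support, a, Y, fun k hk => Finsupp.notMem_support_iff.mp hk, fun k z hz => (h z hz).1 k,
      fun z hz => (h z hz).2⟩
  · rintro ⟨S, c, Y, h⟩
    refine ⟨Finsupp.onFinset S c fun k hk => by_contra fun hS => hk (h.eq_zero k hS), Y,
      fun z hz => ⟨fun k => h.summable k z hz, ?_⟩⟩
    rw [h.eq_sum z hz]
    refine (sum_support_of_subset _ S Finsupp.support_onFinset_subset z).symm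

lemma qSum_zero (z : ℍ) : qSum 0 z = 0 := by simp [qSum, qTerm_zero]

namespace Expands

variable {f g : ℍ → ℂ} {S T : Finset ℤ} {c d : ℤ → ℕ × ℕ → ℂ} {Y Y' : ℝ}

lemma mono (h : Expands f S c Y) (hST : S ⊆ T) (hY : Y ≤ Y') : Expands f T c Y' where
  eq_zero k hk := h.eq_zero k fun hS => hk (hST hS)
  summable k z hz := h.summable k z (lt_of_le_of_lt hY hz)
  eq_sum z hz := by
    rw [h.eq_sum z (lt_of_le_of_lt hY hz)]
    refine Finset.sum_subset hST fun k _ hk => ?_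
    rw [h.eq_zero k hk, qSum_zero, mul_zero]

lemma congr (h : Expands f S c Y) (hfg : ∀ z : ℍ, Y < z.im → g z = f z) : Expands g S c Y :=
  ⟨h.eq_zero, h.summable, fun z hz => (hfg z hz).trans (h.eq_sum z hz)⟩

lemma congr_coeff (h : Expands f S c Y) (hcd : ∀ k p, d k p = c k p) : Expands f S d Y := by
  obtain rfl : d = c := funext fun k => funext (hcd k)
  exact h

lemma add (hf : Expands f S c Y) (hg : Expands g T d Y) : Expands (f + g) (S ∪ T) (c + d) Y := by
  have hf' := hf.mono Finset.subset_union_left (T := S ∪ T) le_rfl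
  have hg' := hg.mono Finset.subset_union_right (T := S ∪ T) le_rfl
  refine ⟨fun k hk => ?_, fun k z hz => ?_, fun z hz => ?_⟩
  · rw [Pi.add_apply, hf'.eq_zero k hk, hg'.eq_zero k hk, add_zero]
  · rw [Pi.add_apply, qTerm_add]
    exact (hf.summable k z hz).add (hg.summable k z hz)
  · rw [Pi.add_apply, hf'.eq_sum z hz, hg'.eq_sum z hz, ← Finset.sum_add_distrib]
    refine Finset.sum_congr rfl fun k _ => ?_
    rw [← mul_add, Pi.add_apply, qSum, qSum, qSum, qTerm_add,
      ← (hf.summable k z hz).tsum_add (hg.summable k z hz)]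
    rfl

/-- Multiplication of the coefficient of `𝕃^k` by `e k`. -/
lemma coeff_mul (h : Expands f S c Y) (e : ℤ → ℂ) :
    Expands (fun z => ∑ k ∈ S, e k * (LL z ^ k * qSum (c k) z)) S (fun k p => e k * c k p) Y := by
  have he (k : ℤ) (z : ℍ) : qTerm (fun p => e k * c k p) z = fun p => e k * qTerm (c k) z p := by
    funext p; simp [qTerm, mul_assoc]
  refine ⟨fun k hk => ?_, fun k z hz => ?_, fun z hz => ?_⟩
  · funext p; simp [h.eq_zero k hk]
  · rw [he]; exact (h.summable k z hz).mul_left _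
  · refine Finset.sum_congr rfl fun k _ => ?_
    rw [qSum, qSum, he, tsum_mul_left]; ring

lemma smul (h : Expands f S c Y) (e : ℂ) : Expands (e • f) S (e • c) Y := by
  refine ((h.coeff_mul fun _ => e).congr fun z hz => ?_).congr_coeff fun k p => rfl
  rw [Pi.smul_apply, h.eq_sum z hz, Finset.smul_sum]; rfl

lemma LL_zpow_mul (h : Expands f S c Y) (j : ℤ) :
    Expands (fun z => LL z ^ j * f z) (S.image (· + j)) (fun k => c (k - j)) Y := by
  refine ⟨fun k hk => h.eq_zero _ fun hS => hk ?_, fun k z hz => h.summable _ z hz, fun z hz => ?_⟩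
  · exact Finset.mem_image.mpr ⟨k - j, hS, by ring⟩
  · rw [h.eq_sum z hz, Finset.sum_image (fun x _ y _ hxy => by simpa using hxy), Finset.mul_sum]
    refine Finset.sum_congr rfl fun k _ => ?_
    rw [add_sub_cancel_right, zpow_add₀ (LL_ne_zero z)]; ring

lemma star (h : Expands f S c Y) :
    Expands (fun z => conj (f z)) S (fun k p => conj (c k p.swap)) Y := by
  have he (k : ℤ) (z : ℍ) : qTerm (fun p => conj (c k p.swap)) z =
      (fun p => conj (qTerm (c k) z p)) ∘ Equiv.prodComm ℕ ℕ := by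
    funext p; simp [qTerm]; ring
  refine ⟨fun k hk => ?_, fun k z hz => ?_, fun z hz => ?_⟩
  · funext p; simp [h.eq_zero k hk]
  · rw [he, Equiv.summable_iff]
    exact (h.summable k z hz).star
  · rw [h.eq_sum z hz, map_sum]
    refine Finset.sum_congr rfl fun k _ => ?_
    rw [qSum, qSum, he, map_mul, map_zpow₀, conj_LL, conj_tsum]
    congr 1
    exact ((Equiv.prodComm ℕ ℕ).tsum_eq (fun p => conj (qTerm (c k) z p))).symm

lemma eventuallyEq (h : Expands f S c Y) {z : ℍ} (hz : Y < z.im) :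
    f =ᶠ[𝓝 z] fun z => ∑ k ∈ S, LL z ^ k * qSum (c k) z := by
  have : ∀ᶠ w in 𝓝 z, Y < UpperHalfPlane.im w :=
    UpperHalfPlane.continuous_im.continuousAt.eventually (lt_mem_nhds hz)
  filter_upwards [this] with w hw
  exact h.eq_sum w hw

end Expands

lemma hasWirtinger_finset_sum {ι : Type*} (S : Finset ι) {f : ι → ℍ → ℂ} {a b : ι → ℂ} {z : ℍ}
    (h : ∀ i ∈ S, HasWirtinger (f i) (a i) (b i) z) :
    HasWirtinger (fun z => ∑ i ∈ S, f i z) (∑ i ∈ S, a i) (∑ i ∈ S, b i) z := by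
  classical
  induction S using Finset.induction_on with
  | empty => simpa using hasWirtinger_const 0 z
  | insert i S hi ih =>
    simp only [Finset.sum_insert hi]
    exact (h i (Finset.mem_insert_self i S)).add
      (ih fun j hj => h j (Finset.mem_insert_of_mem hj))

namespace Expands

variable {f g : ℍ → ℂ} {S T : Finset ℤ} {c d : ℤ → ℕ × ℕ → ℂ} {Y Y' : ℝ}

/-- The expansion of `∂_r f`. -/
lemma maass (h : Expands f S c Y) (r : ℤ) :
    Expands (maass r f) (S ∪ S.image (· + 1))
      (fun k p => ((k + r : ℤ) : ℂ) * c k p + 2 * p.1 * c (k - 1) p) Y := by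
  have hlin (k : ℤ) (p : ℕ × ℕ) : ‖(2 * p.1 * c k p : ℂ)‖ ≤ 2 * (p.1 + p.2 : ℕ) * ‖c k p‖ := by
    simp only [norm_mul, RCLike.norm_ofNat, norm_natCast]
    gcongr; omega
  -- Since z - z̄ = 𝕃/(πi), the operator (z - z̄)∂/∂z sends q^m to 2m𝕃q^m; this is the source of the
  -- factor 2m and of the shift by one power of 𝕃.
  have h2 : Expands (fun z => ∑ k ∈ S, LL z ^ k * qSum (fun p => 2 * p.1 * c k p) z) S
      (fun k p => 2 * p.1 * c k p) Y :=
    ⟨fun k hk => by funext p; simp [h.eq_zero k hk],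
      fun k z hz => summable_qTerm_of_linear_growth (hlin k) (h.summable k) hz, fun z _ => rfl⟩
  refine (((h.coeff_mul fun k => ((k + r : ℤ) : ℂ)).add (h2.LL_zpow_mul 1)).congr
    fun z hz => ?_).congr_coeff fun k p => rfl
  have hW := (hasWirtinger_finset_sum S fun k _ =>
    (hasWirtinger_LL_zpow k z).mul (hasWirtinger_qSum (h.summable k) hz)).congr (h.eventuallyEq hz)
  rw [hW.maass, h.eq_sum z hz, Pi.add_apply, Finset.mul_sum, Finset.mul_sum, Finset.mul_sum,
    ← Finset.sum_add_distrib, ← Finset.sum_add_distrib]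
  refine Finset.sum_congr rfl fun k _ => ?_
  have e1 : qSum (fun p => 2 * Real.pi * I * p.1 * c k p) z =
      Real.pi * I * qSum (fun p => 2 * p.1 * c k p) z := by
    rw [qSum, qSum, ← tsum_mul_left]
    congr 1; funext p; simp only [qTerm]; ring
  rw [e1, zpow_one, LL_zpow_pred k z, Int.cast_add]
  linear_combination (-(k : ℂ) * LL z ^ (k - 1) * qSum (c k) z - LL z ^ (k - 1) * LL z *
    qSum (fun p => 2 * p.1 * c k p) z) * LL_eq z

/-- The expansion of `∂̄_s f`. -/
lemma maassBar (h : Expands f S c Y) (hs : IsSmooth 1 f) (s : ℤ) :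
    Expands (maassBar s f) (S ∪ S.image (· + 1))
      (fun k p => ((k + s : ℤ) : ℂ) * c k p + 2 * p.2 * c (k - 1) p) Y := by
  have h1 := (h.star.maass s).star
  rw [maass_star hs le_rfl] at h1
  refine (h1.congr fun z _ => by simp).congr_coeff fun k p => ?_
  simp [show conj (2 : ℂ) = 2 from map_ofNat _ 2]

/-- Functions with an expansion grow at most polynomially at the cusp. -/
lemma exists_bound (h : Expands f S c Y) :
    ∃ (C : ℝ) (K : ℕ) (Y' : ℝ), 1 ≤ Y' ∧ ∀ z : ℍ, Y' ≤ z.im → ‖f z‖ ≤ C * z.im ^ K := by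
  obtain ⟨z₁, hz₁⟩ := exists_im_eq (y := max Y 1 + 1) (by positivity)
  have hY₁ : Y < z₁.im := by rw [hz₁]; linarith [le_max_left Y 1]
  have hb (k : ℤ) (z : ℍ) (hz : z₁.im ≤ z.im) : ‖qSum (c k) z‖ ≤ ∑' p, ‖qTerm (c k) z₁ p‖ := by
    refine tsum_of_norm_bounded (h.summable k z₁ hY₁).norm.hasSum fun p => ?_
    rw [norm_qTerm, norm_qTerm]
    gcongr
    exact norm_qVar_le hz
  refine ⟨∑ k ∈ S, (2 * Real.pi) ^ k * ∑' p, ‖qTerm (c k) z₁ p‖, ∑ k ∈ S, k.natAbs, z₁.im,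
    by rw [hz₁]; linarith [le_max_right Y 1], fun z hz => ?_⟩
  have h1 : 1 ≤ z.im := le_trans (by rw [hz₁]; linarith [le_max_right Y 1]) hz
  rw [h.eq_sum z (lt_of_lt_of_le hY₁ hz), Finset.sum_mul]
  refine (norm_sum_le _ _).trans (Finset.sum_le_sum fun k hk => ?_)
  have hL : ‖LL z‖ = 2 * Real.pi * z.im := by
    simp [LL, abs_of_pos Real.pi_pos, abs_of_pos z.im_pos]
  rw [norm_mul, norm_zpow, hL, mul_zpow, mul_assoc, mul_assoc, mul_comm (∑' p, _)]
  gcongr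
  · rw [← zpow_natCast]
    refine zpow_le_zpow_right₀ h1 ?_
    have : k.natAbs ≤ ∑ k ∈ S, k.natAbs := Finset.single_le_sum (f := Int.natAbs) (fun _ _ => Nat.zero_le _) hk
    omega
  · exact hb k z hz

end Expands

/-! ### Uniqueness of expansions -/

lemma norm_LL (z : ℍ) : ‖LL z‖ = 2 * Real.pi * z.im := by
  simp [LL, abs_of_pos Real.pi_pos, abs_of_pos z.im_pos]

lemma norm_qVar_eq (z : ℍ) : ‖qVar z‖ = Real.exp (-‖LL z‖) := by
  rw [norm_qVar, norm_LL]; ring_nf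

lemma tendsto_norm_LL : Tendsto (fun z => ‖LL z‖) atImInfty atTop := by
  simp only [norm_LL]
  exact tendsto_comap.const_mul_atTop (by positivity)

lemma tendsto_LL_zpow_of_neg {j : ℤ} (hj : j < 0) :
    Tendsto (fun z => LL z ^ j) atImInfty (𝓝 0) := by
  rw [tendsto_zero_iff_norm_tendsto_zero]
  simp only [norm_zpow]
  exact (tendsto_zpow_atTop_zero hj).comp tendsto_norm_LL

lemma tendsto_zpow_mul_exp_neg (j : ℤ) :
    Tendsto (fun x : ℝ => x ^ j * Real.exp (-x)) atTop (𝓝 0) := by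
  refine squeeze_zero' ?_ ?_ (Real.tendsto_pow_mul_exp_neg_atTop_nhds_zero j.natAbs)
  · filter_upwards [eventually_ge_atTop 1] with x hx
    have : 0 < x := by linarith
    positivity
  · filter_upwards [eventually_ge_atTop 1] with x hx
    gcongr
    rw [← zpow_natCast]
    exact zpow_le_zpow_right₀ hx (by omega)

/-- Because |q| = exp(-|𝕃|), a bound by |q| beats every power of 𝕃. -/
lemma tendsto_LL_zpow_mul_of_norm_le {j : ℤ} {R : ℍ → ℂ} {C : ℝ}
    (h : ∀ᶠ z in atImInfty, ‖R z‖ ≤ C * ‖qVar z‖) :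
    Tendsto (fun z => LL z ^ j * R z) atImInfty (𝓝 0) := by
  have h1 := ((tendsto_zpow_mul_exp_neg j).comp tendsto_norm_LL).const_mul C
  rw [mul_zero] at h1
  refine squeeze_zero_norm' ?_ h1
  filter_upwards [h] with z hz
  rw [norm_mul, norm_zpow, Function.comp_apply]
  calc ‖LL z‖ ^ j * ‖R z‖ ≤ ‖LL z‖ ^ j * (C * ‖qVar z‖) := by gcongr
    _ = _ := by rw [norm_qVar_eq]; ring

lemma eventually_im_ge (y : ℝ) : ∀ᶠ z in atImInfty, y ≤ UpperHalfPlane.im z :=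
  tendsto_comap.eventually (eventually_ge_atTop y)

lemma eventually_im_gt (y : ℝ) : ∀ᶠ z in atImInfty, y < UpperHalfPlane.im z :=
  tendsto_comap.eventually (eventually_gt_atTop y)

/-- The vertical line `x + iy`, `y → ∞`. -/
def vertical (x y : ℝ) : ℍ := ofComplex (x + y * I)

lemma coe_vertical {x y : ℝ} (hy : 0 < y) : (vertical x y : ℂ) = x + y * I :=
  coe_ofComplex_of_im_pos (by simpa using hy)

lemma im_vertical {x y : ℝ} (hy : 0 < y) : (vertical x y).im = y := by
  have := congrArg Complex.im (coe_vertical (x := x) hy)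
  simpa using this

lemma tendsto_vertical (x : ℝ) : Tendsto (vertical x) atTop atImInfty := by
  refine tendsto_comap_iff.mpr (tendsto_id.congr' ?_)
  filter_upwards [eventually_gt_atTop 0] with y hy
  exact (im_vertical hy).symm

lemma qVar_vertical {x y : ℝ} (hy : 0 < y) :
    qVar (vertical x y) = ‖qVar (vertical x y)‖ * cexp (2 * Real.pi * x * I) := by
  rw [norm_qVar, im_vertical hy, qVar, coe_vertical hy, ofReal_exp, ← Complex.exp_add]
  congr 1
  push_cast
  linear_combination (2 * Real.pi * y) * I_sq

/-- Supplies the infinitely many roots in `coeff_eq_zero_of_trig_sum`. The square appears because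
the polynomial there is evaluated at u² with u on the unit circle. -/
lemma infinite_range_cexp : (Set.range fun x : ℝ => cexp (2 * Real.pi * x * I) ^ 2).Infinite := by
  have h : Set.InjOn (fun θ : ℝ => (Circle.exp θ : ℂ)) (Set.Ioc (-Real.pi) Real.pi) := by
    intro a ha b hb hab
    have := congrArg Complex.arg hab
    dsimp only at this
    rwa [Circle.arg_exp ha.1 ha.2, Circle.arg_exp hb.1 hb.2] at this
  refine ((Set.Ioc_infinite (by linarith [Real.pi_pos])).image h).mono ?_
  rintro _ ⟨θ, _, rfl⟩
  refine ⟨θ / (4 * Real.pi), ?_⟩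
  simp only [Circle.coe_exp, ← Complex.exp_nat_mul]
  congr 1
  push_cast
  have := Real.pi_ne_zero
  field_simp
  ring

/-- A trigonometric polynomial which vanishes identically has vanishing coefficients. -/
lemma coeff_eq_zero_of_trig_sum {N : ℕ} {a : ℕ × ℕ → ℂ}
    (h : ∀ x : ℝ, ∑ p ∈ Finset.HasAntidiagonal.antidiagonal N,
      a p * cexp (2 * Real.pi * x * I) ^ p.1 * conj (cexp (2 * Real.pi * x * I)) ^ p.2 = 0) :
    ∀ p ∈ Finset.HasAntidiagonal.antidiagonal N, a p = 0 := by
  classical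
  -- On the unit circle ū = u⁻¹, so for m + n = N multiplication by u^N turns u^m ū^n into (u²)^m:
  -- the form becomes a polynomial in u².
  set P : Polynomial ℂ := ∑ p ∈ Finset.HasAntidiagonal.antidiagonal N, Polynomial.C (a p) * Polynomial.X ^ p.1
  have hP : P = 0 := by
    refine Polynomial.eq_zero_of_infinite_isRoot P (infinite_range_cexp.mono ?_)
    rintro _ ⟨x, rfl⟩
    have hx := h x
    set u := cexp (2 * Real.pi * x * I) with hu
    have huu : u * conj u = 1 := by
      rw [Complex.mul_conj, Complex.normSq_eq_norm_sq, hu, show (2 * Real.pi * x * I : ℂ) =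
        ((2 * Real.pi * x : ℝ) : ℂ) * I by push_cast; ring, Complex.norm_exp_ofReal_mul_I]
      simp
    rw [Set.mem_ofPred_eq, Polynomial.IsRoot, Polynomial.eval_finsetSum]
    rw [← mul_zero (u ^ N), ← hx, Finset.mul_sum]
    refine Finset.sum_congr rfl fun p hp => ?_
    rw [Finset.HasAntidiagonal.mem_antidiagonal] at hp
    simp only [Polynomial.eval_mul, Polynomial.eval_C, Polynomial.eval_pow, Polynomial.eval_X]
    rw [← hp, pow_add]
    have : u ^ p.2 * conj u ^ p.2 = 1 := by rw [← mul_pow, huu, one_pow]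
    linear_combination (-a p * u ^ p.1 * u ^ p.1) * this
  intro p hp
  have h2 : P.coeff p.1 = a p := by
    rw [Polynomial.finsetSum_coeff, Finset.sum_eq_single p]
    · simp
    · intro p' hp' hne
      rw [Polynomial.coeff_C_mul_X_pow, if_neg]
      intro h1
      rw [Finset.HasAntidiagonal.mem_antidiagonal] at hp hp'
      exact hne (Prod.ext h1.symm (by omega))
    · exact fun h => absurd hp h
  rw [← h2, hP, Polynomial.coeff_zero]

namespace Expands

variable {f : ℍ → ℂ} {S : Finset ℤ} {c : ℤ → ℕ × ℕ → ℂ} {Y : ℝ}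

/-- The leading homogeneous part of an expansion along a vertical line. -/
lemma tendsto_LL_zpow_mul_qSum (h : Expands f S c Y) (N : ℕ)
    (hN : ∀ k (p : ℕ × ℕ), p.1 + p.2 < N → c k p = 0) (x : ℝ) (k j : ℤ) :
    Tendsto (fun y : ℝ => LL (vertical x y) ^ j * (qSum (c k) (vertical x y) /
      ‖qVar (vertical x y)‖ ^ N - ∑ p ∈ Finset.HasAntidiagonal.antidiagonal N, c k p *
        cexp (2 * Real.pi * x * I) ^ p.1 * conj (cexp (2 * Real.pi * x * I)) ^ p.2)) atTop (𝓝 0) := by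
  obtain ⟨z₁, hz₁⟩ := exists_im_eq (y := max Y 0 + 1) (by positivity)
  obtain ⟨C, hC⟩ := norm_qSum_sub_le N (hN k)
    (h.summable k z₁ (by rw [hz₁]; linarith [le_max_left Y 0]))
  have key := (tendsto_LL_zpow_mul_of_norm_le (j := j) (C := C)
    (R := fun z => (qSum (c k) z - ∑ p ∈ Finset.HasAntidiagonal.antidiagonal N, qTerm (c k) z p) /
      ‖qVar z‖ ^ N) (by
    filter_upwards [eventually_im_ge z₁.im] with z hz
    rw [norm_div, norm_pow, norm_real, norm_norm, div_le_iff₀ (pow_pos (norm_qVar_pos z) _)]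
    refine (hC z hz).trans (le_of_eq ?_)
    ring)).comp (tendsto_vertical x)
  refine key.congr' ?_
  filter_upwards [eventually_gt_atTop 0] with y hy
  simp only [Function.comp_apply]
  congr 1
  rw [sub_div, Finset.sum_div]
  congr 1
  refine Finset.sum_congr rfl fun p hp => ?_
  rw [Finset.HasAntidiagonal.mem_antidiagonal] at hp
  have hne : (‖qVar (vertical x y)‖ : ℂ) ≠ 0 := by exact_mod_cast (norm_qVar_pos _).ne'
  rw [div_eq_iff (pow_ne_zero _ hne), qTerm, ← hp]
  conv_lhs => rw [qVar_vertical hy]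
  rw [map_mul, conj_ofReal, mul_pow, mul_pow, pow_add]
  ring

/-- Take the lowest total degree N with a non-zero coefficient and the largest exponent k₀ of 𝕃 in
that degree. Dividing by 𝕃^{k₀}|q|^N and letting y → ∞ along the line of abscissa x leaves the
trigonometric polynomial in x formed by these leading coefficients. It vanishes for all x, so the
leading coefficients are zero, a contradiction. -/
lemma coeff_eq_zero (h : Expands f S c Y) (hf : ∀ z : ℍ, Y < z.im → f z = 0) (k : ℤ)
    (p : ℕ × ℕ) : c k p = 0 := by
  classical
  by_contra hkp
  have hex : ∃ N : ℕ, ∃ k, ∃ p : ℕ × ℕ, p.1 + p.2 = N ∧ c k p ≠ 0 := ⟨_, k, p, rfl, hkp⟩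
  set N := Nat.find hex with hNdef
  have hN : ∀ k (p : ℕ × ℕ), p.1 + p.2 < N → c k p = 0 := fun k p hp => by
    by_contra hne
    exact Nat.find_min hex hp ⟨k, p, rfl, hne⟩
  set T := S.filter fun k => ∃ p : ℕ × ℕ, p.1 + p.2 = N ∧ c k p ≠ 0 with hT
  have hTne : T.Nonempty := by
    obtain ⟨k, p, hp, hne⟩ := Nat.find_spec hex
    refine ⟨k, Finset.mem_filter.mpr ⟨by_contra fun hk => hne ?_, p, hp, hne⟩⟩
    rw [h.eq_zero k hk]; rfl
  set k₀ := T.max' hTne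
  obtain ⟨hk₀S, p₀, hp₀, hne₀⟩ := Finset.mem_filter.mp (T.max'_mem hTne)
  have hmax : ∀ k, k₀ < k → ∀ p : ℕ × ℕ, p.1 + p.2 = N → c k p = 0 := fun k hk p hp => by
    by_contra hne
    have hkT : k ∈ T := Finset.mem_filter.mpr
      ⟨by_contra fun hkS => hne (by rw [h.eq_zero k hkS]; rfl), p, hp, hne⟩
    exact absurd (T.le_max' k hkT) (not_le.mpr hk)
  refine hne₀ (coeff_eq_zero_of_trig_sum (N := N) (a := c k₀) (fun x => ?_) p₀
    (Finset.HasAntidiagonal.mem_antidiagonal.mpr hp₀))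
  set A : ℤ → ℂ := fun k => ∑ p ∈ Finset.HasAntidiagonal.antidiagonal N, c k p *
        cexp (2 * Real.pi * x * I) ^ p.1 * conj (cexp (2 * Real.pi * x * I)) ^ p.2 with hA
  have hAk : ∀ k, k₀ < k → A k = 0 := fun k hk => Finset.sum_eq_zero fun p hp => by
    rw [hmax k hk p (Finset.HasAntidiagonal.mem_antidiagonal.mp hp)]; ring
  have hlim : ∀ k ∈ S, Tendsto (fun y : ℝ => LL (vertical x y) ^ (k - k₀) *
      (qSum (c k) (vertical x y) / ‖qVar (vertical x y)‖ ^ N)) atTop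
      (𝓝 (if k = k₀ then A k₀ else 0)) := fun k _ => by
    have h1 := h.tendsto_LL_zpow_mul_qSum N hN x k (k - k₀)
    have h2 : Tendsto (fun y : ℝ => LL (vertical x y) ^ (k - k₀) * A k) atTop
        (𝓝 (if k = k₀ then A k₀ else 0)) := by
      rcases lt_trichotomy k k₀ with hk | hk | hk
      · rw [if_neg hk.ne]
        simpa using ((tendsto_LL_zpow_of_neg (sub_neg.mpr hk)).comp
          (tendsto_vertical x)).mul_const (A k)
      · subst hk; simp
      · rw [if_neg hk.ne', hAk k hk]; simp
    have h3 := h1.add h2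
    rw [zero_add] at h3
    refine h3.congr fun y => ?_
    rw [← mul_add, sub_add_cancel]
  have hsum := tendsto_finsetSum S hlim
  rw [Finset.sum_ite_eq' S k₀, if_pos hk₀S] at hsum
  refine tendsto_nhds_unique hsum (tendsto_const_nhds.congr' ?_)
  filter_upwards [(tendsto_vertical x).eventually (eventually_im_gt Y)] with y hy
  have h0 := (h.eq_sum _ hy).symm.trans (hf _ hy)
  rw [← zero_div ((LL (vertical x y)) ^ k₀ * (‖qVar (vertical x y)‖ : ℂ) ^ N), ← h0, Finset.sum_div]
  refine Finset.sum_congr rfl fun k _ => ?_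
  have := LL_ne_zero (vertical x y)
  rw [zpow_sub₀ this, mul_div_mul_comm]

end Expands

/-- A real analytic function with vanishing expansion is zero. -/
lemma IsRealAnalytic.eq_zero {f : ℍ → ℂ} (hf : IsRealAnalytic f) {Y : ℝ}
    (h : ∀ z : ℍ, Y < z.im → f z = 0) : f = 0 := by
  obtain ⟨z₁, hz₁⟩ := exists_im_eq (y := max Y 0 + 1) (by positivity)
  have hev : f ∘ ofComplex =ᶠ[𝓝 (z₁ : ℂ)] (fun _ => (0 : ℂ)) ∘ ofComplex := by
    refine eventuallyEq_comp_ofComplex ?_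
    have : ∀ᶠ w in 𝓝 z₁, Y < UpperHalfPlane.im w :=
      UpperHalfPlane.continuous_im.continuousAt.eventually
        (lt_mem_nhds (by rw [hz₁]; linarith [le_max_left Y 0]))
    filter_upwards [this] with w hw using h w hw
  have := AnalyticOnNhd.eqOn_of_preconnected_of_eventuallyEq hf
    (fun _ _ => analyticAt_const) (isPreconnected_im_gt 0) z₁.im_pos hev
  funext z
  have hz := this z.im_pos
  simp only [Function.comp_apply, ofComplex_apply] at hz
  exact hz

/-! ### The spaces `𝓜_{r,s}` -/

namespace MSpace

variable {r s : ℤ} {f : ℍ → ℂ}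

lemma isSmooth (hf : f ∈ MSpace r s) {n : WithTop ℕ∞} : IsSmooth n f :=
  (isRealAnalytic_iff.mp hf.1).of_le le_top

lemma expands (hf : f ∈ MSpace r s) : ∃ S c Y, Expands f S c Y := hasCuspExpansion_iff.mp hf.2.2

lemma of_expands (h1 : IsSmooth ω f) (h2 : IsBimodular r s f) (h3 : ∃ S c Y, Expands f S c Y) :
    f ∈ MSpace r s :=
  ⟨isRealAnalytic_iff.mpr h1, h2, hasCuspExpansion_iff.mpr h3⟩

lemma maass (hf : f ∈ MSpace r s) : maass r f ∈ MSpace (r + 1) (s - 1) := by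
  obtain ⟨S, c, Y, h⟩ := expands hf
  exact of_expands ((isSmooth hf).maass le_top r) (hf.2.1.maass (isSmooth hf)) ⟨_, _, _, h.maass r⟩

lemma maassBar (hf : f ∈ MSpace r s) : maassBar s f ∈ MSpace (r - 1) (s + 1) := by
  obtain ⟨S, c, Y, h⟩ := expands hf
  exact of_expands ((isSmooth hf).maassBar le_top s) (hf.2.1.maassBar (isSmooth hf))
    ⟨_, _, _, h.maassBar (isSmooth hf) s⟩

lemma star (hf : f ∈ MSpace r s) : (fun z => conj (f z)) ∈ MSpace s r := by
  obtain ⟨S, c, Y, h⟩ := expands hf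
  exact of_expands (isSmooth hf).star hf.2.1.star ⟨_, _, _, h.star⟩

lemma LL_zpow_mul (hf : f ∈ MSpace r s) (k : ℤ) :
    (fun z => LL z ^ k * f z) ∈ MSpace (r - k) (s - k) := by
  obtain ⟨S, c, Y, h⟩ := expands hf
  refine of_expands ((IsSmooth.LL_zpow k).mul (isSmooth hf)) ?_ ⟨_, _, _, h.LL_zpow_mul k⟩
  have := (IsBimodular.LL_zpow k).mul hf.2.1
  rwa [neg_add_eq_sub, neg_add_eq_sub] at this

lemma exists_bound (hf : f ∈ MSpace r s) : ∃ (C : ℝ) (K : ℕ) (Y : ℝ), 1 ≤ Y ∧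
    ∀ z : ℍ, Y ≤ z.im → ‖f z‖ ≤ C * z.im ^ K := by
  obtain ⟨S, c, Y, h⟩ := expands hf
  exact h.exists_bound

end MSpace

/-! ### Harmonic functions -/

/-- `f` is annihilated by `Δ_{r,s}`. -/
def IsHarmonic (r s : ℤ) (f : ℍ → ℂ) : Prop :=
  maassBar (s - 1) (maass r f) = ((r : ℂ) * (s - 1)) • f

namespace IsHarmonic

variable {r s : ℤ} {f g : ℍ → ℂ}

/-- The commutator adds r - s, and r(s-1) + (r-s) = (r-1)s. Thus harmonicity is symmetric in the two
operators, which makes it stable under conjugation. -/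
lemma maass_maassBar (h : IsHarmonic r s f) (hf : IsSmooth 2 f) :
    BigradedModular.maass (r - 1) (BigradedModular.maassBar s f) = (((r : ℂ) - 1) * s) • f := by
  rw [maass_maassBar_comm hf le_rfl, h, ← add_smul]
  congr 1; ring

lemma star (h : IsHarmonic r s f) (hf : IsSmooth 2 f) : IsHarmonic s r fun z => conj (f z) := by
  have h1 : (1 : WithTop ℕ∞) ≤ 2 := by norm_num
  rw [IsHarmonic, maass_star hf h1,
    maassBar_star (hf.maassBar (m := 1) (by rw [one_add_one_eq_two]) s) le_rfl, h.maass_maassBar hf]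
  funext z
  simp [mul_comm]

/-- Apply ∂_r to the harmonic equation and commute; the constants match because r(s-1) - (r-s+2) =
(r+1)(s-2). -/
lemma maass (h : IsHarmonic r s f) (hf : IsSmooth 3 f) :
    IsHarmonic (r + 1) (s - 1) (maass r f) := by
  have hg : IsSmooth 2 (BigradedModular.maass r f) := hf.maass (by norm_num) r
  have h1 := maass_maassBar_comm hg le_rfl (r + 1) (s - 1)
  rw [add_sub_cancel_right, h, maass_smul (hf.of_le (by norm_num)) le_rfl] at h1
  rw [IsHarmonic, eq_sub_of_add_eq h1.symm, ← sub_smul]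
  congr 1; push_cast; ring

lemma maassBar (h : IsHarmonic r s f) (hf : IsSmooth 2 f) :
    IsHarmonic (r - 1) (s + 1) (maassBar s f) := by
  rw [IsHarmonic, h.maass_maassBar hf, add_sub_cancel_right,
    maassBar_smul (hf.of_le (by norm_num)) le_rfl]
  congr 1; push_cast; ring

lemma add (h : IsHarmonic r s f) (h' : IsHarmonic r s g) (hf : IsSmooth 2 f) (hg : IsSmooth 2 g) :
    IsHarmonic r s (f + g) := by
  have h1 : (1 : WithTop ℕ∞) ≤ 2 := by norm_num
  have h2 : (1 + 1 : WithTop ℕ∞) ≤ 2 := by rw [one_add_one_eq_two]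
  rw [IsHarmonic, maass_add hf hg h1, maassBar_add (hf.maass h2 r) (hg.maass h2 r) le_rfl, h, h',
    smul_add]

lemma smul (h : IsHarmonic r s f) (hf : IsSmooth 2 f) (c : ℂ) : IsHarmonic r s (c • f) := by
  have h1 : (1 : WithTop ℕ∞) ≤ 2 := by norm_num
  have h2 : (1 + 1 : WithTop ℕ∞) ≤ 2 := by rw [one_add_one_eq_two]
  rw [IsHarmonic, maass_smul hf h1, maassBar_smul (hf.maass h2 r) le_rfl, h, smul_comm]

end IsHarmonic

/-! ### Eigenvalues and constant terms -/

lemma maassBar_maass_LL_zpow_mul {f : ℍ → ℂ} (hf : IsSmooth 2 f) (r s k : ℤ) :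
    maassBar (s - k - 1) (maass (r - k) fun z => LL z ^ k * f z) =
      fun z => LL z ^ k * maassBar (s - 1) (maass r f) z := by
  rw [maass_LL_zpow_mul hf (by norm_num), sub_right_comm s k 1,
    maassBar_LL_zpow_mul (hf.maass (m := 1) (by rw [one_add_one_eq_two]) r) le_rfl]

/-- Multiplication by a power of `𝕃` reduces the eigenvalue equation to the eigenvalue zero. -/
lemma isHarmonic_of_laplace {r s k : ℤ} {f : ℍ → ℂ} (hf : IsSmooth 2 f)
    (h : laplace r s f = (-(k * (k + r + s - 1)) : ℂ) • f) :
    IsHarmonic (r + k) (s + k) fun z => LL z ^ (-k) * f z := by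
  have h1 := maassBar_maass_LL_zpow_mul hf r s (-k)
  rw [sub_neg_eq_add, sub_neg_eq_add] at h1
  rw [IsHarmonic, h1]
  funext z
  have h2 := congrFun h z
  simp only [laplace, Pi.smul_apply, smul_eq_mul] at h2 ⊢
  push_cast
  linear_combination (-LL z ^ (-k)) * h2

/-- For fixed (m,n) the Laplacian is triangular in the exponent of 𝕃: the new coefficient of 𝕃^k
involves only the old ones of 𝕃^k, 𝕃^{k-1}, 𝕃^{k-2}. At the least exponent k with a non-zero
coefficient only the diagonal entry r(s-1) - (k+r)(k+s-1) = -k(k+r+s-1) remains. -/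
lemma exists_eigenvalue_eq {r s : ℤ} {f : ℍ → ℂ} (hf : f ∈ MSpace r s) (h0 : f ≠ 0) {lam : ℂ}
    (h : laplace r s f = lam • f) : ∃ k : ℤ, lam = -(k * (k + r + s - 1)) := by
  classical
  obtain ⟨S, c, Y, hE⟩ := MSpace.expands hf
  have h1 := ((hE.maass r).maassBar ((MSpace.isSmooth hf).maass le_top r) (s - 1)).add
    (hE.smul (lam - r * (s - 1)))
  have hc := h1.coeff_eq_zero fun z _ => by
    have := congrFun h z
    simp only [laplace, Pi.smul_apply, Pi.add_apply, smul_eq_mul] at this ⊢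
    linear_combination -this
  obtain ⟨k₁, p, hkp⟩ : ∃ k p, c k p ≠ 0 := by
    by_contra! hall
    refine h0 (hf.1.eq_zero (Y := Y) fun z hz => ?_)
    rw [hE.eq_sum z hz]
    refine Finset.sum_eq_zero fun k _ => ?_
    rw [show c k = 0 from funext (hall k), qSum_zero, mul_zero]
  have hS : (S.filter fun k => c k p ≠ 0).Nonempty :=
    ⟨k₁, Finset.mem_filter.mpr ⟨by_contra fun hS => hkp (by rw [hE.eq_zero _ hS]; rfl), hkp⟩⟩
  set k := (S.filter fun k => c k p ≠ 0).min' hS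
  have hk : c k p ≠ 0 := (Finset.mem_filter.mp (Finset.min'_mem _ hS)).2
  have hlt : ∀ j < k, c j p = 0 := fun j hj => by
    by_contra hne
    exact absurd (Finset.min'_le _ j (Finset.mem_filter.mpr
      ⟨by_contra fun hS => hne (by rw [hE.eq_zero _ hS]; rfl), hne⟩)) (not_le.mpr hj)
  have := hc k p
  simp only [Pi.add_apply, Pi.smul_apply, smul_eq_mul, hlt (k - 1) (by omega),
    hlt (k - 1 - 1) (by omega)] at this
  refine ⟨k, mul_right_cancel₀ hk ?_⟩
  push_cast at this
  linear_combination this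

/-- A harmonic function of weights `(p, p)` is asymptotic to a constant. -/
lemma exists_tendsto_of_isHarmonic {p : ℕ} (hp : 2 ≤ p) {f : ℍ → ℂ} (hf : f ∈ MSpace p p)
    (h : IsHarmonic p p f) : ∃ a : ℂ, Tendsto (fun z => LL z ^ (p : ℤ) * (f z - a)) atImInfty (𝓝 0) := by
  classical
  obtain ⟨S, c, Y, hE⟩ := MSpace.expands hf
  have h1 := ((hE.maass p).maassBar ((MSpace.isSmooth hf).maass le_top p) (p - 1)).add
    (hE.smul (-(p * (p - 1))))
  have hc := h1.coeff_eq_zero fun z _ => by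
    have := congrFun h z
    simp only [Pi.smul_apply, Pi.add_apply, smul_eq_mul] at this ⊢
    push_cast at this
    linear_combination this
  -- For m = n = 0 the terms coming from lower powers of 𝕃 carry the factors m or n and drop out, so
  -- the recursion is diagonal with entry k(k - (1-2p)).
  have hc0 : ∀ k : ℤ, k ≠ 0 → k ≠ 1 - 2 * p → c k (0, 0) = 0 := fun k hk0 hk1 => by
    have := hc k (0, 0)
    simp only [Pi.add_apply, Pi.smul_apply, smul_eq_mul] at this
    push_cast at this
    have h2 : ((k * (k - (1 - 2 * p)) : ℤ) : ℂ) * c k (0, 0) = 0 := by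
      push_cast; linear_combination this
    rcases mul_eq_zero.mp h2 with h3 | h3
    · rw [Int.cast_eq_zero] at h3
      rcases mul_eq_zero.mp h3 with h4 | h4
      · exact absurd h4 hk0
      · exact absurd (by omega) hk1
    · exact h3
  -- The index 0 is forced into the range so that the constant is subtracted in exactly one summand.
  have hE' := hE.mono (Finset.subset_insert 0 S) le_rfl
  obtain ⟨z₁, hz₁⟩ := exists_im_eq (y := max Y 0 + 1) (by positivity)
  have hY : Y < z₁.im := by rw [hz₁]; linarith [le_max_left Y 0]
  have hk (k : ℤ) : Tendsto (fun z => LL z ^ (p : ℤ) * (LL z ^ k * qSum (c k) z -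
      if k = 0 then c 0 (0, 0) else 0)) atImInfty (𝓝 0) := by
    obtain ⟨C, hC⟩ := norm_qSum_sub_le 0 (a := c k) (fun p hp => by simp at hp) (hE.summable k z₁ hY)
    have t1 := tendsto_LL_zpow_mul_of_norm_le (j := p + k) (C := C)
      (R := fun z => qSum (c k) z - c k (0, 0)) (by
        filter_upwards [eventually_im_ge z₁.im] with z hz
        simpa [qTerm] using hC z hz)
    have t2 : Tendsto (fun z => LL z ^ (p : ℤ) * (LL z ^ k * c k (0, 0) -
        if k = 0 then c 0 (0, 0) else 0)) atImInfty (𝓝 0) := by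
      by_cases hk0 : k = 0
      · subst hk0; simp
      · simp only [if_neg hk0, sub_zero]
        by_cases hk1 : k = 1 - 2 * p
        -- The exponent is p + (1-2p) = 1-p, negative because p ≥ 2.
        · have := (tendsto_LL_zpow_of_neg (j := p + k) (by omega)).mul_const (c k (0, 0))
          rw [zero_mul] at this
          refine this.congr fun z => ?_
          rw [zpow_add₀ (LL_ne_zero z), mul_assoc]
        · simp [hc0 k hk0 hk1]
    have t3 := t1.add t2
    rw [add_zero] at t3
    refine t3.congr fun z => ?_
    rw [zpow_add₀ (LL_ne_zero z)]; ring
  have hsum := tendsto_finsetSum (insert 0 S) fun k _ => hk k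
  rw [Finset.sum_const_zero] at hsum
  refine ⟨c 0 (0, 0), hsum.congr' ?_⟩
  filter_upwards [eventually_im_gt Y] with z hz
  rw [hE'.eq_sum z hz, ← Finset.mul_sum, Finset.sum_sub_distrib, Finset.sum_ite_eq',
    if_pos (Finset.mem_insert_self 0 S)]

/-! ### Holomorphic modular forms -/

/-- At most polynomial growth at the cusp. -/
def ModerateGrowth (f : ℍ → ℂ) : Prop :=
  ∃ (C : ℝ) (K : ℕ) (Y : ℝ), 1 ≤ Y ∧ ∀ z : ℍ, Y ≤ z.im → ‖f z‖ ≤ C * z.im ^ K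

namespace ModerateGrowth

variable {f g : ℍ → ℂ}

lemma mul (hf : ModerateGrowth f) (hg : ModerateGrowth g) : ModerateGrowth (f * g) := by
  obtain ⟨C, K, Y, hY, h⟩ := hf
  obtain ⟨C', K', Y', hY', h'⟩ := hg
  refine ⟨C * C', K + K', max Y Y', hY.trans (le_max_left _ _), fun z hz => ?_⟩
  have h1 := h z (le_trans (le_max_left _ _) hz)
  have h2 := h' z (le_trans (le_max_right _ _) hz)
  rw [Pi.mul_apply, norm_mul, pow_add]
  calc ‖f z‖ * ‖g z‖ ≤ (C * z.im ^ K) * (C' * z.im ^ K') :=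
        mul_le_mul h1 h2 (norm_nonneg _) ((norm_nonneg _).trans h1)
    _ = _ := by ring

lemma add (hf : ModerateGrowth f) (hg : ModerateGrowth g) : ModerateGrowth (f + g) := by
  obtain ⟨C, K, Y, hY, h⟩ := hf
  obtain ⟨C', K', Y', hY', h'⟩ := hg
  refine ⟨|C| + |C'|, K + K', max Y Y', hY.trans (le_max_left _ _), fun z hz => ?_⟩
  have h1 := h z (le_trans (le_max_left _ _) hz)
  have h2 := h' z (le_trans (le_max_right _ _) hz)
  have h0 : 1 ≤ z.im := hY.trans (le_trans (le_max_left _ _) hz)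
  have e1 : z.im ^ K ≤ z.im ^ (K + K') := pow_le_pow_right₀ h0 (by omega)
  have e2 : z.im ^ K' ≤ z.im ^ (K + K') := pow_le_pow_right₀ h0 (by omega)
  refine (norm_add_le _ _).trans ((add_le_add h1 h2).trans ?_)
  rw [add_mul]
  refine add_le_add ?_ ?_
  · exact (mul_le_mul_of_nonneg_right (le_abs_self C) (by positivity)).trans (by gcongr)
  · exact (mul_le_mul_of_nonneg_right (le_abs_self C') (by positivity)).trans (by gcongr)

lemma of_isBoundedAtImInfty (hf : IsBoundedAtImInfty f) : ModerateGrowth f := by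
  obtain ⟨M, A, h⟩ := isBoundedAtImInfty_iff.mp hf
  exact ⟨M, 0, max A 1, le_max_right _ _, fun z hz => by
    simpa using h z ((le_max_left _ _).trans hz)⟩

lemma const (c : ℂ) : ModerateGrowth fun _ => c := ⟨‖c‖, 0, 1, le_rfl, fun z _ => by simp⟩

lemma smul (hf : ModerateGrowth f) (c : ℂ) : ModerateGrowth (c • f) := (const c).mul hf

lemma pow (hf : ModerateGrowth f) : ∀ n : ℕ, ModerateGrowth (f ^ n)
  | 0 => by simpa using! const 1
  | n + 1 => by rw [pow_succ]; exact (pow hf n).mul hf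

lemma inv_LL : ModerateGrowth fun z => (LL z)⁻¹ := by
  refine ⟨1, 0, 1, le_rfl, fun z hz => ?_⟩
  rw [norm_inv, norm_LL, pow_zero, mul_one]
  refine inv_le_one_of_one_le₀ ?_
  nlinarith [Real.pi_gt_three]

end ModerateGrowth

/-- A periodic holomorphic function of moderate growth is bounded at the cusp. -/
lemma ModerateGrowth.isBoundedAtImInfty {f : ℍ → ℂ} (hf : ModerateGrowth f)
    (hd : ∀ z : ℍ, DifferentiableAt ℂ (f ∘ ofComplex) z)
    (hper : Function.Periodic (f ∘ ofComplex) (1 : ℝ)) : IsBoundedAtImInfty f := by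
  obtain ⟨C, K, Y, hY, h⟩ := hf
  have hd' := Function.Periodic.eventually_differentiableAt_cuspFunction_nhds_ne_zero one_pos hper
    (show ∀ᶠ z in comap Complex.im atTop, DifferentiableAt ℂ (f ∘ ofComplex) z from
      eventually_of_mem (preimage_mem_comap (Ioi_mem_atTop 0)) fun z hz => hd ⟨z, hz⟩)
  set F := Function.Periodic.cuspFunction 1 (f ∘ ofComplex) with hF
  have h1 : Tendsto (fun w => (f ∘ ofComplex) w * Function.Periodic.qParam 1 w)
      (comap Complex.im atTop) (𝓝 0) := by
    have h2 : Tendsto (fun w : ℂ => |C| * ((2 * Real.pi * w.im) ^ (K : ℤ) *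
        Real.exp (-(2 * Real.pi * w.im)))) (comap Complex.im atTop) (𝓝 0) := by
      have := ((tendsto_zpow_mul_exp_neg K).comp
        ((tendsto_comap (f := Complex.im)).const_mul_atTop
          (show (0 : ℝ) < 2 * Real.pi by positivity))).const_mul |C|
      rw [mul_zero] at this
      exact this
    refine squeeze_zero_norm' ?_ h2
    filter_upwards [tendsto_comap.eventually (eventually_ge_atTop Y)] with w hw
    have hw0 : 0 < w.im := by linarith
    have h3 := h ⟨w, hw0⟩ hw
    rw [norm_mul, Function.comp_apply, ofComplex_apply_of_im_pos hw0,
      Function.Periodic.norm_qParam]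
    have e : Real.exp (-2 * Real.pi * w.im / 1) = Real.exp (-(2 * Real.pi * w.im)) := by
      congr 1; ring
    rw [e, ← mul_assoc, zpow_natCast, mul_pow]
    gcongr
    refine h3.trans ?_
    change C * w.im ^ K ≤ _
    have : (1 : ℝ) ≤ (2 * Real.pi) ^ K := one_le_pow₀ (by nlinarith [Real.pi_gt_three])
    calc C * w.im ^ K ≤ |C| * w.im ^ K := by gcongr; exact le_abs_self C
      _ ≤ |C| * ((2 * Real.pi) ^ K * w.im ^ K) := by
        gcongr
        exact le_mul_of_one_le_left (by positivity) this
  -- Polynomial growth in y is only logarithmic growth in q, so F(q)q → 0. The singularity at q = 0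
  -- is then removable and f even has a limit at the cusp.
  have h2 : Tendsto (fun q => F q * q) (𝓝[≠] 0) (𝓝 0) := by
    refine (h1.comp (Function.Periodic.invQParam_tendsto one_pos)).congr' ?_
    filter_upwards [self_mem_nhdsWithin] with q hq
    rw [Function.comp_apply, Function.Periodic.qParam_right_inv one_ne_zero hq, hF,
      Function.Periodic.cuspFunction_eq_of_nonzero _ _ hq]
  have h3 : (fun q => F q - F 0) =o[𝓝[≠] 0] fun q => (q - 0)⁻¹ := by
    rw [Asymptotics.isLittleO_iff_tendsto']
    · have h4 : Tendsto (fun q => F q * q - F 0 * q) (𝓝[≠] 0) (𝓝 0) := by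
        have h5 : Tendsto (fun q : ℂ => F 0 * q) (𝓝[≠] 0) (𝓝 (F 0 * 0)) :=
          ((continuous_const.mul continuous_id).tendsto 0).mono_left nhdsWithin_le_nhds
        simpa using h2.sub h5
      refine h4.congr fun q => ?_
      rw [sub_zero, div_inv_eq_mul, sub_mul]
    · filter_upwards [self_mem_nhdsWithin] with q hq h0
      rw [sub_zero, inv_eq_zero] at h0
      exact absurd h0 hq
  have h4 := tendsto_limUnder_of_differentiable_on_punctured_nhds_of_isLittleO hd' h3
  have h5 : Tendsto f atImInfty (𝓝 (limUnder (𝓝[≠] 0) F)) := by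
    refine (h4.comp ((Function.Periodic.qParam_tendsto one_pos).comp
      (show Tendsto UpperHalfPlane.coe atImInfty (comap Complex.im atTop) from
        tendsto_comap_iff.mpr tendsto_comap))).congr fun z => ?_
    rw [Function.comp_apply, Function.comp_apply, hF,
      Function.Periodic.eq_cuspFunction one_ne_zero hper]
    simp
  exact h5.isBigO_one ℝ

lemma slash_eq_of_isBimodular {k : ℤ} {f : ℍ → ℂ} (hf : IsBimodular k 0 f) (γ : SL(2, ℤ)) :
    f ∣[k] γ = f := by
  rw [isBimodular_iff] at hf
  funext z
  rw [ModularForm.SL_slash_apply, hf, zpow_zero, mul_one, ← autFactor_eq_denom, zpow_neg]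
  have := zpow_ne_zero k (autFactor_ne_zero γ z)
  field_simp

lemma HasWirtinger.hasDerivAt {f : ℍ → ℂ} {a : ℂ} {z : ℍ} (h : HasWirtinger f a 0 z) :
    HasDerivAt (f ∘ ofComplex) a z := by
  refine (hasFDerivAt_of_restrictScalars ℝ (f' := ContinuousLinearMap.toSpanSingleton ℂ a) h ?_)
  ext v; simp [mul_comm]

/-- A modular function of moderate growth which is annihilated by `∂/∂z̄` is a modular form. -/
lemma exists_modularForm {k : ℤ} {f : ℍ → ℂ} (hf : IsBimodular k 0 f) (hs : IsSmooth 1 f)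
    (hg : ModerateGrowth f) (h : maassBar 0 f = 0) : ∃ g : ModularForm 𝒮ℒ k, ⇑g = f := by
  have h0 (z : ℍ) : wirtingerBar f z = 0 := by
    have := congrFun h z
    simp only [maassBar, Int.cast_zero, zero_mul, add_zero, Pi.zero_apply, mul_eq_zero] at this
    refine this.resolve_left ?_
    rw [← neg_sub]
    exact neg_ne_zero.mpr (sub_conj_ne_zero z)
  have hd (z : ℍ) : DifferentiableAt ℂ (f ∘ ofComplex) z := by
    have := hs.hasWirtinger le_rfl z
    rw [h0] at this
    exact this.hasDerivAt.differentiableAt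
  let g : SlashInvariantForm 𝒮ℒ k :=
    { toFun := f
      slash_action_eq' := by
        rintro _ ⟨γ, rfl⟩
        exact slash_eq_of_isBimodular hf γ }
  have hper : Function.Periodic (f ∘ ofComplex) (1 : ℝ) :=
    SlashInvariantFormClass.periodic_comp_ofComplex g one_mem_strictPeriods_SL
  refine ⟨{ g with
    holo' := ?_
    bdd_at_cusps' := ?_ }, rfl⟩
  · rw [UpperHalfPlane.mdifferentiable_iff]
    exact fun z hz => (hd ⟨z, hz⟩).differentiableWithinAt
  · intro c hc
    rw [OnePoint.isBoundedAt_iff_forall_SL2Z hc]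
    intro γ _
    change IsBoundedAtImInfty (f ∣[k] γ)
    rw [slash_eq_of_isBimodular hf γ]
    exact hg.isBoundedAtImInfty hd hper

/-! ### The weight two Eisenstein series -/

lemma G2star_eq (z : ℍ) :
    G2star z = -1 / 24 * EisensteinSeries.E2 z - 1 / (4 * LL z) := by
  rw [G2star, EisensteinSeries.E2_eq_tsum_cexp]
  simp only [qVar]
  ring

lemma hasWirtinger_E2 (z : ℍ) :
    HasWirtinger EisensteinSeries.E2 (wirtinger EisensteinSeries.E2 z) 0 z := by
  have h := E2_mdifferentiable z
  rw [UpperHalfPlane.mdifferentiableAt_iff] at h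
  have h1 : HasWirtinger EisensteinSeries.E2 (deriv (EisensteinSeries.E2 ∘ ofComplex) z) 0 z := by
    refine (h.hasDerivAt.hasFDerivAt.restrictScalars ℝ).congr_fderiv ?_
    ext v; simp [mul_comm]
  rwa [h1.wirtinger]

lemma isSmooth_E2 {n : WithTop ℕ∞} : IsSmooth n EisensteinSeries.E2 := by
  refine IsSmooth.congr_of_holomorphic (h := EisensteinSeries.E2 ∘ ofComplex) (fun z => ?_)
    fun z => by simp
  exact (UpperHalfPlane.mdifferentiable_iff.mp E2_mdifferentiable).analyticAt
    (isOpen_upperHalfPlaneSet.mem_nhds z.im_pos)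

lemma isSmooth_G2star {n : WithTop ℕ∞} : IsSmooth n G2star := by
  have h := (isSmooth_E2 (n := n)).smul (-1 / 24) |>.add
    ((IsSmooth.LL_zpow (n := n) (-1)).smul (-1 / 4))
  refine Eq.subst (motive := IsSmooth n) ?_ h
  funext z
  have := LL_ne_zero z
  simp only [Pi.add_apply, Pi.smul_apply, smul_eq_mul, G2star_eq, zpow_neg_one]
  field_simp
  ring

/-- Under γ the function E₂ acquires a correction proportional to c/(cz+d), with a constant made
explicit by ζ(2). The term -1/(4𝕃) has the opposite defect, again by c(z - z̄) = j - j̄. -/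
lemma isBimodular_G2star : IsBimodular 2 0 G2star := by
  rw [isBimodular_iff]
  intro γ z
  have hj := autFactor_ne_zero γ z
  have hj' := conj_autFactor_ne_zero γ z
  have h := congrFun (EisensteinSeries.E2_slash_action γ) z
  rw [ModularForm.SL_slash_apply, ← autFactor_eq_denom, zpow_neg, ← div_eq_mul_inv,
    div_eq_iff (zpow_ne_zero _ hj)] at h
  rw [G2star_eq, G2star_eq, h, LL_eq (γ • z), sub_conj_smul, LL_eq z]
  have hz := sub_conj_ne_zero z
  have hc : (γ 1 0 : ℂ) * ((z : ℂ) - conj (z : ℂ)) = autFactor γ z - conj (autFactor γ z) := by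
    rw [conj_autFactor, autFactor]; ring
  simp only [Pi.sub_apply, Pi.smul_apply, smul_eq_mul, EisensteinSeries.D2, riemannZeta_two,
    ← autFactor_eq_denom, zpow_zero, mul_one]
  have hpi : (Real.pi : ℂ) ≠ 0 := by exact_mod_cast Real.pi_ne_zero
  rw [show (γ 1 0 : ℂ) = (autFactor γ z - conj (autFactor γ z)) / ((z : ℂ) - conj (z : ℂ)) by
    rw [← hc]; field_simp]
  rw [zpow_ofNat]
  field_simp
  ring_nf
  simp only [I_sq]
  ring

lemma moderateGrowth_G2star : ModerateGrowth G2star := by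
  have h := ((ModerateGrowth.of_isBoundedAtImInfty EisensteinSeries.isBoundedAtImInfty_E2).smul
    (-1 / 24)).add (ModerateGrowth.inv_LL.smul (-1 / 4))
  refine Eq.subst (motive := ModerateGrowth) ?_ h
  funext z
  have := LL_ne_zero z
  simp only [Pi.add_apply, Pi.smul_apply, smul_eq_mul, G2star_eq]
  field_simp
  ring

/-- The lowering operator applied to `𝔾₂^*` is constant. -/
lemma maassBar_G2star : maassBar 0 G2star = fun z => 1 / (4 * LL z) := by
  funext z
  have h := ((hasWirtinger_E2 z).smul (-1 / 24)).add ((hasWirtinger_LL_zpow (-1) z).smul (-1 / 4))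
  have h2 := h.congr (g := G2star) (Eventually.of_forall fun w => by
    have := LL_ne_zero w
    simp only [Pi.add_apply, Pi.smul_apply, smul_eq_mul, G2star_eq, zpow_neg_one]
    field_simp
    ring)
  rw [h2.maassBar]
  have e : (-1 - 1 : ℤ) = -2 := by norm_num
  rw [e, zpow_neg, zpow_ofNat, LL_eq]
  have hpi : (Real.pi : ℂ) ≠ 0 := by exact_mod_cast Real.pi_ne_zero
  have hz := sub_conj_ne_zero z
  have hI := I_ne_zero
  push_cast
  field_simp
  ring

/-! ### The lowering operator and almost holomorphic modular forms -/

/-- The lowering operator `𝕃 ∂̄_0`, a derivation. -/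
def lower (f : ℍ → ℂ) (z : ℍ) : ℂ := LL z * maassBar 0 f z

lemma maassBar_zero_eq_zero_of_lower {f : ℍ → ℂ} (h : lower f = 0) : maassBar 0 f = 0 := by
  funext z
  exact (mul_eq_zero.mp (congrFun h z)).resolve_left (LL_ne_zero z)

lemma MSpace.lower {k : ℤ} {f : ℍ → ℂ} (hf : f ∈ MSpace k 0) : lower f ∈ MSpace (k - 2) 0 := by
  have h := MSpace.LL_zpow_mul (MSpace.maassBar hf) 1
  simp only [zpow_one] at h
  have e : k - 1 - 1 = k - 2 := by ring
  rw [e, zero_add, sub_self] at h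
  exact h

lemma MSpace.lower_iterate {k : ℤ} {f : ℍ → ℂ} (hf : f ∈ MSpace k 0) (j : ℕ) :
    BigradedModular.lower^[j] f ∈ MSpace (k - 2 * j) 0 := by
  induction j with
  | zero => simpa using hf
  | succ j ih =>
    rw [Function.iterate_succ_apply']
    have := MSpace.lower ih
    convert! this using 1
    congr 1
    push_cast; ring

lemma IsSmooth.lower {f : ℍ → ℂ} (hf : IsSmooth ω f) : IsSmooth ω (lower f) :=
  IsSmooth.LL.mul (hf.maassBar le_top 0)

lemma IsSmooth.lower_iterate {f : ℍ → ℂ} (hf : IsSmooth ω f) (j : ℕ) :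
    IsSmooth ω (BigradedModular.lower^[j] f) := by
  induction j with
  | zero => exact hf
  | succ j ih => rw [Function.iterate_succ_apply']; exact ih.lower

lemma IsBimodular.lower {k : ℤ} {f : ℍ → ℂ} (hf : IsBimodular k 0 f) (hs : IsSmooth ω f) :
    IsBimodular (k - 2) 0 (lower f) := by
  have h := (IsBimodular.LL_zpow 1).mul (hf.maassBar (hs.of_le le_top))
  have e : -1 + (k - 1) = k - 2 := by ring
  have e' : (-1 + (0 + 1) : ℤ) = 0 := by norm_num
  rw [e, e'] at h
  refine Eq.subst (motive := IsBimodular (k - 2) 0) ?_ h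
  funext z
  simp [BigradedModular.lower]

lemma IsBimodular.lower_iterate {k : ℤ} {f : ℍ → ℂ} (hf : IsBimodular k 0 f) (hs : IsSmooth ω f)
    (j : ℕ) : IsBimodular (k - 2 * j) 0 (BigradedModular.lower^[j] f) := by
  induction j with
  | zero => simpa using hf
  | succ j ih =>
    rw [Function.iterate_succ_apply']
    have := ih.lower (hs.lower_iterate j)
    convert! this using 1
    push_cast; ring

section

variable {f g : ℍ → ℂ}

lemma lower_smul (hf : IsSmooth ω f) (c : ℂ) : lower (c • f) = c • lower f := by
  funext z
  simp only [lower, maassBar_smul hf le_top c 0, Pi.smul_apply, smul_eq_mul]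
  ring

lemma lower_add (hf : IsSmooth ω f) (hg : IsSmooth ω g) : lower (f + g) = lower f + lower g := by
  funext z
  simp only [lower, maassBar_add hf hg le_top 0, Pi.add_apply]
  ring

lemma lower_mul (hf : IsSmooth ω f) (hg : IsSmooth ω g) :
    lower (f * g) = lower f * g + f * lower g := by
  funext z
  have := congrFun (maassBar_mul hf hg le_top 0 0) z
  simp only [add_zero] at this
  simp only [lower, this, Pi.add_apply, Pi.mul_apply]
  ring

lemma lower_iterate_smul (hf : IsSmooth ω f) (c : ℂ) (j : ℕ) :
    lower^[j] (c • f) = c • lower^[j] f := by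
  induction j with
  | zero => rfl
  | succ j ih => rw [Function.iterate_succ_apply', Function.iterate_succ_apply', ih,
      lower_smul (hf.lower_iterate j)]

lemma lower_iterate_add (hf : IsSmooth ω f) (hg : IsSmooth ω g) (j : ℕ) :
    lower^[j] (f + g) = lower^[j] f + lower^[j] g := by
  induction j with
  | zero => rfl
  | succ j ih => rw [Function.iterate_succ_apply', Function.iterate_succ_apply',
      Function.iterate_succ_apply', ih, lower_add (hf.lower_iterate j) (hg.lower_iterate j)]

lemma IsSmooth.pow {n : WithTop ℕ∞} (hf : IsSmooth n f) : ∀ k : ℕ, IsSmooth n (f ^ k)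
  | 0 => by simpa using! IsSmooth.const (n := n) 1
  | k + 1 => by rw [pow_succ]; exact (pow hf k).mul hf

lemma IsBimodular.pow {r s : ℤ} (hf : IsBimodular r s f) (k : ℕ) :
    IsBimodular (k * r) (k * s) (f ^ k) := by
  induction k with
  | zero => intro γ z; simp
  | succ k ih =>
    rw [pow_succ]
    have := ih.mul hf
    convert! this using 1 <;> push_cast <;> ring

lemma lower_zero : lower (0 : ℍ → ℂ) = 0 := by
  have := lower_smul (IsSmooth.const (n := ω) 0) 0
  simpa using! this

lemma lower_const (c : ℂ) : lower (fun _ => c) = 0 := by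
  funext z
  rw [lower, (hasWirtinger_const c z).maassBar]
  simp

lemma lower_G2star : lower G2star = fun _ => 1 / 4 := by
  funext z
  rw [lower, maassBar_G2star]
  have := LL_ne_zero z
  field_simp

lemma lower_G2star_pow (n : ℕ) : lower (G2star ^ n) = (n / 4 : ℂ) • G2star ^ (n - 1) := by
  induction n with
  | zero => simpa using! lower_const 1
  | succ n ih =>
    rw [pow_succ, lower_mul (isSmooth_G2star.pow n) isSmooth_G2star, ih, lower_G2star]
    funext z
    simp only [Pi.add_apply, Pi.mul_apply, Pi.smul_apply, Pi.pow_apply, smul_eq_mul,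
      Nat.add_sub_cancel]
    rcases n with _ | n
    · simp
    · rw [Nat.add_sub_cancel, pow_succ]; push_cast; ring

/-- As a derivation that kills f and sends 𝔾₂^* to 1/4, `lower` acts on f·(𝔾₂^*)^n as one quarter of
the derivative in the variable 𝔾₂^*. -/
lemma lower_mul_G2star_pow (hf : IsSmooth ω f) (h : lower f = 0) (n j : ℕ) :
    lower^[j] (f * G2star ^ n) = ((n.descFactorial j : ℂ) / 4 ^ j) • (f * G2star ^ (n - j)) := by
  induction j with
  | zero => simp
  | succ j ih =>
    rw [Function.iterate_succ_apply', ih, lower_smul (hf.mul (isSmooth_G2star.pow _)),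
      lower_mul hf (isSmooth_G2star.pow _), h, lower_G2star_pow, Nat.descFactorial_succ]
    funext z
    simp only [Pi.add_apply, Pi.mul_apply, Pi.smul_apply, Pi.pow_apply, smul_eq_mul, Pi.zero_apply,
      Nat.sub_sub]
    push_cast; ring

end

/-! ### Homogeneous elements and the kernel of powers of the lowering operator -/

lemma inDeg_mul (r s t u : ℤ) (f g : ℍ → ℂ) :
    inDeg r s f * inDeg t u g = inDeg (r + t) (s + u) (f * g) := by
  simp [inDeg, AddMonoidAlgebra.single_mul_single]

lemma inDeg_add (r s : ℤ) (f g : ℍ → ℂ) : inDeg r s (f + g) = inDeg r s f + inDeg r s g :=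
  AddMonoidAlgebra.single_add _ _ _

lemma inDeg_smul (r s : ℤ) (c : ℂ) (f : ℍ → ℂ) : inDeg r s (c • f) = c • inDeg r s f := by
  simp [inDeg, AddMonoidAlgebra.smul_single]

lemma inDeg_pow (r s : ℤ) (f : ℍ → ℂ) (n : ℕ) : inDeg r s f ^ n = inDeg (n * r) (n * s) (f ^ n) := by
  simp [inDeg, AddMonoidAlgebra.single_pow]

lemma inDeg_zero (r s : ℤ) : inDeg r s 0 = 0 := AddMonoidAlgebra.single_zero _

/-- Modular functions of weight `(k, 0)` annihilated by a power of the lowering operator are almost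
holomorphic modular forms. -/
lemma mem_almostHolomorphic_of_lower_iterate (p : ℕ) : ∀ {k : ℤ} {f : ℍ → ℂ}, IsSmooth ω f →
    IsBimodular k 0 f → (∀ j, ModerateGrowth (lower^[j] f)) → lower^[p] f = 0 →
    inDeg k 0 f ∈ almostHolomorphic := by
  induction p with
  | zero =>
    intro k f _ _ _ h
    rw [show f = 0 from h, inDeg_zero]
    exact zero_mem _
  | succ p ih =>
    intro k f hs hb hg h
    rw [Function.iterate_succ_apply'] at h
    set g := lower^[p] f with hgdef
    have hgs : IsSmooth ω g := hs.lower_iterate p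
    -- The last non-zero candidate among the iterates is holomorphic, hence a modular form of weight
    -- k - 2p; it is the coefficient of the top power of 𝔾₂^*, up to a scalar.
    obtain ⟨G, hG⟩ := exists_modularForm (hb.lower_iterate hs p) (hgs.of_le le_top) (hg p)
      (maassBar_zero_eq_zero_of_lower h)
    rw [← hgdef] at hG
    -- Lowering g·(𝔾₂^*)^p exactly p times gives (p!/4^p)g, so adding c times this product produces
    -- a function already killed by the p-th power.
    set c : ℂ := -(4 ^ p / p.factorial) with hc
    have hprod : inDeg k 0 (g * G2star ^ p) ∈ almostHolomorphic := by
      have e : inDeg k 0 (g * G2star ^ p) = inDeg (k - 2 * p) 0 G * inDeg 2 0 G2star ^ p := by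
        rw [inDeg_pow, inDeg_mul, hG]
        congr 1; ring
      rw [e]
      exact almostHolomorphic.mul_mem (Algebra.subset_adjoin (Or.inl ⟨_, G, rfl⟩))
        (almostHolomorphic.pow_mem (Algebra.subset_adjoin (Or.inr rfl)) p)
    have hsm : IsSmooth ω (g * G2star ^ p) := hgs.mul (isSmooth_G2star.pow p)
    have hf' : inDeg k 0 (f + c • (g * G2star ^ p)) ∈ almostHolomorphic := by
      refine ih (hs.add (hsm.smul c)) (hb.add (IsBimodular.smul ?_ c)) (fun j => ?_) ?_
      · have := (hb.lower_iterate hs p).mul (isBimodular_G2star.pow p)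
        convert! this using 1; ring
      · rw [lower_iterate_add hs (hsm.smul c), lower_iterate_smul hsm,
          lower_mul_G2star_pow hgs h]
        exact (hg j).add ((((hg p).mul (moderateGrowth_G2star.pow _)).smul _).smul c)
      · rw [lower_iterate_add hs (hsm.smul c), lower_iterate_smul hsm,
          lower_mul_G2star_pow hgs h, Nat.descFactorial_self, Nat.sub_self, pow_zero, mul_one,
          smul_smul, ← hgdef, hc]
        have : (p.factorial : ℂ) ≠ 0 := by exact_mod_cast p.factorial_ne_zero
        rw [show -((4 : ℂ) ^ p / p.factorial) * (p.factorial / 4 ^ p) = -1 by field_simp]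
        rw [neg_one_smul, add_neg_cancel]
    have e : inDeg k 0 f = inDeg k 0 (f + c • (g * G2star ^ p)) - c • inDeg k 0 (g * G2star ^ p) := by
      rw [inDeg_add, inDeg_smul, add_sub_cancel_right]
    rw [e]
    exact sub_mem hf' (Subalgebra.smul_mem _ hprod c)

/-! ### Harmonic functions of weights (1,1) or with non-positive second weight -/

/-- For r = s = 1 the constant r(s-1) is zero, so ∂_1 f is a holomorphic modular form of weight two
and level one, and there is none except zero. -/
lemma maass_one_eq_zero_of_isHarmonic {f : ℍ → ℂ} (hf : f ∈ MSpace 1 1) (h : IsHarmonic 1 1 f) :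
    maass 1 f = 0 := by
  have h1 := MSpace.maass hf
  have h2 : maassBar 0 (maass 1 f) = 0 := by
    rw [IsHarmonic] at h
    simpa using h
  rw [sub_self] at h1
  obtain ⟨g, hg⟩ := exists_modularForm h1.2.1 (MSpace.isSmooth h1) (MSpace.exists_bound h1) h2
  have hg0 : g = 0 := rank_zero_iff_forall_zero.mp ModularForm.levelOne_weight_two_rank_zero g
  rw [← hg, hg0]
  rfl

/-- Harmonic functions of weights `(1, 1)` are multiples of `𝕃⁻¹`. -/
lemma eq_const_of_isHarmonic_one_one {f : ℍ → ℂ} (hf : f ∈ MSpace 1 1) (h : IsHarmonic 1 1 f) :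
    ∃ c : ℂ, f = c • fun z => LL z ^ (-1 : ℤ) := by
  have hs1 : IsSmooth 1 f := MSpace.isSmooth hf
  have h1 := maass_one_eq_zero_of_isHarmonic hf h
  have h2 := maass_one_eq_zero_of_isHarmonic (MSpace.star hf) (h.star (MSpace.isSmooth hf))
  rw [maass_star hs1 le_rfl] at h2
  have hu : IsSmooth 1 fun z => LL z ^ (1 : ℤ) * f z := (IsSmooth.LL_zpow 1).mul hs1
  -- The factor 𝕃 brings the weights to (0,0), where ∂_0 and ∂̄_0 contain only derivatives; both
  -- annihilate 𝕃f, which is therefore constant.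
  have m1 := maass_LL_zpow_mul hs1 le_rfl 1 1
  have m2 := maassBar_LL_zpow_mul hs1 le_rfl 1 1
  have hz1 (z : ℍ) : wirtinger (fun z => LL z ^ (1 : ℤ) * f z) z = 0 := by
    have := congrFun m1 z
    rw [h1, Pi.zero_apply, mul_zero, maass, sub_self, Int.cast_zero, zero_mul, add_zero] at this
    exact (mul_eq_zero.mp this).resolve_left (sub_conj_ne_zero z)
  have hz2 (z : ℍ) : wirtingerBar (fun z => LL z ^ (1 : ℤ) * f z) z = 0 := by
    have := congrFun m2 z
    have h3 := congrFun h2 z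
    simp only [Pi.zero_apply, map_eq_zero] at h3
    rw [h3, mul_zero, maassBar, sub_self, Int.cast_zero, zero_mul, add_zero] at this
    refine (mul_eq_zero.mp this).resolve_left ?_
    rw [← neg_sub]
    exact neg_ne_zero.mpr (sub_conj_ne_zero z)
  have hd (w : ℂ) (hw : 0 < w.im) :
      HasFDerivAt ((fun z => LL z ^ (1 : ℤ) * f z) ∘ ofComplex) (0 : ℂ →L[ℝ] ℂ) w := by
    have := hu.hasWirtinger le_rfl ⟨w, hw⟩
    rw [hz1, hz2] at this
    refine HasFDerivAt.congr_fderiv this ?_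
    ext v; simp
  have hconst := (isOpen_im_gt 0).exists_is_const_of_fderiv_eq_zero (𝕜 := ℝ)
    (isPreconnected_im_gt 0)
    (fun w hw => (hd w hw).differentiableAt.differentiableWithinAt) (fun w hw => (hd w hw).fderiv)
  obtain ⟨c, hc⟩ := hconst
  refine ⟨c, ?_⟩
  funext z
  have := hc z z.im_pos
  simp only [Function.comp_apply, ofComplex_apply, zpow_one] at this
  rw [Pi.smul_apply, smul_eq_mul, ← this, zpow_neg_one]
  have := LL_ne_zero z
  field_simp

/-- Harmonic functions of weights `(r, 0)` are almost holomorphic. -/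
lemma lower_lower_eq_zero {r : ℤ} (hr : 2 ≤ r) {f : ℍ → ℂ} (hf : f ∈ MSpace r 0)
    (h : IsHarmonic r 0 f) : lower (lower f) = 0 := by
  have hs : IsSmooth 2 f := MSpace.isSmooth hf
  have he := MSpace.maassBar hf
  have hes : IsSmooth 1 (maassBar 0 f) := MSpace.isSmooth he
  have h1 := h.maass_maassBar hs
  have h2 := maass_LL_zpow_mul hes le_rfl (r - 1) (r - 1)
  rw [h1, sub_self] at h2
  have hu := MSpace.LL_zpow_mul he (r - 1)
  -- The exponent r - 1 makes the first weight zero. As ∂_{r-1}∂̄_0 f = 0, the function u is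
  -- antiholomorphic of weights (0, 2-r).
  set u : ℍ → ℂ := fun z => LL z ^ (r - 1) * maassBar 0 f z with hu_def
  have h3 : maassBar 0 (fun z => conj (u z)) = 0 := by
    rw [maassBar_star (MSpace.isSmooth hu (n := 1)) le_rfl, h2]
    funext z; simp
  have hu' := MSpace.star hu
  have e1 : r - 1 - (r - 1) = 0 := sub_self _
  have e2 : (0 + 1 - (r - 1) : ℤ) = 2 - r := by ring
  rw [e1, e2] at hu'
  obtain ⟨g, hg⟩ := exists_modularForm hu'.2.1 (MSpace.isSmooth hu') (MSpace.exists_bound hu') h3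
  -- A form of negative weight 2 - r vanishes; for r = 2 it is constant, and then u is the lowering
  -- of f itself.
  rcases hr.lt_or_eq with hr | rfl
  · have hg0 : ⇑g = 0 := ModularFormClass.levelOne_neg_weight_eq_zero (by omega) g
    have hl : lower f = 0 := by
      funext z
      have := congrFun (hg.symm.trans hg0) z
      simp only [Pi.zero_apply, map_eq_zero, hu_def, mul_eq_zero] at this
      rw [lower, this.resolve_left (zpow_ne_zero _ (LL_ne_zero z))]
      simp
    rw [hl, lower_zero]
  · obtain ⟨c, hc⟩ : ∃ c : ℂ, ⇑g = Function.const ℍ c := by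
      revert g
      rw [show (2 - 2 : ℤ) = 0 by norm_num]
      intro g _
      exact ModularFormClass.levelOne_weight_zero_const g
    have hl : lower f = fun _ => conj c := by
      funext z
      have := congrFun (hg.symm.trans hc) z
      have h4 := congrArg conj this
      simp only [conj_conj, Function.const_apply] at h4
      rw [← h4, hu_def, lower]
      norm_num
    rw [hl, lower_const]

/-- One lowering of 𝕃^{-n-1} f equals 𝕃^{-n} ∂̄_{-n-1} f, and ∂̄ keeps harmonicity while moving (r,
-n-1) to (r-1, -n). The sum of the weights does not change, so the bound 2 persists down to second
weight 0, where two more lowerings suffice. -/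
lemma lower_iterate_LL_zpow_mul_eq_zero (n : ℕ) : ∀ {r : ℤ}, 2 ≤ r - n → ∀ {f : ℍ → ℂ},
    f ∈ MSpace r (-n) → IsHarmonic r (-n) f →
    lower^[n + 2] (fun z => LL z ^ (-n : ℤ) * f z) = 0 := by
  induction n with
  | zero =>
    intro r hr f hf h
    simp only [Nat.cast_zero, neg_zero, sub_zero, zpow_zero, one_mul] at hr hf h ⊢
    exact lower_lower_eq_zero hr hf h
  | succ n ih =>
    intro r hr f hf h
    have hs : IsSmooth 2 f := MSpace.isSmooth hf
    have e : lower (fun z => LL z ^ (-(n + 1 : ℕ) : ℤ) * f z) =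
        fun z => LL z ^ (-n : ℤ) * maassBar (-(n + 1 : ℕ)) f z := by
      funext z
      have := maassBar_LL_zpow_mul hs (by norm_num) (-(n + 1 : ℕ)) (-(n + 1 : ℕ))
      rw [sub_self] at this
      rw [lower, this, ← mul_assoc, ← zpow_one_add₀ (LL_ne_zero z)]
      congr 2
      push_cast; ring
    rw [show n + 1 + 2 = (n + 2) + 1 by ring, Function.iterate_succ_apply, e]
    have e2 : (-(n + 1 : ℕ) + 1 : ℤ) = -n := by push_cast; ring
    have h1 := MSpace.maassBar hf
    have h2 := h.maassBar hs
    rw [e2] at h1 h2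
    exact ih (by push_cast at hr ⊢; omega) h1 h2

/-! ### Real analytic Eisenstein series -/

/-- Non-zero pairs of integers. -/
abbrev NonzeroPair : Type := {p : ℤ × ℤ // p ≠ 0}

/-- The linear form `mz + n`. -/
def linForm (p : NonzeroPair) (z : ℍ) : ℂ := (p.1.1 : ℂ) * z + (p.1.2 : ℂ)

lemma conj_linForm (p : NonzeroPair) (z : ℍ) :
    conj (linForm p z) = (p.1.1 : ℂ) * conj (z : ℂ) + (p.1.2 : ℂ) := by
  simp [linForm]

lemma im_linForm (p : NonzeroPair) (z : ℍ) : (linForm p z).im = p.1.1 * z.im := by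
  simp [linForm]

lemma linForm_ne_zero (p : NonzeroPair) (z : ℍ) : linForm p z ≠ 0 := by
  intro h
  have h1 := congrArg Complex.im h
  rw [im_linForm, Complex.zero_im, mul_eq_zero] at h1
  have hm : p.1.1 = 0 := by
    rcases h1 with h1 | h1
    · exact_mod_cast h1
    · exact absurd h1 z.im_ne_zero
  rw [linForm, hm, Int.cast_zero, zero_mul, zero_add, Int.cast_eq_zero] at h
  exact p.2 (Prod.ext hm h)

lemma conj_linForm_ne_zero (p : NonzeroPair) (z : ℍ) : conj (linForm p z) ≠ 0 :=
  (map_ne_zero _).mpr (linForm_ne_zero p z)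

lemma abs_mul_im_le_norm_linForm (p : NonzeroPair) (z : ℍ) :
    |(p.1.1 : ℝ)| * z.im ≤ ‖linForm p z‖ := by
  have := Complex.abs_im_le_norm (linForm p z)
  rwa [im_linForm, abs_mul, abs_of_pos z.im_pos] at this

/-- The summands of the Eisenstein series. -/
def eisTerm (r s : ℤ) (p : NonzeroPair) (z : ℍ) : ℂ :=
  linForm p z ^ (-r) * conj (linForm p z) ^ (-s)

/-- The series `∑ (mz + n)^{-r} (m z̄ + n)^{-s}`. -/
def eisSum (r s : ℤ) (z : ℍ) : ℂ := ∑' p : NonzeroPair, eisTerm r s p z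

lemma norm_eisTerm (r s : ℤ) (p : NonzeroPair) (z : ℍ) :
    ‖eisTerm r s p z‖ = ‖linForm p z‖ ^ (-(r + s)) := by
  rw [eisTerm, norm_mul, norm_zpow, norm_zpow, RCLike.norm_conj,
    ← zpow_add₀ (norm_ne_zero_iff.mpr (linForm_ne_zero p z))]
  congr 1; ring

/-- The vector of a pair. -/
def NonzeroPair.vec (p : NonzeroPair) : Fin 2 → ℤ := ![p.1.1, p.1.2]

lemma NonzeroPair.vec_injective : Function.Injective NonzeroPair.vec := by
  intro p q h
  have h0 := congrFun h 0
  have h1 := congrFun h 1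
  simp only [NonzeroPair.vec, Matrix.cons_val_zero, Matrix.cons_val_one] at h0 h1
  exact Subtype.ext (Prod.ext h0 h1)

lemma summable_norm_vec {w : ℤ} (hw : 3 ≤ w) :
    Summable fun p : NonzeroPair => ‖p.vec‖ ^ (-w : ℝ) :=
  (EisensteinSeries.summable_one_div_norm_rpow (k := w)
    (by have : (3 : ℝ) ≤ w := by exact_mod_cast hw
        linarith)).comp_injective
    NonzeroPair.vec_injective

lemma norm_linForm_zpow_le {w : ℤ} (hw : 0 ≤ w) {A B : ℝ} (hB : 0 < B) {z : ℍ}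
    (hz : z ∈ verticalStrip A B) (p : NonzeroPair) :
    ‖linForm p z‖ ^ (-w) ≤ EisensteinSeries.r ⟨⟨A, B⟩, hB⟩ ^ (-w : ℝ) * ‖p.vec‖ ^ (-w : ℝ) := by
  have h := EisensteinSeries.summand_bound_of_mem_verticalStrip (k := w) (by exact_mod_cast hw)
    p.vec hB hz
  rw [← Real.rpow_intCast]
  push_cast
  simpa [NonzeroPair.vec, linForm] using h

lemma mem_verticalStrip_self (z : ℍ) : z ∈ verticalStrip |z.re| z.im := ⟨le_rfl, le_rfl⟩

lemma summable_eisTerm {r s : ℤ} (h : 3 ≤ r + s) (z : ℍ) : Summable fun p => eisTerm r s p z := by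
  refine .of_norm_bounded ((summable_norm_vec h).mul_left
    (EisensteinSeries.r ⟨⟨|z.re|, z.im⟩, z.im_pos⟩ ^ (-(r + s : ℤ) : ℝ))) fun p => ?_
  rw [norm_eisTerm]
  exact norm_linForm_zpow_le (by omega) z.im_pos (mem_verticalStrip_self z) p

lemma hasWirtinger_linForm (p : NonzeroPair) (z : ℍ) : HasWirtinger (linForm p) (p.1.1) 0 z :=
  (((hasWirtinger_coe z).smul (p.1.1 : ℂ)).add (hasWirtinger_const (p.1.2 : ℂ) z)).congr_deriv
    (by ring) (by ring)

lemma hasWirtinger_eisTerm (r s : ℤ) (p : NonzeroPair) (z : ℍ) :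
    HasWirtinger (eisTerm r s p) (-r * p.1.1 * eisTerm (r + 1) s p z)
      (-s * p.1.1 * eisTerm r (s + 1) p z) z := by
  have h1 := (hasWirtinger_linForm p z).comp_left
    (hasDerivAt_zpow (-r) _ (Or.inl (linForm_ne_zero p z)))
  have h2 := (hasWirtinger_linForm p z).star.comp_left
    (hasDerivAt_zpow (-s) _ (Or.inl (conj_linForm_ne_zero p z)))
  refine (h1.mul h2).congr_deriv ?_ ?_
  · simp only [map_zero, mul_zero, zero_add, eisTerm]
    rw [show -r - 1 = -(r + 1) by ring]; push_cast; ring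
  · simp only [mul_zero, zero_mul, add_zero, eisTerm, map_intCast]
    rw [show -s - 1 = -(s + 1) by ring]; push_cast; ring

/-- Since |m|B ≤ |mz+n|, the factor m created by differentiation is paid for by the extra power of
the linear form. The differentiated series needs no better convergence than the original one. -/
lemma norm_eisTerm_deriv_le {w : ℤ} (c : ℤ) (p : NonzeroPair) {B : ℝ}
    (hB : 0 < B) {z : ℍ} (hz : B ≤ z.im) {a b : ℤ} (hab : a + b = w + 1) :
    ‖(-c * p.1.1 * eisTerm a b p z : ℂ)‖ ≤ |(c : ℝ)| / B * ‖linForm p z‖ ^ (-w) := by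
  have hpos : 0 < ‖linForm p z‖ := norm_pos_iff.mpr (linForm_ne_zero p z)
  rw [norm_mul, norm_mul, norm_neg, norm_intCast, norm_intCast, norm_eisTerm, hab,
    show -(w + 1) = -w - 1 by ring, zpow_sub_one₀ hpos.ne']
  have h1 : |(p.1.1 : ℝ)| * B ≤ ‖linForm p z‖ :=
    (mul_le_mul_of_nonneg_left hz (abs_nonneg _)).trans (abs_mul_im_le_norm_linForm p z)
  have h2 : |(p.1.1 : ℝ)| * ‖linForm p z‖⁻¹ ≤ 1 / B := by
    rw [← div_eq_mul_inv, div_le_div_iff₀ hpos hB, one_mul]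
    exact h1
  have h3 : 0 ≤ ‖linForm p z‖ ^ (-w) := by positivity
  calc |(c : ℝ)| * |(p.1.1 : ℝ)| * (‖linForm p z‖ ^ (-w) * ‖linForm p z‖⁻¹)
      = |(c : ℝ)| * (|(p.1.1 : ℝ)| * ‖linForm p z‖⁻¹) * ‖linForm p z‖ ^ (-w) := by ring
    _ ≤ |(c : ℝ)| * (1 / B) * ‖linForm p z‖ ^ (-w) := by gcongr
    _ = _ := by ring

lemma hasWirtinger_eisSum {r s : ℤ} (h : 3 ≤ r + s) (z : ℍ) :
    HasWirtinger (eisSum r s) (∑' p : NonzeroPair, -r * p.1.1 * eisTerm (r + 1) s p z)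
      (∑' p : NonzeroPair, -s * p.1.1 * eisTerm r (s + 1) p z) z := by
  obtain ⟨A, hA⟩ : ∃ A, |z.re| < A := exists_gt _
  obtain ⟨B, hB, hBz⟩ : ∃ B, 0 < B ∧ B < z.im := exists_between z.im_pos
  let t : Set ℂ := {w | w.re < A} ∩ {w | -A < w.re} ∩ {w | B < w.im}
  have hto : IsOpen t := ((isOpen_lt Complex.continuous_re continuous_const).inter
    (isOpen_lt continuous_const Complex.continuous_re)).inter (isOpen_im_gt B)
  have htc : IsPreconnected t := (((convex_halfSpace_re_lt A).inter
    (convex_halfSpace_re_gt (-A))).inter (convex_halfSpace_im_gt B)).isPreconnected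
  have hzt : (z : ℂ) ∈ t := by
    exact ⟨⟨(abs_lt.mp hA).2, (abs_lt.mp hA).1⟩, hBz⟩
  have hstrip (w : ℍ) (hw : (w : ℂ) ∈ t) : w ∈ verticalStrip A B :=
    ⟨abs_le.mpr ⟨le_of_lt hw.1.2, le_of_lt hw.1.1⟩, le_of_lt hw.2⟩
  have hu : Summable fun p : NonzeroPair => (|(r : ℝ)| / B + |(s : ℝ)| / B) *
      (EisensteinSeries.r ⟨⟨A, B⟩, hB⟩ ^ (-(r + s : ℤ) : ℝ) * ‖p.vec‖ ^ (-(r + s : ℤ) : ℝ)) :=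
    ((summable_norm_vec h).mul_left _).mul_left _
  have hu1 (p : NonzeroPair) (w : ℍ) (hw : (w : ℂ) ∈ t) :
      ‖(-r * p.1.1 * eisTerm (r + 1) s p w : ℂ)‖ ≤ (|(r : ℝ)| / B + |(s : ℝ)| / B) *
      (EisensteinSeries.r ⟨⟨A, B⟩, hB⟩ ^ (-(r + s : ℤ) : ℝ) * ‖p.vec‖ ^ (-(r + s : ℤ) : ℝ)) := by
    refine (norm_eisTerm_deriv_le (w := r + s) r p hB (hstrip w hw).2 (by ring)).trans ?_
    refine mul_le_mul ?_ (norm_linForm_zpow_le (by omega) hB (hstrip w hw) p) (by positivity)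
      (by positivity)
    exact le_add_of_nonneg_right (by positivity)
  have hu2 (p : NonzeroPair) (w : ℍ) (hw : (w : ℂ) ∈ t) :
      ‖(-s * p.1.1 * eisTerm r (s + 1) p w : ℂ)‖ ≤ (|(r : ℝ)| / B + |(s : ℝ)| / B) *
      (EisensteinSeries.r ⟨⟨A, B⟩, hB⟩ ^ (-(r + s : ℤ) : ℝ) * ‖p.vec‖ ^ (-(r + s : ℤ) : ℝ)) := by
    refine (norm_eisTerm_deriv_le (w := r + s) s p hB (hstrip w hw).2 (by ring)).trans ?_
    refine mul_le_mul ?_ (norm_linForm_zpow_le (by omega) hB (hstrip w hw) p) (by positivity)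
      (by positivity)
    exact le_add_of_nonneg_left (by positivity)
  exact hasWirtinger_tsum hu hto htc (fun w hw => hB.trans hw.2)
    (fun p w _ => hasWirtinger_eisTerm r s p w) hu1 hu2 hzt (summable_eisTerm h z) hzt

lemma conj_eisSum (r s : ℤ) (z : ℍ) : conj (eisSum r s z) = eisSum s r z := by
  rw [eisSum, eisSum, conj_tsum]
  congr 1
  funext p
  rw [eisTerm, eisTerm, map_mul, map_zpow₀, map_zpow₀, conj_conj, mul_comm]

/-- Put ℓ = mz + n, so that m(z - z̄) = ℓ - ℓ̄. In each term the part with ℓ cancels the weight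
term, and the part with ℓ̄ shifts the bidegree. -/
lemma maass_eisSum {r s : ℤ} (h : 3 ≤ r + s) :
    maass r (eisSum r s) = (r : ℂ) • eisSum (r + 1) (s - 1) := by
  funext z
  rw [(hasWirtinger_eisSum h z).maass, Pi.smul_apply, smul_eq_mul, eisSum, eisSum,
    ← tsum_mul_left, ← tsum_mul_left, ← tsum_mul_left]
  have hs1 : Summable fun p : NonzeroPair => ((z : ℂ) - conj (z : ℂ)) *
      (-r * p.1.1 * eisTerm (r + 1) s p z) := by
    refine Summable.mul_left _ ?_
    refine .of_norm_bounded (((summable_norm_vec h).mul_left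
      (EisensteinSeries.r ⟨⟨|z.re|, z.im⟩, z.im_pos⟩ ^ (-(r + s : ℤ) : ℝ))).mul_left
      (|(r : ℝ)| / z.im)) fun p => ?_
    refine (norm_eisTerm_deriv_le (w := r + s) r p z.im_pos le_rfl (by ring)).trans ?_
    refine mul_le_mul_of_nonneg_left (norm_linForm_zpow_le (by omega) z.im_pos
      (mem_verticalStrip_self z) p) ?_
    have := z.im_pos
    positivity
  rw [← hs1.tsum_add ((summable_eisTerm h z).mul_left _)]
  congr 1
  funext p
  have hj := linForm_ne_zero p z
  have hj' := conj_linForm_ne_zero p z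
  simp only [eisTerm]
  rw [show -(s - 1) = -s + 1 by ring, zpow_add_one₀ hj', show -r = -(r + 1) + 1 by ring,
    zpow_add_one₀ hj]
  have hc : (p.1.1 : ℂ) * ((z : ℂ) - conj (z : ℂ)) = linForm p z - conj (linForm p z) := by
    rw [conj_linForm, linForm]; ring
  linear_combination (-r * linForm p z ^ (-(r + 1)) * conj (linForm p z) ^ (-s)) * hc

lemma differentiableAt_eisSum {r s : ℤ} (h : 3 ≤ r + s) (z : ℍ) :
    HasWirtinger (eisSum r s) (wirtinger (eisSum r s) z) (wirtingerBar (eisSum r s) z) z :=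
  hasWirtinger_of_differentiableAt (hasWirtinger_eisSum h z).differentiableAt

lemma maassBar_eisSum {r s : ℤ} (h : 3 ≤ r + s) :
    maassBar s (eisSum r s) = (s : ℂ) • eisSum (r - 1) (s + 1) := by
  funext z
  have h1 := (differentiableAt_eisSum (r := s) (s := r) (by omega) z)
  have h2 := h1.star.congr (g := eisSum r s)
    (Eventually.of_forall fun w => (conj_eisSum s r w).symm)
  have h3 := congrArg conj (congrFun (maass_eisSum (r := s) (s := r) (by omega)) z)
  rw [Pi.smul_apply, smul_eq_mul, map_mul, conj_eisSum, map_intCast, maass, map_add,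
    map_mul, map_sub, conj_conj, map_mul, conj_eisSum, map_intCast] at h3
  rw [h2.maassBar, Pi.smul_apply, smul_eq_mul, ← h3]

/-- Smoothness in terms of the Wirtinger derivatives. -/
lemma IsSmooth.succ {n : ℕ} {f : ℍ → ℂ}
    (h : ∀ z, HasWirtinger f (BigradedModular.wirtinger f z) (BigradedModular.wirtingerBar f z) z)
    (h1 : IsSmooth n (BigradedModular.wirtinger f)) (h2 : IsSmooth n (BigradedModular.wirtingerBar f)) :
    IsSmooth (n + 1 : ℕ) f := by
  intro z
  push_cast
  rw [contDiffAt_succ_iff_hasFDerivAt]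
  refine ⟨fun w => wirtingerCLM (BigradedModular.wirtinger f (ofComplex w))
    (BigradedModular.wirtingerBar f (ofComplex w)), ⟨_, eventually_im_pos z, fun w hw => ?_⟩, ?_⟩
  · have := h ⟨w, hw⟩
    simp only [ofComplex_apply_of_im_pos hw]
    exact this
  · exact ((h1 z).smul contDiffAt_const).add ((h2 z).smul contDiffAt_const)

lemma wirtinger_eq_of_maass (r : ℤ) (f : ℍ → ℂ) :
    wirtinger f = (fun z => LL z ^ (-1 : ℤ)) * ((Real.pi * I) • (maass r f + (-r : ℂ) • f)) := by
  funext z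
  have hz := sub_conj_ne_zero z
  have hpi : (Real.pi : ℂ) ≠ 0 := by exact_mod_cast Real.pi_ne_zero
  simp only [Pi.mul_apply, Pi.smul_apply, Pi.add_apply, smul_eq_mul, maass, zpow_neg_one, LL_eq]
  field_simp [I_ne_zero]
  ring

lemma wirtingerBar_eq_of_maassBar (s : ℤ) (f : ℍ → ℂ) :
    wirtingerBar f =
      (fun z => LL z ^ (-1 : ℤ)) * ((-(Real.pi * I)) • (maassBar s f + (-s : ℂ) • f)) := by
  funext z
  have hz := sub_conj_ne_zero z
  have hpi : (Real.pi : ℂ) ≠ 0 := by exact_mod_cast Real.pi_ne_zero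
  simp only [Pi.mul_apply, Pi.smul_apply, Pi.add_apply, smul_eq_mul, maassBar, zpow_neg_one, LL_eq]
  field_simp [I_ne_zero]
  ring

/-- A bootstrap: the Wirtinger derivatives are combinations of Eisenstein series of the same total
weight with coefficient 𝕃^{-1}, so class C^n for all (r,s) at once yields class C^{n+1}. -/
lemma isSmooth_eisSum (n : ℕ) : ∀ {r s : ℤ}, 3 ≤ r + s → IsSmooth n (eisSum r s) := by
  induction n with
  | zero =>
    intro r s h z
    rw [Nat.cast_zero, contDiffAt_zero]
    refine ⟨_, eventually_im_pos z, fun w hw => ?_⟩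
    exact (hasWirtinger_eisSum h ⟨w, hw⟩).continuousAt.continuousWithinAt
  | succ n ih =>
    intro r s h
    refine IsSmooth.succ (differentiableAt_eisSum h) ?_ ?_
    · rw [wirtinger_eq_of_maass r, maass_eisSum h]
      exact (IsSmooth.LL_zpow _).mul ((((ih (by omega)).smul _).add ((ih h).smul _)).smul _)
    · rw [wirtingerBar_eq_of_maassBar s, maassBar_eisSum h]
      exact (IsSmooth.LL_zpow _).mul ((((ih (by omega)).smul _).add ((ih h).smul _)).smul _)

lemma isHarmonic_eisSum {r s : ℤ} (h : 3 ≤ r + s) : IsHarmonic r s (eisSum r s) := by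
  rw [IsHarmonic, maass_eisSum h, maassBar_smul (isSmooth_eisSum 1 (by omega)) (by simp),
    maassBar_eisSum (by omega), smul_smul, add_sub_cancel_right, sub_add_cancel]
  push_cast
  rfl

/-- The right action of `SL₂(ℤ)` on non-zero pairs. -/
def NonzeroPair.smulEquiv (γ : SL(2, ℤ)) : NonzeroPair ≃ NonzeroPair :=
  Equiv.subtypeEquiv
    { toFun := fun p => (p.1 * γ 0 0 + p.2 * γ 1 0, p.1 * γ 0 1 + p.2 * γ 1 1)
      invFun := fun p => (p.1 * γ 1 1 - p.2 * γ 1 0, -p.1 * γ 0 1 + p.2 * γ 0 0)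
      left_inv := fun p => by
        have := γ.det_coe
        rw [Matrix.det_fin_two] at this
        refine Prod.ext ?_ ?_
        · change (p.1 * γ 0 0 + p.2 * γ 1 0) * γ 1 1 - (p.1 * γ 0 1 + p.2 * γ 1 1) * γ 1 0 = p.1
          linear_combination p.1 * this
        · change -(p.1 * γ 0 0 + p.2 * γ 1 0) * γ 0 1 + (p.1 * γ 0 1 + p.2 * γ 1 1) * γ 0 0 = p.2
          linear_combination p.2 * this
      right_inv := fun p => by
        have := γ.det_coe
        rw [Matrix.det_fin_two] at this
        refine Prod.ext ?_ ?_
        · change (p.1 * γ 1 1 - p.2 * γ 1 0) * γ 0 0 + (-p.1 * γ 0 1 + p.2 * γ 0 0) * γ 1 0 = p.1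
          linear_combination p.1 * this
        · change (p.1 * γ 1 1 - p.2 * γ 1 0) * γ 0 1 + (-p.1 * γ 0 1 + p.2 * γ 0 0) * γ 1 1 = p.2
          linear_combination p.2 * this }
    fun p => by
      rw [not_iff_not]
      constructor
      · rintro rfl; simp
      · intro h
        have h1 := congrArg Prod.fst h
        have h2 := congrArg Prod.snd h
        simp only [Equiv.coe_fn_mk, Prod.fst_zero, Prod.snd_zero] at h1 h2
        have := γ.det_coe
        rw [Matrix.det_fin_two] at this
        refine Prod.ext ?_ ?_
        · change p.1 = 0
          linear_combination -p.1 * this + γ 1 1 * h1 - γ 1 0 * h2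
        · change p.2 = 0
          linear_combination -p.2 * this - γ 0 1 * h1 + γ 0 0 * h2

lemma linForm_smul (γ : SL(2, ℤ)) (p : NonzeroPair) (z : ℍ) :
    linForm p (γ • z) = linForm (NonzeroPair.smulEquiv γ p) z / autFactor γ z := by
  have hj := autFactor_ne_zero γ z
  have hz : ((γ • z : ℍ) : ℂ) = ((γ 0 0 : ℂ) * z + γ 0 1) / autFactor γ z := by
    rw [UpperHalfPlane.specialLinearGroup_apply]
    simp [autFactor]
  rw [eq_div_iff hj, linForm, hz, add_mul, mul_assoc, div_mul_cancel₀ _ hj]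
  simp only [linForm, NonzeroPair.smulEquiv, Equiv.subtypeEquiv_apply, Equiv.coe_fn_mk, autFactor]
  push_cast
  ring

/-- The group permutes the non-zero pairs, and each linear form is transformed by the factor of
automorphy. -/
lemma isBimodular_eisSum (r s : ℤ) : IsBimodular r s (eisSum r s) := by
  rw [isBimodular_iff]
  intro γ z
  have hj := autFactor_ne_zero γ z
  have hj' := conj_autFactor_ne_zero γ z
  rw [eisSum, eisSum, ← (NonzeroPair.smulEquiv γ).tsum_eq fun p => eisTerm r s p z,
    ← tsum_mul_left]
  congr 1
  funext p
  rw [eisTerm, eisTerm, linForm_smul, map_div₀, div_zpow, div_zpow]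
  simp only [zpow_neg]
  field_simp

/-! ### Eisenstein series near the cusp -/

/-- The part of the upper half plane over which fundamental domains are chosen, near the cusp. -/
def cuspStrip : Filter ℍ := atImInfty ⊓ 𝓟 {z | |z.re| ≤ 1 / 2}

lemma cuspStrip_le : cuspStrip ≤ atImInfty := inf_le_left

lemma eventually_cuspStrip_re : ∀ᶠ z : ℍ in cuspStrip, |z.re| ≤ 1 / 2 :=
  Filter.mem_of_superset (Filter.mem_inf_of_right (mem_principal_self _)) fun _ h => h

/-- The constant terms of the Eisenstein series. -/
def eisConstTerm (k : ℕ) (p : NonzeroPair) : ℝ :=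
  if p.1.1 = 0 then ((p.1.2 : ℝ) ^ (-k : ℤ)) ^ 2 else 0

lemma eisTerm_eq_of_fst_eq_zero (k : ℕ) {p : NonzeroPair} (hp : p.1.1 = 0) (z : ℍ) :
    eisTerm k k p z = eisConstTerm k p := by
  simp [eisTerm, linForm, eisConstTerm, hp, pow_two]

lemma eisConstTerm_nonneg (k : ℕ) (p : NonzeroPair) : 0 ≤ eisConstTerm k p := by
  unfold eisConstTerm
  split_ifs <;> positivity

lemma summable_eisConstTerm {k : ℕ} (hk : 2 ≤ k) : Summable (eisConstTerm k) := by
  refine .of_norm_bounded (summable_eisTerm (r := k) (s := k) (by omega) UpperHalfPlane.I).norm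
    fun p => ?_
  by_cases hp : p.1.1 = 0
  · rw [eisTerm_eq_of_fst_eq_zero k hp, norm_real]
  · simp [eisConstTerm, hp]

lemma tsum_eisConstTerm_pos {k : ℕ} (hk : 2 ≤ k) : 0 < ∑' p, eisConstTerm k p := by
  refine (summable_eisConstTerm hk).tsum_pos (eisConstTerm_nonneg k) ⟨(0, 1), by simp⟩ ?_
  simp [eisConstTerm]

lemma abs_add_half_le_norm_vec {p : NonzeroPair} (hp : p.1.1 ≠ 0) :
    |(p.1.2 : ℝ) + 1 / 2| ≤ 3 / 2 * ‖p.vec‖ := by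
  have h1 : (1 : ℝ) ≤ ‖p.vec‖ := by
    refine le_trans ?_ (norm_le_pi_norm p.vec 0)
    have : (1 : ℤ) ≤ |p.1.1| := Int.one_le_abs hp
    rw [NonzeroPair.vec, Matrix.cons_val_zero, Int.norm_eq_abs]
    exact_mod_cast this
  have h2 : |(p.1.2 : ℝ)| ≤ ‖p.vec‖ := by
    refine le_trans (le_of_eq ?_) (norm_le_pi_norm p.vec 1)
    rw [NonzeroPair.vec, Matrix.cons_val_one, Int.norm_eq_abs]
    rfl
  refine (abs_add_le _ _).trans ?_
  rw [abs_of_pos (by norm_num : (0 : ℝ) < 1 / 2)]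
  linarith

/-- The majorant for dominated convergence. The shift by 1/2 keeps the second factor finite at n =
0. For m = 0 the convention 1/0 = 0 makes the majorant vanish, which is harmless because there the
term equals its constant. -/
lemma summable_inv_sq_mul_inv_sq : Summable fun p : NonzeroPair =>
    1 / |(p.1.1 : ℝ)| ^ 2 * (1 / |(p.1.2 : ℝ) + 1 / 2| ^ 2) := by
  have h1 : Summable fun n : ℤ => 1 / |(n : ℝ)| ^ 2 := by
    simpa using Real.summable_one_div_int_pow.mpr (by norm_num : 1 < 2)
  have h2 : Summable fun n : ℤ => 1 / |(n : ℝ) + 1 / 2| ^ 2 := by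
    have := (Real.summable_one_div_int_add_rpow (1 / 2) 2).mpr (by norm_num)
    refine this.congr fun n => ?_
    rw [Real.rpow_two]
  exact (h1.mul_of_nonneg h2 (fun _ => by positivity) (fun _ => by positivity)).comp_injective
    Subtype.val_injective

lemma norm_LL_zpow_mul_eisTerm_eq (k : ℕ) (p : NonzeroPair) (z : ℍ) :
    ‖LL z ^ (k : ℤ) * eisTerm k k p z‖ = (2 * Real.pi) ^ k * (z.im / ‖linForm p z‖ ^ 2) ^ k := by
  rw [norm_mul, norm_zpow, norm_LL, norm_eisTerm, zpow_natCast, mul_pow, div_pow, ← pow_mul,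
    mul_assoc, zpow_neg, div_eq_mul_inv, ← zpow_natCast (‖linForm p z‖)]
  congr 4
  push_cast
  ring

lemma im_le_norm_linForm {p : NonzeroPair} (hp : p.1.1 ≠ 0) (z : ℍ) : z.im ≤ ‖linForm p z‖ := by
  refine le_trans ?_ (abs_mul_im_le_norm_linForm p z)
  have : (1 : ℝ) ≤ |(p.1.1 : ℝ)| := by exact_mod_cast Int.one_le_abs hp
  nlinarith [z.im_pos]

lemma im_div_norm_linForm_sq_le {p : NonzeroPair} (hp : p.1.1 ≠ 0) (z : ℍ) :
    z.im / ‖linForm p z‖ ^ 2 ≤ z.im⁻¹ := by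
  have h := im_le_norm_linForm hp z
  have hy := z.im_pos
  have hl := hy.trans_le h
  rw [inv_eq_one_div, div_le_div_iff₀ (by positivity) hy, one_mul, ← pow_two]
  gcongr

lemma tendsto_LL_zpow_mul_eisTerm {k : ℕ} (hk : 2 ≤ k) (p : NonzeroPair) :
    Tendsto (fun z => LL z ^ (k : ℤ) * (eisTerm k k p z - eisConstTerm k p)) atImInfty (𝓝 0) := by
  by_cases hp : p.1.1 = 0
  · simp [eisTerm_eq_of_fst_eq_zero k hp]
  · have h0 : Tendsto (fun z : ℍ => (2 * Real.pi) ^ k * z.im⁻¹) atImInfty (𝓝 0) := by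
      have h : Tendsto UpperHalfPlane.im atImInfty atTop := tendsto_comap
      have := (tendsto_inv_atTop_zero.comp h).const_mul ((2 * Real.pi) ^ k)
      rwa [mul_zero] at this
    refine squeeze_zero_norm' ?_ h0
    filter_upwards [eventually_im_ge 1] with z hz
    have hc : (eisConstTerm k p : ℂ) = 0 := by simp [eisConstTerm, hp]
    have h1 := im_div_norm_linForm_sq_le hp z
    have hy := z.im_pos
    rw [hc, sub_zero, norm_LL_zpow_mul_eisTerm_eq]
    refine mul_le_mul_of_nonneg_left ?_ (by positivity)
    exact (pow_le_of_le_one (by positivity) (h1.trans (inv_le_one_of_one_le₀ hz))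
      (by omega)).trans h1

lemma norm_LL_zpow_mul_eisTerm_le {k : ℕ} (hk : 2 ≤ k) : ∃ C : ℝ, ∀ z : ℍ, 1 ≤ z.im →
    |z.re| ≤ 1 / 2 → ∀ p : NonzeroPair, ‖LL z ^ (k : ℤ) * (eisTerm k k p z - eisConstTerm k p)‖ ≤
      C * (1 / |(p.1.1 : ℝ)| ^ 2 * (1 / |(p.1.2 : ℝ) + 1 / 2| ^ 2)) := by
  obtain ⟨R, hR, hRle⟩ : ∃ R : ℝ, 0 < R ∧ ∀ z : ℍ, 1 ≤ z.im → |z.re| ≤ 1 / 2 →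
      ∀ p : NonzeroPair, ‖linForm p z‖⁻¹ ≤ R * ‖p.vec‖⁻¹ := by
    refine ⟨EisensteinSeries.r ⟨⟨1 / 2, 1⟩, one_pos⟩ ^ (-1 : ℝ),
      Real.rpow_pos_of_pos (EisensteinSeries.r_pos _) _, fun z hz hz' p => ?_⟩
    have := norm_linForm_zpow_le (w := 1) zero_le_one one_pos
      (show z ∈ verticalStrip (1 / 2) 1 from ⟨hz', hz⟩) p
    simpa [Real.rpow_neg_one] using this
  refine ⟨(2 * Real.pi) ^ k * (R * (3 / 2)) ^ 2, fun z hz hz' p => ?_⟩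
  by_cases hp : p.1.1 = 0
  · simp [eisTerm_eq_of_fst_eq_zero k hp, hp]
  have hc : (eisConstTerm k p : ℂ) = 0 := by simp [eisConstTerm, hp]
  have h1 := im_div_norm_linForm_sq_le hp z
  have hy := z.im_pos
  have hl : 0 < ‖linForm p z‖ := norm_pos_iff.mpr (linForm_ne_zero p z)
  have hm : 0 < |(p.1.1 : ℝ)| := abs_pos.mpr (by exact_mod_cast hp)
  have hn : 0 < |(p.1.2 : ℝ) + 1 / 2| := by
    refine abs_pos.mpr fun h => ?_
    have h' : (2 * p.1.2 + 1 : ℝ) = 0 := by linarith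
    have h'' : 2 * p.1.2 + 1 = 0 := by exact_mod_cast h'
    omega
  have hv := abs_add_half_le_norm_vec hp
  rw [hc, sub_zero, norm_LL_zpow_mul_eisTerm_eq, mul_assoc]
  refine mul_le_mul_of_nonneg_left ?_ (by positivity)
  -- The base y/|mz+n|² is at most 1, so the exponent k may be lowered to 2. The square then splits
  -- into (y/|mz+n|)², bounded through m, and |mz+n|^{-2}, bounded through n on the strip.
  refine (pow_le_pow_of_le_one (by positivity) (h1.trans (inv_le_one_of_one_le₀ hz)) hk).trans ?_
  have h2 : z.im * ‖linForm p z‖⁻¹ ≤ 1 / |(p.1.1 : ℝ)| := by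
    rw [← div_eq_mul_inv, div_le_div_iff₀ hl hm, one_mul, mul_comm]
    exact abs_mul_im_le_norm_linForm p z
  have h3 : ‖linForm p z‖⁻¹ ≤ R * (3 / 2) * (1 / |(p.1.2 : ℝ) + 1 / 2|) := by
    refine (hRle z hz hz' p).trans ?_
    rw [mul_assoc]
    refine mul_le_mul_of_nonneg_left ?_ hR.le
    have hv0 : 0 < ‖p.vec‖ := by linarith
    rw [inv_eq_one_div, mul_one_div, div_le_div_iff₀ hv0 hn, one_mul]
    exact hv
  calc (z.im / ‖linForm p z‖ ^ 2) ^ 2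
      = (z.im * ‖linForm p z‖⁻¹) ^ 2 * ‖linForm p z‖⁻¹ ^ 2 := by field_simp
    _ ≤ (1 / |(p.1.1 : ℝ)|) ^ 2 * (R * (3 / 2) * (1 / |(p.1.2 : ℝ) + 1 / 2|)) ^ 2 := by gcongr
    _ = _ := by simp only [mul_pow, div_pow, one_pow]; ring

/-- The behaviour of the Eisenstein series at the cusp. -/
lemma tendsto_LL_zpow_mul_eisSum {k : ℕ} (hk : 2 ≤ k) :
    Tendsto (fun z => LL z ^ (k : ℤ) * (eisSum k k z - ((∑' p, eisConstTerm k p : ℝ) : ℂ)))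
      cuspStrip (𝓝 0) := by
  obtain ⟨C, hC⟩ := norm_LL_zpow_mul_eisTerm_le hk
  have h := tendsto_tsum_of_dominated_convergence (𝓕 := cuspStrip)
    (f := fun z p => LL z ^ (k : ℤ) * (eisTerm k k p z - eisConstTerm k p)) (g := fun _ => (0 : ℂ))
    (summable_inv_sq_mul_inv_sq.mul_left C)
    (fun p => (tendsto_LL_zpow_mul_eisTerm hk p).mono_left cuspStrip_le) (by
      filter_upwards [cuspStrip_le (eventually_im_ge 1), eventually_cuspStrip_re] with z h1 h2 p
      exact hC z h1 h2 p)
  rw [tsum_zero] at h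
  refine h.congr fun z => ?_
  rw [tsum_mul_left, ofReal_tsum, (summable_eisTerm (by omega) z).tsum_sub
    (by exact_mod_cast summable_eisConstTerm hk), eisSum]

/-! ### A maximum principle -/

open scoped Modular

/-- If the second derivative were positive, the point would be a local minimum as well. Then φ would
be locally constant and its second derivative zero. -/
lemma deriv_deriv_nonpos_of_isLocalMax {φ : ℝ → ℝ} {x : ℝ} (h : IsLocalMax φ x)
    (hc : ContinuousAt φ x) : deriv (deriv φ) x ≤ 0 := by
  by_contra! hpos
  have hmin := isLocalMin_of_deriv_deriv_pos hpos h.deriv_eq_zero hc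
  have hconst : φ =ᶠ[𝓝 x] fun _ => φ x := by
    filter_upwards [h, hmin] with y h1 h2
    exact le_antisymm h1 h2
  have h1 : deriv (deriv φ) x = 0 := by
    rw [hconst.deriv.deriv_eq]
    simp
  exact hpos.ne' h1

lemma HasWirtinger.hasDerivAt_line {f : ℍ → ℂ} {a b : ℂ} {w : ℍ} (h : HasWirtinger f a b w)
    {z v : ℂ} {t : ℝ} (hw : (w : ℂ) = z + t * v) :
    HasDerivAt (fun t : ℝ => f (ofComplex (z + t * v))) (a * v + b * conj v) t := by
  have h1 : HasDerivAt (fun t : ℝ => z + t * v) v t := by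
    simpa using ((Complex.ofRealCLM.hasDerivAt (x := t)).mul_const v).const_add z
  have h2 : HasFDerivAt (f ∘ ofComplex) (wirtingerCLM a b) (z + t * v) := hw ▸ h
  have h3 := h2.comp_hasDerivAt t h1
  rw [wirtingerCLM_apply] at h3
  exact h3

lemma eventually_im_line_pos (z : ℍ) (v : ℂ) :
    ∀ᶠ t : ℝ in 𝓝 0, 0 < ((z : ℂ) + t * v).im := by
  have hc : ContinuousAt (fun t : ℝ => (z : ℂ) + t * v) 0 := by fun_prop
  refine hc.eventually (p := fun w : ℂ => 0 < w.im) ?_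
  simpa using eventually_im_pos z

/-- The second derivative along a line. -/
lemma deriv_deriv_re_line {u : ℍ → ℂ} (hu : IsSmooth 2 u) (c v : ℂ) (z : ℍ) :
    deriv (deriv fun t : ℝ => (c * u (ofComplex (z + t * v))).re) 0 =
      (c * (wirtinger (wirtinger u) z * v ^ 2 + 2 * wirtingerBar (wirtinger u) z * (v * conj v) +
        wirtingerBar (wirtingerBar u) z * conj v ^ 2)).re := by
  have hre {g : ℝ → ℂ} {g' : ℂ} {t : ℝ} (h : HasDerivAt g g' t) :
      HasDerivAt (fun t => (c * g t).re) (c * g').re t :=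
    (Complex.reCLM.hasFDerivAt.comp_hasDerivAt t (h.const_mul c))
  have h1 : (deriv fun t : ℝ => (c * u (ofComplex (z + t * v))).re) =ᶠ[𝓝 0] fun t : ℝ =>
      (c * (wirtinger u (ofComplex (z + t * v)) * v +
        wirtingerBar u (ofComplex (z + t * v)) * conj v)).re := by
    filter_upwards [eventually_im_line_pos z v] with t ht
    exact (hre ((hu.hasWirtinger one_le_two _).hasDerivAt_line
      (coe_ofComplex_of_im_pos ht))).deriv
  rw [h1.deriv_eq]
  have h2 := (hu.wirtinger (m := 1) (by rw [one_add_one_eq_two])).hasWirtinger le_rfl z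
  have h3 := (hu.wirtingerBar (m := 1) (by rw [one_add_one_eq_two])).hasWirtinger le_rfl z
  have hz : (z : ℂ) = z + (0 : ℝ) * v := by simp
  refine (hre (((h2.hasDerivAt_line hz).mul_const v).add
    ((h3.hasDerivAt_line hz).mul_const (conj v)))).deriv.trans ?_
  rw [wirtinger_wirtingerBar_comm hu]
  congr 2
  ring

lemma IsSmooth.continuous {n : WithTop ℕ∞} {u : ℍ → ℂ} (hu : IsSmooth n u) : Continuous u := by
  rw [continuous_iff_continuousAt]
  intro z
  have h := (hu z).continuousAt.comp (UpperHalfPlane.continuous_coe.continuousAt (x := z))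
  refine h.congr (Eventually.of_forall fun w => ?_)
  simp

/-- At a global maximum of `|u|`, the Laplacian points inward. -/
lemma re_conj_mul_laplacian_nonpos {u : ℍ → ℂ} (hu : IsSmooth 2 u) {z : ℍ}
    (hmax : ∀ w, ‖u w‖ ≤ ‖u z‖) : (conj (u z) * wirtingerBar (wirtinger u) z).re ≤ 0 := by
  have key (v : ℂ) : (conj (u z) * (wirtinger (wirtinger u) z * v ^ 2 +
      2 * wirtingerBar (wirtinger u) z * (v * conj v) +
        wirtingerBar (wirtingerBar u) z * conj v ^ 2)).re ≤ 0 := by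
    rw [← deriv_deriv_re_line hu]
    -- The tested function is the real part of conj(u(z))·u along a line. It is bounded by |u(z)|²
    -- and attains this value at z.
    refine deriv_deriv_nonpos_of_isLocalMax (Eventually.of_forall fun t => ?_) ?_
    · simp only [ofReal_zero, zero_mul, add_zero, ofComplex_apply]
      rw [← Complex.normSq_eq_conj_mul_self, ofReal_re, Complex.normSq_eq_norm_sq]
      refine (Complex.re_le_norm _).trans ?_
      rw [norm_mul, RCLike.norm_conj, pow_two]
      exact mul_le_mul_of_nonneg_left (hmax _) (norm_nonneg _)
    · have hz : (z : ℂ) = z + (0 : ℝ) * v := by simp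
      have := ((hu.hasWirtinger one_le_two z).hasDerivAt_line hz).continuousAt
      exact Complex.continuous_re.continuousAt.comp (continuousAt_const.mul this)
  have h1 := key 1
  have h2 := key I
  -- The second derivatives in the directions 1 and i add up to four times ∂∂̄.
  have h3 : (conj (u z) * wirtingerBar (wirtinger u) z).re =
    ((conj (u z) * (wirtinger (wirtinger u) z * 1 ^ 2 +
      2 * wirtingerBar (wirtinger u) z * (1 * conj 1) +
        wirtingerBar (wirtingerBar u) z * conj 1 ^ 2)).re +
    (conj (u z) * (wirtinger (wirtinger u) z * I ^ 2 +
      2 * wirtingerBar (wirtinger u) z * (I * conj I) +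
        wirtingerBar (wirtingerBar u) z * conj I ^ 2)).re) / 4 := by
    rw [← Complex.add_re, map_one, conj_I]
    have : conj (u z) * (wirtinger (wirtinger u) z * 1 ^ 2 +
      2 * wirtingerBar (wirtinger u) z * (1 * 1) +
        wirtingerBar (wirtingerBar u) z * 1 ^ 2) +
      conj (u z) * (wirtinger (wirtinger u) z * I ^ 2 +
      2 * wirtingerBar (wirtinger u) z * (I * -I) +
        wirtingerBar (wirtingerBar u) z * (-I) ^ 2) =
        ((4 : ℝ) : ℂ) * (conj (u z) * wirtingerBar (wirtinger u) z) := by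
      push_cast
      linear_combination (conj (u z) * (wirtinger (wirtinger u) z -
        2 * wirtingerBar (wirtinger u) z + wirtingerBar (wirtingerBar u) z)) * I_sq
    rw [this, re_ofReal_mul]
    ring
  rw [h3]
  exact div_nonpos_of_nonpos_of_nonneg (add_nonpos h1 h2) (by norm_num)

/-- An invariant continuous function which vanishes at the cusp attains its maximum modulus. -/
lemma exists_forall_norm_le {u : ℍ → ℂ} (hu : Continuous u)
    (hinv : ∀ (γ : SL(2, ℤ)) (z : ℍ), u (γ • z) = u z) (hlim : Tendsto u cuspStrip (𝓝 0))
    {z₀ : ℍ} (hz₀ : u z₀ ≠ 0) : ∃ z, u z ≠ 0 ∧ ∀ w, ‖u w‖ ≤ ‖u z‖ := by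
  obtain ⟨γ₀, hγ₀⟩ := ModularGroup.exists_smul_mem_fd z₀
  set w₀ := γ₀ • z₀
  have hw₀ : u w₀ ≠ 0 := by rwa [hinv]
  have hev : ∀ᶠ z in cuspStrip, ‖u z‖ < ‖u w₀‖ := by
    have := hlim.norm
    rw [norm_zero] at this
    exact this.eventually_lt_const (norm_pos_iff.mpr hw₀)
  rw [cuspStrip, eventually_inf_principal] at hev
  -- Above height Y the modulus stays below |u(w₀)|, so the maximum over the compact truncated
  -- fundamental domain is global.
  obtain ⟨Y, hY⟩ := (atImInfty_mem _).mp hev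
  have hmem : w₀ ∈ ModularGroup.truncatedFundamentalDomain Y := by
    refine ⟨hγ₀, ?_⟩
    by_contra! h
    exact lt_irrefl _ (hY w₀ h.le hγ₀.2)
  obtain ⟨z, -, hz⟩ := (ModularGroup.isCompact_truncatedFundamentalDomain Y).exists_isMaxOn
    ⟨w₀, hmem⟩ hu.norm.continuousOn
  have hz1 : ‖u w₀‖ ≤ ‖u z‖ := hz hmem
  refine ⟨z, norm_pos_iff.mp ((norm_pos_iff.mpr hw₀).trans_le hz1), fun w => ?_⟩
  obtain ⟨γ, hγ⟩ := ModularGroup.exists_smul_mem_fd w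
  rw [← hinv γ w]
  by_cases h : (γ • w).im ≤ Y
  · exact hz ⟨hγ, h⟩
  · exact (hY _ (not_le.mp h).le hγ.2).le.trans hz1

/-- A harmonic function of weights `(p, p)` whose constant term vanishes is zero. -/
lemma eq_zero_of_isHarmonic_of_tendsto {p : ℕ} (hp : 2 ≤ p) {f : ℍ → ℂ} (hf : IsSmooth 2 f)
    (hmod : IsBimodular p p f) (h : IsHarmonic p p f)
    (hlim : Tendsto (fun z => LL z ^ (p : ℤ) * f z) cuspStrip (𝓝 0)) : f = 0 := by
  set u : ℍ → ℂ := fun z => LL z ^ (p : ℤ) * f z with hu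
  have husm : IsSmooth 2 u := (IsSmooth.LL_zpow _).mul hf
  have hinv (γ : SL(2, ℤ)) (z : ℍ) : u (γ • z) = u z := by
    have := ((IsBimodular.LL_zpow (p : ℤ)).mul hmod) γ z
    simpa [hu] using this
  -- The harmonic equation transported to weights (0,0). Its constant p(p-1) is positive for p ≥ 2,
  -- which contradicts the sign of the Laplacian at a maximum.
  have hlap (z : ℍ) : ((4 * z.im ^ 2 : ℝ) : ℂ) * wirtingerBar (wirtinger u) z =
      ((p * (p - 1) : ℝ) : ℂ) * u z := by
    have h1 := congrFun (maassBar_maass_LL_zpow_mul hf p p p) z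
    have h2 := maassBar_maass husm le_rfl 0 0 z
    rw [IsHarmonic] at h
    rw [h] at h1
    simp only [sub_self] at h1 h2
    rw [h2, sub_conj_eq, ← neg_sub, sub_conj_eq] at h1
    simp only [Pi.smul_apply, smul_eq_mul] at h1
    push_cast at h1 ⊢
    rw [hu]
    linear_combination h1 + (4 * (z.im : ℂ) ^ 2 * wirtingerBar (wirtinger u) z) * I_sq
  by_contra hne
  obtain ⟨z₀, hz₀⟩ := Function.ne_iff.mp hne
  have hz₀' : u z₀ ≠ 0 := mul_ne_zero (zpow_ne_zero _ (LL_ne_zero z₀)) hz₀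
  obtain ⟨z, hz, hmax⟩ := exists_forall_norm_le husm.continuous hinv hlim hz₀'
  have h1 := re_conj_mul_laplacian_nonpos husm hmax
  have h2 := congrArg (fun x => (conj (u z) * x).re) (hlap z)
  simp only [mul_left_comm (conj (u z)), re_ofReal_mul] at h2
  rw [← Complex.normSq_eq_conj_mul_self, ofReal_re] at h2
  have h3 := Complex.normSq_pos.mpr hz
  have hy := z.im_pos
  have hp' : (2 : ℝ) ≤ p := by exact_mod_cast hp
  have h4 : 0 < (p * (p - 1) : ℝ) * Complex.normSq (u z) :=
    mul_pos (mul_pos (by linarith) (by linarith)) h3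
  have h5 : 4 * z.im ^ 2 * (conj (u z) * wirtingerBar (wirtinger u) z).re ≤ 0 :=
    mul_nonpos_of_nonneg_of_nonpos (by positivity) h1
  linarith

/-! ### Harmonic functions of positive weights -/

/-- The Eisenstein series has a positive constant term C, so subtracting a/C times it cancels the
constant term a of f; the maximum principle kills the difference. -/
lemma exists_eq_smul_eisSum_diag {p : ℕ} (hp : 2 ≤ p) {f : ℍ → ℂ} (hf : f ∈ MSpace p p)
    (h : IsHarmonic p p f) : ∃ c : ℂ, f = c • eisSum p p := by
  obtain ⟨a, ha⟩ := exists_tendsto_of_isHarmonic hp hf h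
  have hC : ((∑' q, eisConstTerm p q : ℝ) : ℂ) ≠ 0 :=
    ofReal_ne_zero.mpr (tsum_eisConstTerm_pos hp).ne'
  have hE := tendsto_LL_zpow_mul_eisSum hp
  set C := ((∑' q, eisConstTerm p q : ℝ) : ℂ)
  have hw : 3 ≤ (p : ℤ) + p := by omega
  have hfs : IsSmooth 2 f := MSpace.isSmooth hf
  have hEs : IsSmooth 2 (eisSum p p) := isSmooth_eisSum 2 hw
  have hg := eq_zero_of_isHarmonic_of_tendsto hp (hfs.add (hEs.smul (-(a / C))))
    (hf.2.1.add ((isBimodular_eisSum p p).smul _))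
    (h.add ((isHarmonic_eisSum hw).smul hEs _) hfs (hEs.smul _)) (by
      have := (ha.mono_left cuspStrip_le).add (hE.const_mul (-(a / C)))
      rw [mul_zero, add_zero] at this
      refine this.congr fun z => ?_
      simp only [Pi.add_apply, Pi.smul_apply, smul_eq_mul]
      field_simp
      ring)
  refine ⟨a / C, ?_⟩
  funext z
  have := congrFun hg z
  simp only [Pi.add_apply, Pi.smul_apply, Pi.zero_apply, smul_eq_mul] at this ⊢
  linear_combination this

/-- Descent to the diagonal: ∂_r shrinks s - r by two, and ∂̄_{s-1} recovers f from ∂_r f because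
r(s-1) ≠ 0. Both operators act on Eisenstein series by scalars and a shift of bidegree. -/
lemma exists_eq_smul_eisSum_of_le (n : ℕ) : ∀ {r s : ℤ}, 1 ≤ r → s = r + 2 * n → 4 ≤ r + s →
    ∀ {f : ℍ → ℂ}, f ∈ MSpace r s → IsHarmonic r s f → ∃ c : ℂ, f = c • eisSum r s := by
  induction n with
  | zero =>
    intro r s hr hs hw f hf h
    obtain rfl : s = r := by simpa using hs
    lift s to ℕ using by omega
    exact exists_eq_smul_eisSum_diag (by omega) hf h
  | succ n ih =>
    intro r s hr hs hw f hf h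
    have hfs : IsSmooth 3 f := MSpace.isSmooth hf
    obtain ⟨c, hc⟩ := ih (by omega) (by push_cast at hs; omega) (by omega) (MSpace.maass hf)
      (h.maass hfs)
    have h1 : IsHarmonic r s f := h
    rw [IsHarmonic, hc, maassBar_smul (isSmooth_eisSum 1 (by omega)) (by simp),
      maassBar_eisSum (by omega), add_sub_cancel_right, sub_add_cancel, smul_smul] at h1
    have hrs : ((r : ℂ) * (s - 1)) ≠ 0 := by
      have hs1 : s - 1 ≠ 0 := by push_cast at hs; omega
      refine mul_ne_zero (by exact_mod_cast (by omega : r ≠ 0)) (by exact_mod_cast hs1)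
    refine ⟨((r : ℂ) * (s - 1))⁻¹ * (c * ((s - 1 : ℤ) : ℂ)), ?_⟩
    rw [mul_smul, h1, smul_smul, inv_mul_cancel₀ hrs, one_smul]

/-- Harmonic functions of positive weights are multiples of Eisenstein series. -/
lemma exists_eq_smul_eisSum {r s : ℤ} (hr : 1 ≤ r) (hs : 1 ≤ s) (hw : 4 ≤ r + s)
    (heven : Even (r + s)) {f : ℍ → ℂ} (hf : f ∈ MSpace r s) (h : IsHarmonic r s f) :
    ∃ c : ℂ, f = c • eisSum r s := by
  obtain ⟨m, hm⟩ := heven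
  rcases le_total r s with hle | hle
  · exact exists_eq_smul_eisSum_of_le (m - r).toNat hr (by omega) hw hf h
  · obtain ⟨c, hc⟩ := exists_eq_smul_eisSum_of_le (m - s).toNat hs (by omega) (by omega)
      (MSpace.star hf) (h.star (MSpace.isSmooth hf))
    refine ⟨conj c, ?_⟩
    funext z
    have := congrArg conj (congrFun hc z)
    rwa [conj_conj, Pi.smul_apply, smul_eq_mul, map_mul, conj_eisSum] at this

lemma eisenstein_eq (a b : ℕ) : eisenstein a b =
    (((a + b).factorial : ℂ) / (2 * Real.pi * I) ^ (a + b + 2) * (1 / 2)) •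
      fun z => LL z * eisSum (a + 1) (b + 1) z := by
  funext z
  rw [eisenstein, Pi.smul_apply, smul_eq_mul, eisSum]
  congr 1
  rw [← tsum_mul_left]
  refine tsum_congr fun p => ?_
  rw [eisTerm, conj_linForm, div_eq_mul_inv, mul_inv]
  simp only [linForm, zpow_neg]
  norm_cast

/-! ### Generation by Eisenstein series and almost holomorphic modular forms -/

/-- The module over `ℂ[𝕃^±]` which contains all eigenfunctions. -/
def eigenSpan : Submodule LaurentL BigradedFun :=
  Submodule.span LaurentL
    (eisensteinSet ∪ (almostHolomorphic : Set BigradedFun) ∪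
      bigradedConj '' (almostHolomorphic : Set BigradedFun))

lemma inDeg_LL_zpow_mem (k : ℤ) : inDeg (-k) (-k) (fun z => LL z ^ k) ∈ LaurentL := by
  obtain ⟨n, rfl | rfl⟩ := k.eq_nat_or_neg
  · have h := LaurentL.pow_mem (Algebra.subset_adjoin (s := {LElt, LInvElt}) (Or.inl rfl)) n
    rw [LElt, inDeg_pow, mul_neg_one] at h
    convert h using 2
    funext z
    simp
  · have h := LaurentL.pow_mem (Algebra.subset_adjoin (s := {LElt, LInvElt}) (Or.inr rfl)) n
    rw [LInvElt, inDeg_pow, mul_one] at h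
    rw [neg_neg]
    convert h using 2
    funext z
    simp

lemma inDeg_LL_zpow_mul_mem {r s r' s' k : ℤ} {f : ℍ → ℂ} (h : inDeg r s f ∈ eigenSpan)
    (hr : r' = r - k) (hs : s' = s - k) : inDeg r' s' (fun z => LL z ^ k * f z) ∈ eigenSpan := by
  have h1 := eigenSpan.smul_mem ⟨_, inDeg_LL_zpow_mem k⟩ h
  rw [Subalgebra.smul_def, smul_eq_mul, inDeg_mul] at h1
  subst hr hs
  rw [← neg_add_eq_sub, ← neg_add_eq_sub]
  exact h1

lemma LL_zpow_mul_LL_zpow_neg_mul (k : ℤ) (f : ℍ → ℂ) :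
    (fun z => LL z ^ k * (LL z ^ (-k) * f z)) = f := by
  funext z
  rw [← mul_assoc, ← zpow_add₀ (LL_ne_zero z), add_neg_cancel, zpow_zero, one_mul]

lemma inDeg_mem_of_LL_zpow_neg_mul {r s r' s' k : ℤ} {f : ℍ → ℂ}
    (h : inDeg r s (fun z => LL z ^ (-k) * f z) ∈ eigenSpan) (hr : r' = r - k) (hs : s' = s - k) :
    inDeg r' s' f ∈ eigenSpan := by
  have := inDeg_LL_zpow_mul_mem h hr hs
  rwa [LL_zpow_mul_LL_zpow_neg_mul] at this

lemma inDeg_smul_mem {r s : ℤ} {f : ℍ → ℂ} (c : ℂ) (h : inDeg r s f ∈ eigenSpan) :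
    inDeg r s (c • f) ∈ eigenSpan := by
  rw [inDeg_smul, ← algebraMap_smul LaurentL c (inDeg r s f)]
  exact eigenSpan.smul_mem _ h

lemma almostHolomorphic_le {x : BigradedFun} (hx : x ∈ almostHolomorphic) : x ∈ eigenSpan :=
  Submodule.subset_span (Or.inl (Or.inr hx))

lemma bigradedConj_mem {x : BigradedFun} (hx : x ∈ almostHolomorphic) :
    bigradedConj x ∈ eigenSpan :=
  Submodule.subset_span (Or.inr ⟨x, hx, rfl⟩)

lemma inDeg_LL_zpow_neg_mul_mem {r : ℤ} {n : ℕ} (hr : 2 ≤ r - n) {f : ℍ → ℂ}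
    (hf : f ∈ MSpace r (-n)) (h : IsHarmonic r (-n) f) :
    inDeg (r + n) 0 (fun z => LL z ^ (-n : ℤ) * f z) ∈ almostHolomorphic := by
  have hg := MSpace.LL_zpow_mul hf (-n)
  rw [sub_neg_eq_add, sub_self] at hg
  refine mem_almostHolomorphic_of_lower_iterate (n + 2) (MSpace.isSmooth hg) hg.2.1 (fun j => ?_)
    (lower_iterate_LL_zpow_mul_eq_zero n hr hf h)
  exact MSpace.exists_bound (MSpace.lower_iterate hg j)

lemma inDeg_eisSum_mem {r s : ℤ} (hr : 1 ≤ r) (hs : 1 ≤ s) (hw : 4 ≤ r + s)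
    (heven : Even (r + s)) : inDeg r s (eisSum r s) ∈ eigenSpan := by
  obtain ⟨a, rfl⟩ : ∃ a : ℕ, r = a + 1 := ⟨(r - 1).toNat, by omega⟩
  obtain ⟨b, rfl⟩ : ∃ b : ℕ, s = b + 1 := ⟨(s - 1).toNat, by omega⟩
  have hab : Even (a + b) := by
    obtain ⟨m, hm⟩ := heven
    exact ⟨(m - 1).toNat, by omega⟩
  have hmem : inDeg a b (eisenstein a b) ∈ eigenSpan :=
    Submodule.subset_span (Or.inl (Or.inl ⟨a, b, by omega, hab, rfl⟩))
  set c : ℂ := ((a + b).factorial : ℂ) / (2 * Real.pi * I) ^ (a + b + 2) * (1 / 2) with hc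
  have hc0 : c ≠ 0 := by
    refine mul_ne_zero (div_ne_zero ?_ (pow_ne_zero _ Complex.two_pi_I_ne_zero)) (by norm_num)
    exact_mod_cast Nat.factorial_ne_zero (a + b)
  have h1 := inDeg_smul_mem c⁻¹ hmem
  rw [eisenstein_eq, ← hc, smul_smul, inv_mul_cancel₀ hc0, one_smul] at h1
  refine inDeg_mem_of_LL_zpow_neg_mul (k := -1) (r := a) (s := b) ?_ (by ring) (by ring)
  simpa using h1

/-- Harmonic functions are generated by Eisenstein series and almost holomorphic modular forms. -/
lemma inDeg_mem_of_isHarmonic {r s : ℤ} (hw : 2 ≤ r + s) (heven : Even (r + s)) {f : ℍ → ℂ}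
    (hf : f ∈ MSpace r s) (h : IsHarmonic r s f) : inDeg r s f ∈ eigenSpan := by
  rcases le_or_gt s 0 with hs | hs
  · obtain ⟨n, rfl⟩ : ∃ n : ℕ, s = -n := ⟨(-s).toNat, by omega⟩
    exact inDeg_mem_of_LL_zpow_neg_mul
      (almostHolomorphic_le (inDeg_LL_zpow_neg_mul_mem (by omega) hf h)) (by ring) (by ring)
  rcases le_or_gt r 0 with hr | hr
  · obtain ⟨n, rfl⟩ : ∃ n : ℕ, r = -n := ⟨(-r).toNat, by omega⟩
    have h1 := bigradedConj_mem (inDeg_LL_zpow_neg_mul_mem (by omega) (MSpace.star hf)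
      (h.star (MSpace.isSmooth hf)))
    rw [bigradedConj_inDeg] at h1
    simp only [map_mul, map_zpow₀, conj_LL, conj_conj] at h1
    exact inDeg_mem_of_LL_zpow_neg_mul h1 (by ring) (by ring)
  -- With both weights positive and an even sum, (1,1) is the only case outside the range of
  -- absolute convergence of the Eisenstein series.
  by_cases h4 : 4 ≤ r + s
  · obtain ⟨c, rfl⟩ := exists_eq_smul_eisSum hr hs h4 heven hf h
    exact inDeg_smul_mem c (inDeg_eisSum_mem hr hs h4 heven)
  · obtain ⟨m, hm⟩ := heven
    obtain rfl : r = 1 := by omega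
    obtain rfl : s = 1 := by omega
    obtain ⟨c, rfl⟩ := eq_const_of_isHarmonic_one_one hf h
    refine inDeg_smul_mem c ?_
    have h1 := inDeg_LL_zpow_mul_mem (k := -1) (r' := 1) (s' := 1)
      (almostHolomorphic_le almostHolomorphic.one_mem : inDeg 0 0 1 ∈ eigenSpan) (by norm_num)
      (by norm_num)
    simpa using h1

/-! ### From harmonic functions to eigenfunctions -/

/-- The reflection k ↦ 1-(r+s)-k preserves k(k+r+s-1) and replaces r+s+2k by 2-(r+s+2k). As this
number is even, one of the two choices is at least 2, and for it 𝕃^{-k} f is harmonic of total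
weight at least two. -/
lemma inDeg_mem_of_laplace {r s : ℤ} {f : ℍ → ℂ} (hf : f ∈ MSpace r s) {lam : ℂ}
    (h : laplace r s f = lam • f) : inDeg r s f ∈ eigenSpan := by
  by_cases h0 : f = 0
  · rw [h0, inDeg_zero]; exact eigenSpan.zero_mem
  obtain ⟨m, hm⟩ := hf.2.1.even_of_ne_zero h0
  obtain ⟨k, hk, hlam⟩ : ∃ k : ℤ, 2 ≤ r + s + 2 * k ∧ lam = -(k * (k + r + s - 1)) := by
    obtain ⟨k, hk⟩ := exists_eigenvalue_eq hf h0 h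
    by_cases hle : 2 ≤ r + s + 2 * k
    · exact ⟨k, hle, hk⟩
    · refine ⟨1 - (r + s) - k, by omega, hk.trans ?_⟩
      push_cast
      ring
  have hg := MSpace.LL_zpow_mul hf (-k)
  rw [sub_neg_eq_add, sub_neg_eq_add] at hg
  refine inDeg_mem_of_LL_zpow_neg_mul (k := k) (inDeg_mem_of_isHarmonic (by omega)
    ⟨m + k, by omega⟩ hg (isHarmonic_of_laplace (MSpace.isSmooth hf) (hlam ▸ h))) (by ring) (by ring)

lemma eq_sum_inDeg (F : BigradedFun) : F = ∑ p ∈ F.coeff.support, inDeg p.1 p.2 (F.coeff p) := by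
  exact (AddMonoidAlgebra.sum_coeff_single F).symm

lemma coeff_bigradedLaplace (F : BigradedFun) {p : ℤ × ℤ} (hp : p ∈ F.coeff.support) :
    (bigradedLaplace F).coeff p = laplace p.1 p.2 (F.coeff p) := by
  classical
  rw [bigradedLaplace, AddMonoidAlgebra.coeff_sum, Finsupp.finsetSum_apply]
  refine (Finset.sum_eq_single_of_mem p hp fun q _ hq => ?_).trans Finsupp.single_eq_same
  exact Finsupp.single_eq_of_ne hq.symm

lemma laplace_coeff_of_isEigenfunction {F : BigradedFun} {lam : ℂ} (hF : IsEigenfunction F lam)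
    {p : ℤ × ℤ} (hp : p ∈ F.coeff.support) :
    laplace p.1 p.2 (F.coeff p) = lam • F.coeff p := by
  rw [← coeff_bigradedLaplace F hp, hF.2.2]
  rfl

theorem IsEigenfunction.integral_and_mem_eigenSpan {F : BigradedFun} {lam : ℂ}
    (hF : IsEigenfunction F lam) : (∃ n : ℤ, lam = n) ∧ F ∈ eigenSpan := by
  constructor
  · obtain ⟨p, hp⟩ : F.coeff.support.Nonempty := by
      rw [Finsupp.support_nonempty_iff]
      intro h
      exact hF.2.1 (by ext p; rw [h]; rfl)
    obtain ⟨k, hk⟩ := exists_eigenvalue_eq (hF.1 p.1 p.2) (Finsupp.mem_support_iff.mp hp)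
      (laplace_coeff_of_isEigenfunction hF hp)
    exact ⟨-(k * (k + p.1 + p.2 - 1)), by rw [hk]; push_cast; ring⟩
  · rw [eq_sum_inDeg F]
    exact eigenSpan.sum_mem fun p hp =>
      inDeg_mem_of_laplace (hF.1 p.1 p.2) (laplace_coeff_of_isEigenfunction hF hp)

end BigradedModular

end

theorem mainTheorem3 (F : BigradedModular.BigradedFun) (lam : ℂ)
    (hF : BigradedModular.IsEigenfunction F lam) :
    (∃ n : ℤ, lam = n) ∧
      F ∈ Submodule.span BigradedModular.LaurentL
        (BigradedModular.eisensteinSet ∪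
          (BigradedModular.almostHolomorphic : Set BigradedModular.BigradedFun) ∪
          BigradedModular.bigradedConj ''
            (BigradedModular.almostHolomorphic : Set BigradedModular.BigradedFun)) :=
  hF.integral_and_mem_eigenSpan
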